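/- **Setting.** Let either (D) $\Omega\subset\mathbb R^3$ be a bounded smooth domain (Dirichlet boundary conditions), or (P) $\Omega=\mathbb T^3=[0,2\pi]^3$ (periodic boundary conditions). All functions are real-valued. Let $\mathcal D$ be $C_0^\infty(\Omega)$ in case (D) and the space of smooth $2\pi$-periodic functions in case (P); let $H^1_0(\Omega)$ be the closure of $\mathcal D$ in the norm $\|u\|_{H^1}^2=\|u\|_{L^2}^2+\|\nabla u\|_{L^2}^2$ (so it is $H^1(\mathbb T^3)$ in case (P)), and $\mathcal E=H^1_0(\Omega)\times L^2(\Omega)$ with $\|(u,v)\|_{\mathcal E}^2=\|u\|_{H^1}^2+\|v\|_{L^2}^2$. Let $0\le\lambda_1\le\lambda_2\le\cdots$ be the eigenvalues of $-\Delta_x$ with the given boundary conditions and $\{e_i\}$ a corresponding orthonormal eigenbasis of $L^2(\Omega)$, and put $$\|w\|_{H^s_\Delta}^2=\sum_i(1+\lambda_i)^s(w,e_i)^2,\qquad (-\Delta_x)^\theta w=\sum_i\lambda_i^\theta (w,e_i)e_i .$$ Let $\alpha,\gamma>0$ and let $f\in C^1(\mathbb R)$ satisfy, for some constants $C,\kappa,K>0$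 and all $s\in\mathbb R$, $$f(s)s\ge -C+\kappa|s|^2,\qquad f'(s)\ge -K,\qquad |f'(s)|\le C(1+|s|^4).$$ For $g\in L^2(\Omega)$ and $(u_0,u_1)\in\mathcal E$ consider $$\partial_t^2u+\gamma(-\Delta_x)^{1/2}\partial_tu+\alpha\partial_tu-\Delta_xu+f(u)=g,\qquad u|_{t=0}=u_0,\quad \partial_tu|_{t=0}=u_1. \tag{1}$$ A *weak energy solution* of (1) is a function $\xi_u=(u,\partial_tu):[0,\infty)\to\mathcal E$, weakly continuous in $\mathcal E$, where $\partial_tu$ is the distributional time derivative of $u$, such that $\xi_u(0)=(u_0,u_1)$ and, for every $T>0$, $\xi_u\in L^\infty(0,T;\mathcal E)$, $\partial_tu\in L^2(0,T;H^{1/2}_\Delta)$ and, for all $\phi\in C_0^\infty((0,T)\times\Omega)$, $$-\int_0^T(\partial_tu,\partial_t\phi)\,dt+\int_0^T(\nabla u,\nabla\phi)\,dt+\alpha\int_0^T(\partial_tu,\phi)\,dt+\gamma\int_0^T(\partial_tu,(-\Delta_x)^{1/2}\phi)\,dt+\int_0^T(f(u),\phi)\,dt=\int_0^T(g,\phi)\,dt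 .$$ **Theorem.** There exist $\beta>0$ and a nondecreasing function $Q:\mathbb R\to\mathbb R$, depending only on $\Omega$, the boundary conditions, $f$, $\alpha$ and $\gamma$, such that for all $g\in L^2(\Omega)$ and all $\xi_0=(u_0,u_1)\in\mathcal E$ problem (1) has at least one weak energy solution $\xi_u$ that satisfies, for all $t\ge0$, $$\|\xi_u(t)\|_{\mathcal E}^2+\int_t^{t+1}\|\partial_tu(s)\|_{H^{1/2}_\Delta}^2\,ds\le Q(\|\xi_0\|_{\mathcal E})\,e^{-\beta t}+Q(\|g\|_{L^2(\Omega)}).$$ -/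

import Mathlib

open MeasureTheory Set
open scoped ContDiff ENNReal InnerProductSpace

noncomputable section

namespace DampedWave

/-- The physical space `ℝ³` with its Euclidean norm and Lebesgue measure. -/
abbrev R3 : Type := EuclideanSpace ℝ (Fin 3)

/-- `Ω` is a bounded smooth domain: open, connected, bounded, and near each boundary point it is
the sublevel set `{ψ < 0}` of a smooth function with non-vanishing differential at that point. -/
structure IsBoundedSmoothDomain (Ω : Set R3) : Prop where
  isOpen : IsOpen Ω
  isConnected : IsConnected Ω
  isBounded : Bornology.IsBounded Ω
  smooth_boundary : ∀ x₀ ∈ frontier Ω, ∃ (U : Set R3) (ψ : R3 → ℝ),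
    IsOpen U ∧ x₀ ∈ U ∧ ContDiff ℝ ∞ ψ ∧ fderiv ℝ ψ x₀ ≠ 0 ∧ Ω ∩ U = {x ∈ U | ψ x < 0}

/-- The two boundary value problems: Dirichlet conditions in a set `Ω`, or periodic conditions
(the torus `[0, 2π]³`). -/
inductive Problem : Type
  | dirichlet (Ω : Set R3)
  | periodic

namespace Problem

/-- The only requirement: in the Dirichlet case `Ω` is a bounded smooth domain. -/
def IsAdmissible : Problem → Prop
  | dirichlet Ω => IsBoundedSmoothDomain Ω
  | periodic => True

/-- The set over which spatial integrals are taken: `Ω`, or the periodicity cell `[0, 2π]³`. -/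
def domain : Problem → Set R3
  | dirichlet Ω => Ω
  | periodic => {x | ∀ i, x i ∈ Icc 0 (2 * Real.pi)}

/-- `2π`-periodicity in each coordinate. -/
def IsPeriodic (φ : R3 → ℝ) : Prop :=
  ∀ (i : Fin 3) (x : R3), φ (x + EuclideanSpace.single i (2 * Real.pi)) = φ x

/-- Spatial test functions: `C₀^∞(Ω)` (extended by zero to `ℝ³`) in the Dirichlet case, and
`C^∞(𝕋³)`, i.e. the smooth `2π`-periodic functions, in the periodic case. -/
def IsTest : Problem → (R3 → ℝ) → Prop
  | dirichlet Ω, φ => ContDiff ℝ ∞ φ ∧ HasCompactSupport φ ∧ tsupport φ ⊆ Ω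
  | periodic, φ => ContDiff ℝ ∞ φ ∧ IsPeriodic φ

/-- Space-time test functions: `C₀^∞((0,T) × Ω)`, respectively `C₀^∞((0,T) × 𝕋³)`; in the latter
case the support is compact because its projection to the time axis is contained in a compact
subinterval of `(0,T)`. -/
def IsSpaceTimeTest : Problem → ℝ → (ℝ × R3 → ℝ) → Prop
  | dirichlet Ω, T, φ => ContDiff ℝ ∞ φ ∧ HasCompactSupport φ ∧ tsupport φ ⊆ Ioo 0 T ×ˢ Ω
  | periodic, T, φ => ContDiff ℝ ∞ φ ∧ (∀ t, IsPeriodic fun x => φ (t, x)) ∧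
      ∃ a b : ℝ, 0 < a ∧ b < T ∧ ∀ t x, t ∉ Icc a b → φ (t, x) = 0

variable (P : Problem)

/-- Lebesgue measure on the domain. -/
abbrev μ : Measure R3 := volume.restrict P.domain

/-- `L²(Ω)`, real-valued. -/
abbrev L2 : Type := Lp ℝ 2 P.μ

/-- `L²(Ω; ℝ³)`, where gradients live. -/
abbrev L2vec : Type := Lp R3 2 P.μ

/-- The space `H¹₀(Ω)` (`H¹(𝕋³)` in the periodic case): the closure of the test functions in the
`H¹`-metric. A function `u` is represented by the pair `(u, ∇u)`, so that the norm inherited from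
`L² × L²` is the `H¹`-norm: `‖u‖² = ‖u‖²_{L²} + ‖∇u‖²_{L²}`. (The set whose span is taken
is already a linear subspace.) -/
def H1 : Submodule ℝ (WithLp 2 (P.L2 × P.L2vec)) :=
  (Submodule.span ℝ {a : WithLp 2 (P.L2 × P.L2vec) | ∃ φ : R3 → ℝ, P.IsTest φ ∧
    a.fst =ᵐ[P.μ] φ ∧ a.snd =ᵐ[P.μ] fun x => gradient φ x}).topologicalClosure

variable {P} in
/-- The function underlying an element of `H¹₀(Ω)`. -/
def H1.toL2 (w : P.H1) : P.L2 := w.1.fst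

variable {P} in
/-- The (weak) gradient of an element of `H¹₀(Ω)`. -/
def H1.grad (w : P.H1) : P.L2vec := w.1.snd

/-- The energy space `H¹₀(Ω) × L²(Ω)`, with `‖(u, v)‖² = ‖u‖²_{H¹} + ‖v‖²_{L²}`. -/
abbrev Energy : Type := WithLp 2 (P.H1 × P.L2)

/-- The eigenspace of `-Δ` (with the given boundary conditions) for the number `l`: all
`w` in `H¹₀(Ω)` with `(∇w, ∇z) = l (w, z)` for all `z` in `H¹₀(Ω)`, as a subspace of `L²(Ω)`.
It is zero unless `l` is an eigenvalue. (The set of these `w` is already a closed subspace; span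
and closure are written only to make this evident.) -/
def eigenspace (l : ℝ) : Submodule ℝ P.L2 :=
  (Submodule.span ℝ {e : P.L2 | ∃ w : P.H1, H1.toL2 w = e ∧
    ∀ z : P.H1, ⟪H1.grad w, H1.grad z⟫_ℝ = l * ⟪H1.toL2 w, H1.toL2 z⟫_ℝ}).topologicalClosure

instance (l : ℝ) : CompleteSpace (P.eigenspace l) := by
  unfold eigenspace; infer_instance

/-- The orthogonal projection of `L²(Ω)` onto the eigenspace for `l`. In terms of an orthonormal
eigenbasis `e_i` with eigenvalues `λ_i` it is `w ↦ ∑_{λ_i = l} (w, e_i) e_i`. -/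
def eigenproj (l : ℝ) : P.L2 →L[ℝ] P.L2 := (P.eigenspace l).starProjection

/-- `‖w‖²_{H^s_Δ} = ∑_i (1 + λ_i)^s (w, e_i)²`, grouped by distinct eigenvalues. For `s ≥ 0`, a
function `w ∈ L²(Ω)` belongs to `H^s_Δ` if and only if this is finite. -/
def hsNormSq (s : ℝ) (w : P.L2) : ℝ≥0∞ :=
  ∑' l : ℝ, ENNReal.ofReal ((1 + l) ^ s) * ‖P.eigenproj l w‖ₑ ^ 2

/-- The fractional Laplacian `(-Δ)^θ w = ∑_i λ_i^θ (w, e_i) e_i`, grouped by distinct eigenvalues;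
it is applied with `θ = 1/2` to test functions, for which the series converges in `L²(Ω)`. -/
def fracLap (θ : ℝ) (w : P.L2) : P.L2 :=
  ∑' l : ℝ, l ^ θ • P.eigenproj l w

open Classical in
/-- The class in `L²(Ω)` of a square-integrable function. -/
def classL2 (φ : R3 → ℝ) : P.L2 :=
  if h : MemLp φ 2 P.μ then h.toLp φ else 0

/-- `ξ = (u, ∂ₜu)` is a weak energy solution on `[0, ∞)` of
`∂ₜ²u + γ (-Δ)^{1/2} ∂ₜu + α ∂ₜu - Δu + f(u) = g` with initial data `ξ₀ = (u₀, u₁)`.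
As usual, `ξ` denotes the weakly continuous representative, which gives a meaning to `ξ t` for every
`t ≥ 0`, in particular to the initial condition. Only the values `ξ t` with `t ≥ 0` matter. -/
structure IsWeakEnergySolution (f : ℝ → ℝ) (γ α : ℝ) (g : P.L2) (ξ₀ : P.Energy)
    (ξ : ℝ → P.Energy) : Prop where
  /-- `ξ ∈ L^∞(0, T; 𝓔)` -/
  bounded : ∀ T > 0, MemLp ξ ∞ (volume.restrict (Ioo 0 T))
  /-- the second component is the distributional time derivative of the first -/
  time_deriv : ∀ T > 0, ∀ φ, P.IsSpaceTimeTest T φ →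
    ∫ t in Ioo 0 T, ∫ x in P.domain, (H1.toL2 (ξ t).fst) x * deriv (fun s => φ (s, x)) t =
      -∫ t in Ioo 0 T, ∫ x in P.domain, (ξ t).snd x * φ (t, x)
  /-- `∂ₜu ∈ L²(0, T; H^{1/2}_Δ)` -/
  dissipation : ∀ T > 0, ∫⁻ t in Ioo 0 T, P.hsNormSq (1 / 2) (ξ t).snd < ⊤
  /-- `ξ` is weakly continuous with values in `𝓔` -/
  weak_continuous : ∀ η : P.Energy, ContinuousOn (fun t => ⟪η, ξ t⟫_ℝ) (Ici 0)
  /-- the initial condition -/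
  initial : ξ 0 = ξ₀
  /-- the equation in the sense of distributions -/
  equation : ∀ T > 0, ∀ φ, P.IsSpaceTimeTest T φ →
    -(∫ t in Ioo 0 T, ∫ x in P.domain, (ξ t).snd x * deriv (fun s => φ (s, x)) t)
      + (∫ t in Ioo 0 T, ∫ x in P.domain,
          ⟪(H1.grad (ξ t).fst) x, gradient (fun y => φ (t, y)) x⟫_ℝ)
      + α * (∫ t in Ioo 0 T, ∫ x in P.domain, (ξ t).snd x * φ (t, x))
      + γ * (∫ t in Ioo 0 T,
          ⟪(ξ t).snd, P.fracLap (1 / 2) (P.classL2 fun x => φ (t, x))⟫_ℝ)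
      + (∫ t in Ioo 0 T, ∫ x in P.domain, f ((H1.toL2 (ξ t).fst) x) * φ (t, x))
      = ∫ t in Ioo 0 T, ∫ x in P.domain, g x * φ (t, x)

end Problem

/-- The growth and dissipativity assumptions on the nonlinearity. -/
structure IsQuinticDissipative (f : ℝ → ℝ) : Prop where
  contDiff : ContDiff ℝ 1 f
  bounds : ∃ C κ K : ℝ, 0 < C ∧ 0 < κ ∧ 0 < K ∧
    (∀ s, -C + κ * |s| ^ 2 ≤ f s * s) ∧ (∀ s, -K ≤ deriv f s) ∧
    (∀ s, |deriv f s| ≤ C * (1 + |s| ^ 4))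

end DampedWave

end

noncomputable section

namespace DampedWave

open Filter Topology

/-! ### Eigenfunction expansions for a compact embedding of Hilbert spaces -/

section SpectralTheory

open Module.End

section Orthogonal

variable {X : Type*} [NormedAddCommGroup X] [InnerProductSpace ℝ X]

/-! With A = -Δ the equation reads u'' + γ A^{1/2} u' + α u' + A u + f(u) = g, and the solution is a
limit of Galerkin approximations. Let V be H¹₀, H be L², and ι : V → H the embedding. It is
injective with dense range and compact (`isCompactOperator_embed`), so ιι* = (1 + A)⁻¹ is a compact
injective symmetric operator. The spectral theorem then gives eigenfunction expansions converging in
H and in V (`hasSum_specProj`, `hasSum_specLift`).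

Two approximations are made at once: projection to finitely many eigenspaces, and replacement of f
by globally Lipschitz functions that keep its dissipativity and one-sided bounds uniformly
(`IsQuinticDissipative.exists_truncation`). The first makes A bounded, the second makes u ↦ p ∘ u a
Lipschitz gradient field on H, so the Galerkin systems have global solutions.

The uniform estimate comes from testing with u' + δ u. For small δ the functional E = ½‖u'‖² +
½‖A^{1/2}u‖² + ∫ F(u) - (g, u) + δ (u, u') + (δα/2)‖u‖² + (δγ/2)‖A^{1/4}u‖² satisfies E' ≤ -β E -
(γ‖A^{1/4}u'‖² + (α/4)‖u'‖²) + K (1 + ‖g‖²). It bounds the energy norm from above up to a constant,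
and initially it is bounded by a sextic polynomial of the data. Gronwall's inequality gives the
exponential decay, and integration over unit intervals gives the dissipation integral
(`exists_galerkin_estimate`).

For the limit, ι u and (1 + A)⁻¹ u' are equi-Lipschitz paths in fixed compact sets, so a subsequence
converges at every time; by boundedness this is weak convergence in V and H
(`exists_subseq_tendsto_path`). The delicate term is ∫ f(u) z, because the embedding V ⊂ L⁶ makes
the quintic growth just admissible, without compactness. Since the test functions converge strongly
in V, Young's inequality with a small weight on u reduces the convergence to a Vitali argument
(`IsTruncation.isApproximation`). The estimate survives the limit by lower semicontinuity, so it is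
obtained for the constructed solution; no uniqueness is involved. -/

theorem norm_sq_sum_of_orthogonal {κ : Type*} (y : κ → X)
    (hy : ∀ i j, i ≠ j → ⟪y i, y j⟫_ℝ = 0) (s : Finset κ) :
    ‖∑ i ∈ s, y i‖ ^ 2 = ∑ i ∈ s, ‖y i‖ ^ 2 := by
  classical
  rw [← real_inner_self_eq_norm_sq, sum_inner]
  refine Finset.sum_congr rfl fun i hi => ?_
  rw [inner_sum, Finset.sum_eq_single i, real_inner_self_eq_norm_sq]
  · exact fun j _ hj => hy i j hj.symm
  · exact fun h => absurd hi h

theorem summable_of_orthogonal [CompleteSpace X] {κ : Type*} {y : κ → X}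
    (hy : ∀ i j, i ≠ j → ⟪y i, y j⟫_ℝ = 0) (hs : Summable fun i => ‖y i‖ ^ 2) : Summable y := by
  rw [summable_iff_vanishing_norm] at hs ⊢
  intro ε hε
  obtain ⟨s, h⟩ := hs (ε ^ 2) (by positivity)
  refine ⟨s, fun t ht => ?_⟩
  have h1 := h t ht
  rw [Real.norm_of_nonneg (Finset.sum_nonneg fun _ _ => by positivity),
    ← norm_sq_sum_of_orthogonal y hy] at h1
  exact lt_of_pow_lt_pow_left₀ 2 hε.le h1

/-- Bessel's inequality without normalisation: ⟪y i, x⟫ = ‖y i‖² says that y i is the orthogonal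
projection of x to its own line. It is applied to spectral projections in `H` and again in `V`. -/
theorem sum_norm_sq_le_of_orthogonal {κ : Type*} {y : κ → X} {x : X}
    (hy : ∀ i j, i ≠ j → ⟪y i, y j⟫_ℝ = 0) (hx : ∀ i, ⟪y i, x⟫_ℝ = ‖y i‖ ^ 2) (s : Finset κ) :
    ∑ i ∈ s, ‖y i‖ ^ 2 ≤ ‖x‖ ^ 2 := by
  have h1 : ⟪∑ i ∈ s, y i, x⟫_ℝ = ∑ i ∈ s, ‖y i‖ ^ 2 := by
    rw [sum_inner]; exact Finset.sum_congr rfl fun i _ => hx i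
  have h2 := norm_sub_sq_real x (∑ i ∈ s, y i)
  rw [real_inner_comm, h1, norm_sq_sum_of_orthogonal y hy] at h2
  nlinarith [sq_nonneg ‖x - ∑ i ∈ s, y i‖]

theorem summable_norm_sq_of_orthogonal {κ : Type*} {y : κ → X} {x : X}
    (hy : ∀ i j, i ≠ j → ⟪y i, y j⟫_ℝ = 0) (hx : ∀ i, ⟪y i, x⟫_ℝ = ‖y i‖ ^ 2) :
    Summable fun i => ‖y i‖ ^ 2 :=
  summable_of_sum_le (fun _ => by positivity) (sum_norm_sq_le_of_orthogonal hy hx)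

end Orthogonal

section Spectral

variable {V H : Type*} [NormedAddCommGroup V] [InnerProductSpace ℝ V] [CompleteSpace V]
  [NormedAddCommGroup H] [InnerProductSpace ℝ H] [CompleteSpace H]

/-- A compact injective contraction of Hilbert spaces with dense range. -/
structure IsCompactEmbedding (ι : V →L[ℝ] H) : Prop where
  compact : IsCompactOperator ι
  injective : Function.Injective ι
  denseRange : DenseRange ι
  norm_le : ∀ w, ‖ι w‖ ≤ ‖w‖

/-- The solution operator `ι ι*` of `⟪w, z⟫_V = ⟪h, ι z⟫`; it is `(1 - Δ)⁻¹` in the application. -/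
def greenOp (ι : V →L[ℝ] H) : H →L[ℝ] H := ι ∘L ι.adjoint

/-- The eigenspace of `(ι ι*)⁻¹ - 1` for the number `l`. -/
def specSpace (ι : V →L[ℝ] H) (l : ℝ) : Submodule ℝ H :=
  Module.End.eigenspace (greenOp ι).toLinearMap (1 + l)⁻¹

theorem mem_specSpace {ι : V →L[ℝ] H} {l : ℝ} {h : H} :
    h ∈ specSpace ι l ↔ greenOp ι h = (1 + l)⁻¹ • h := by
  rw [specSpace, Module.End.mem_eigenspace_iff]; rfl

theorem isClosed_specSpace (ι : V →L[ℝ] H) (l : ℝ) : IsClosed (specSpace ι l : Set H) := by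
  have : (specSpace ι l : Set H) = {h | greenOp ι h = (1 + l)⁻¹ • h} := by
    ext h; exact mem_specSpace
  rw [this]
  exact isClosed_eq (by fun_prop) (by fun_prop)

instance (ι : V →L[ℝ] H) (l : ℝ) : CompleteSpace (specSpace ι l) :=
  (isClosed_specSpace ι l).completeSpace_coe

/-- The orthogonal projection onto `specSpace ι l`. -/
def specProj (ι : V →L[ℝ] H) (l : ℝ) : H →L[ℝ] H := (specSpace ι l).starProjection

/-- The projection onto `specSpace ι l` with values in `V`. -/
def specLift (ι : V →L[ℝ] H) (l : ℝ) : H →L[ℝ] V := (1 + l) • (ι.adjoint ∘L specProj ι l)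

variable {ι : V →L[ℝ] H}

theorem inner_greenOp_left (h k : H) : ⟪greenOp ι h, k⟫_ℝ = ⟪ι.adjoint h, ι.adjoint k⟫_ℝ := by
  rw [greenOp, ContinuousLinearMap.comp_apply, ContinuousLinearMap.adjoint_inner_right]

theorem greenOp_isSymmetric (ι : V →L[ℝ] H) : (greenOp ι).toLinearMap.IsSymmetric := fun h k => by
  change ⟪greenOp ι h, k⟫_ℝ = ⟪h, greenOp ι k⟫_ℝ
  rw [inner_greenOp_left, real_inner_comm, ← inner_greenOp_left, real_inner_comm]

theorem specProj_mem (l : ℝ) (h : H) : specProj ι l h ∈ specSpace ι l :=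
  Submodule.starProjection_apply_mem _ _

theorem specProj_eq_self {l : ℝ} {h : H} (hh : h ∈ specSpace ι l) : specProj ι l h = h :=
  Submodule.starProjection_eq_self_iff.2 hh

theorem specProj_specProj (l : ℝ) (h : H) : specProj ι l (specProj ι l h) = specProj ι l h :=
  specProj_eq_self (specProj_mem l h)

theorem inner_specProj_left (l : ℝ) (h k : H) :
    ⟪specProj ι l h, k⟫_ℝ = ⟪h, specProj ι l k⟫_ℝ :=
  Submodule.inner_starProjection_left_eq_right _ _ _

theorem inner_specProj_self (l : ℝ) (h : H) : ⟪specProj ι l h, h⟫_ℝ = ‖specProj ι l h‖ ^ 2 := by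
  rw [← real_inner_self_eq_norm_sq, inner_specProj_left l h (specProj ι l h), specProj_specProj,
    real_inner_comm]

theorem greenOp_specProj (l : ℝ) (h : H) :
    greenOp ι (specProj ι l h) = (1 + l)⁻¹ • specProj ι l h :=
  mem_specSpace.1 (specProj_mem l h)

theorem inner_specProj_of_ne {l m : ℝ} (hlm : l ≠ m) (h k : H) :
    ⟪specProj ι l h, specProj ι m k⟫_ℝ = 0 := by
  have hne : (1 + l)⁻¹ ≠ (1 + m)⁻¹ := fun h => hlm (by simpa using inv_injective h)
  exact (greenOp_isSymmetric ι).orthogonalFamily_eigenspaces hne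
    ⟨_, specProj_mem l h⟩ ⟨_, specProj_mem m k⟩

theorem specProj_specProj_of_ne {l m : ℝ} (hlm : l ≠ m) (h : H) :
    specProj ι l (specProj ι m h) = 0 := by
  rw [← inner_self_eq_zero (𝕜 := ℝ), inner_specProj_left, specProj_specProj,
    real_inner_comm, inner_specProj_of_ne hlm]

theorem specProj_greenOp (l : ℝ) (h : H) :
    specProj ι l (greenOp ι h) = (1 + l)⁻¹ • specProj ι l h := by
  refine ext_inner_right ℝ fun k => ?_
  have h1 : ⟪greenOp ι h, specProj ι l k⟫_ℝ = ⟪h, greenOp ι (specProj ι l k)⟫_ℝ :=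
    greenOp_isSymmetric ι h _
  rw [inner_specProj_left, h1, greenOp_specProj, inner_smul_left, inner_smul_right,
    inner_specProj_left, conj_trivial]

theorem inner_specLift (l : ℝ) (h : H) (z : V) :
    ⟪specLift ι l h, z⟫_ℝ = (1 + l) * ⟪specProj ι l h, ι z⟫_ℝ := by
  simp [specLift, inner_smul_left, ContinuousLinearMap.adjoint_inner_left]

namespace IsCompactEmbedding

theorem adjoint_injective (hι : IsCompactEmbedding ι) : Function.Injective ι.adjoint := by
  rw [injective_iff_map_eq_zero]
  intro h hh
  refine hι.denseRange.eq_zero_of_inner_left ℝ fun w => ?_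
  rw [← ContinuousLinearMap.adjoint_inner_left, hh, inner_zero_left]

theorem greenOp_injective (hι : IsCompactEmbedding ι) : Function.Injective (greenOp ι) :=
  hι.injective.comp hι.adjoint_injective

theorem norm_adjoint_le (hι : IsCompactEmbedding ι) (h : H) : ‖ι.adjoint h‖ ≤ ‖h‖ := by
  have h1 : ‖ι‖ ≤ 1 := ι.opNorm_le_bound zero_le_one fun w => by simpa using hι.norm_le w
  have h2 : ‖ι.adjoint‖ ≤ 1 := by rwa [LinearIsometryEquiv.norm_map]
  simpa using (ι.adjoint).le_of_opNorm_le h2 h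

/-- For h ≠ 0 the form ⟪ιι*h, h⟫ = ‖ι*h‖² lies in (0, ‖h‖²], so every eigenvalue (1 + l)⁻¹ of
`greenOp` lies in (0, 1] and l ≥ 0. This also covers l = -1, where the inverse is 0 by convention.
-/
theorem specSpace_eq_bot (hι : IsCompactEmbedding ι) {l : ℝ} (hl : l < 0) :
    specSpace ι l = ⊥ := by
  rw [Submodule.eq_bot_iff]
  intro h hh
  rw [mem_specSpace] at hh
  by_contra hne
  have hpos : 0 < ‖ι.adjoint h‖ ^ 2 := by
    have : ι.adjoint h ≠ 0 := fun h0 => hne (hι.adjoint_injective (by simpa using h0))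
    positivity
  have hle : ‖ι.adjoint h‖ ^ 2 ≤ ‖h‖ ^ 2 := by gcongr; exact hι.norm_adjoint_le h
  have h1 := inner_greenOp_left (ι := ι) h h
  rw [hh, inner_smul_left, real_inner_self_eq_norm_sq, real_inner_self_eq_norm_sq] at h1
  simp only [conj_trivial] at h1
  have hn : 0 < ‖h‖ ^ 2 := by positivity
  have h2 : 0 < (1 + l)⁻¹ := by
    by_contra hc
    nlinarith
  have h3 : 1 < (1 + l)⁻¹ := by
    rw [one_lt_inv₀ (inv_pos.1 h2)]; linarith
  nlinarith

theorem specProj_eq_zero (hι : IsCompactEmbedding ι) {l : ℝ} (hl : l < 0) (h : H) :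
    specProj ι l h = 0 := by
  have := specProj_mem (ι := ι) l h
  rwa [hι.specSpace_eq_bot hl, Submodule.mem_bot] at this

theorem map_specLift (hι : IsCompactEmbedding ι) (l : ℝ) (h : H) :
    ι (specLift ι l h) = specProj ι l h := by
  have h1 : ι (specLift ι l h) = (1 + l) • greenOp ι (specProj ι l h) := by
    simp [specLift, greenOp]
  rw [h1, greenOp_specProj, smul_smul]
  rcases lt_or_ge l 0 with hl | hl
  · rw [hι.specProj_eq_zero hl, smul_zero]
  · rw [mul_inv_cancel₀ (by positivity), one_smul]

/-- Spectral theorem for the compact symmetric `greenOp`: a nonzero eigenvalue μ is (1 + l)⁻¹ with l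
= μ⁻¹ - 1, and the eigenvalue 0 is excluded by injectivity. -/
theorem iSup_specSpace_orthogonal (hι : IsCompactEmbedding ι) :
    (⨆ l, specSpace ι l)ᗮ = ⊥ := by
  have hc : IsCompactOperator (greenOp ι) := hι.compact.comp_clm ι.adjoint
  rw [eq_bot_iff, ← ContinuousLinearMap.orthogonalComplement_iSup_eigenspaces_eq_bot hc
    (greenOp_isSymmetric ι)]
  refine Submodule.orthogonal_le (iSup_le fun μ => ?_)
  rcases eq_or_ne μ 0 with rfl | hμ
  · intro h hh
    rw [Module.End.mem_eigenspace_iff, zero_smul] at hh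
    have : h = 0 := hι.greenOp_injective (by rw [map_zero]; exact hh)
    rw [this]; exact zero_mem _
  · refine le_trans (le_of_eq ?_) (le_iSup _ (μ⁻¹ - 1))
    rw [specSpace]; congr 1; simp

theorem hasSum_specProj (hι : IsCompactEmbedding ι) (h : H) :
    HasSum (fun l => specProj ι l h) h := by
  have hs : Summable (fun l => specProj ι l h) :=
    summable_of_orthogonal (fun l m hlm => inner_specProj_of_ne hlm h h)
      (summable_norm_sq_of_orthogonal (x := h) (fun l m hlm => inner_specProj_of_ne hlm h h)
        fun l => inner_specProj_self l h)
  -- The series converges by Bessel; whatever it misses of h is orthogonal to every eigenspace,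
  -- hence zero.
  have key : h - ∑' l, specProj ι l h ∈ (⨆ l, specSpace ι l)ᗮ := by
    rw [← Submodule.iInf_orthogonal, Submodule.mem_iInf]
    intro l k hk
    have h1 : HasSum (fun m => ⟪k, specProj ι m h⟫_ℝ) ⟪k, ∑' l, specProj ι l h⟫_ℝ :=
      hs.hasSum.mapL (innerSL ℝ k)
    have h2 : HasSum (fun m => ⟪k, specProj ι m h⟫_ℝ) ⟪k, h⟫_ℝ := by
      convert hasSum_single l (f := fun m => ⟪k, specProj ι m h⟫_ℝ) ?_ using 1
      · rw [← inner_specProj_left, specProj_eq_self hk]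
      · intro m hm
        rw [← specProj_eq_self hk]
        exact inner_specProj_of_ne hm.symm k h
    rw [inner_sub_right, h1.unique h2, sub_self]
  rw [hι.iSup_specSpace_orthogonal, Submodule.mem_bot, sub_eq_zero] at key
  rw [key]
  exact key ▸ hs.hasSum

theorem inner_specLift_self (hι : IsCompactEmbedding ι) (l : ℝ) (w : V) :
    ⟪specLift ι l (ι w), w⟫_ℝ = ‖specLift ι l (ι w)‖ ^ 2 := by
  rw [← real_inner_self_eq_norm_sq, inner_specLift, inner_specLift, hι.map_specLift,
    inner_specProj_self, real_inner_self_eq_norm_sq]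

theorem norm_sq_specLift (hι : IsCompactEmbedding ι) (l : ℝ) (h : H) :
    ‖specLift ι l h‖ ^ 2 = (1 + l) * ‖specProj ι l h‖ ^ 2 := by
  rw [← real_inner_self_eq_norm_sq, inner_specLift, hι.map_specLift, real_inner_self_eq_norm_sq]

theorem inner_specLift_of_ne (hι : IsCompactEmbedding ι) {l m : ℝ} (hlm : l ≠ m) (h k : H) :
    ⟪specLift ι l h, specLift ι m k⟫_ℝ = 0 := by
  rw [inner_specLift, hι.map_specLift, inner_specProj_of_ne hlm, mul_zero]

/-- The lifted projections are orthogonal in `V` as well, so Bessel's inequality there gives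
convergence in the stronger norm; injectivity of ι identifies the sum. -/
theorem hasSum_specLift (hι : IsCompactEmbedding ι) (w : V) :
    HasSum (fun l => specLift ι l (ι w)) w := by
  have hs : Summable (fun l => specLift ι l (ι w)) :=
    summable_of_orthogonal (fun l m hlm => hι.inner_specLift_of_ne hlm _ _)
      (summable_norm_sq_of_orthogonal (x := w) (fun l m hlm => hι.inner_specLift_of_ne hlm _ _)
        fun l => hι.inner_specLift_self l w)
  have h1 : HasSum (fun l => specProj ι l (ι w)) (ι (∑' l, specLift ι l (ι w))) := by
    simpa only [hι.map_specLift] using hs.hasSum.mapL ι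
  have h2 := hι.injective (h1.unique (hι.hasSum_specProj (ι w)))
  rw [← h2]
  simpa only [h2] using hs.hasSum

theorem summable_mul_norm_sq_specProj (hι : IsCompactEmbedding ι) (w : V) :
    Summable fun l => (1 + l) * ‖specProj ι l (ι w)‖ ^ 2 := by
  simp only [← hι.norm_sq_specLift]
  exact summable_norm_sq_of_orthogonal (x := w) (fun l m hlm => hι.inner_specLift_of_ne hlm _ _)
    fun l => hι.inner_specLift_self l w

/-- This places `V` in the domain of (-Δ)^{1/2}: the squared norms carry the weight l ≤ 1 + l, which
is summable by Bessel's inequality in `V`. -/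
theorem summable_sqrt_smul_specProj (hι : IsCompactEmbedding ι) (w : V) :
    Summable fun l => √l • specProj ι l (ι w) := by
  refine summable_of_orthogonal (fun l m hlm => ?_) ?_
  · rw [inner_smul_left, inner_smul_right, inner_specProj_of_ne hlm, mul_zero, mul_zero]
  · refine (hι.summable_mul_norm_sq_specProj w).of_nonneg_of_le (fun _ => by positivity) fun l => ?_
    rcases lt_or_ge l 0 with hl | hl
    · simp [hι.specProj_eq_zero hl]
    · rw [norm_smul, mul_pow, Real.norm_of_nonneg (Real.sqrt_nonneg _), Real.sq_sqrt hl]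
      gcongr
      linarith

/-- A sequence of finite sets of nonnegative numbers that exhausts the spectrum. -/
theorem exists_exhaustion [TopologicalSpace.SeparableSpace H] (hι : IsCompactEmbedding ι) :
    ∃ s : ℕ → Finset ℝ, (∀ n, ∀ l ∈ s n, 0 ≤ l) ∧
      ∀ {X : Type _} [AddCommGroup X] [TopologicalSpace X] (F : ℝ → X) (a : X),
        (∀ l, specSpace ι l = ⊥ → F l = 0) → HasSum F a →
          Tendsto (fun n => ∑ l ∈ s n, F l) atTop (𝓝 a) := by
  classical
  let S : Set ℝ := {l | specSpace ι l ≠ ⊥}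
  -- A nonzero projection cannot vanish on a dense sequence, and for each vector of the sequence
  -- only countably many projections are nonzero because its expansion is summable.
  have hS : S.Countable := by
    have hsub : S ⊆ ⋃ n, Function.support fun l => specProj ι l (TopologicalSpace.denseSeq H n) := by
      intro l hl
      by_contra hc
      simp only [mem_iUnion, Function.mem_support, not_exists, not_not] at hc
      refine hl ((Submodule.eq_bot_iff _).2 fun h hh => ?_)
      have h0 : (fun k => specProj ι l k) = fun _ => 0 :=
        (TopologicalSpace.denseRange_denseSeq H).equalizer (by fun_prop) (by fun_prop)
          (funext hc)
      rw [← specProj_eq_self hh]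
      exact congrFun h0 h
    exact (countable_iUnion fun n => (hι.hasSum_specProj _).summable.countable_support).mono hsub
  have : Countable S := hS
  -- Countability of the spectrum makes `atTop` on its finite subsets countably generated; one
  -- sequence of finite sets then computes all unconditional sums.
  obtain ⟨t, ht⟩ := exists_seq_tendsto (atTop : Filter (Finset S))
  refine ⟨fun n => (t n).map ⟨_, Subtype.val_injective⟩, ?_, ?_⟩
  · intro n l hl
    simp only [Finset.mem_map, Function.Embedding.coeFn_mk] at hl
    obtain ⟨⟨m, hm⟩, -, rfl⟩ := hl
    by_contra hc
    exact hm (hι.specSpace_eq_bot (not_le.1 hc))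
  · intro X _ _ F a hF ha
    have hsup : Function.support F ⊆ S := fun l hl hb => hl (hF l hb)
    have h1 := ((hasSum_subtype_iff_of_support_subset hsup).2 ha).comp ht
    refine h1.congr fun n => ?_
    simp [Finset.sum_map]

end IsCompactEmbedding

end Spectral

end SpectralTheory

/-! ### Global solutions of differential equations with a Lipschitz field -/

section GlobalODE

variable {E : Type*} [NormedAddCommGroup E] [NormedSpace ℝ E]

/-- The weight e^{ct} reproduces itself under integration with a gain 1/c, which is what makes the
Picard map contract. -/
theorem norm_integral_le_of_le_exp {h : ℝ → E} {C c τ : ℝ} (hc : 0 < c) (hC : 0 ≤ C) (hτ : 0 ≤ τ)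
    (hh : ∀ s ∈ Icc 0 τ, ‖h s‖ ≤ C * Real.exp (c * s)) :
    ‖∫ s in (0 : ℝ)..τ, h s‖ ≤ C / c * Real.exp (c * τ) := by
  have h1 : ‖∫ s in (0 : ℝ)..τ, h s‖ ≤ ∫ s in (0 : ℝ)..τ, C * Real.exp (c * s) :=
    intervalIntegral.norm_integral_le_of_norm_le hτ
      (Eventually.of_forall fun s hs => hh s ⟨hs.1.le, hs.2⟩)
      (Continuous.intervalIntegrable (by fun_prop) _ _)
  have h2 : ∫ s in (0 : ℝ)..τ, C * Real.exp (c * s) = C / c * (Real.exp (c * τ) - 1) := by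
    rw [intervalIntegral.integral_const_mul, intervalIntegral.integral_comp_mul_left _ hc.ne',
      integral_exp]
    simp only [smul_eq_mul, mul_zero, Real.exp_zero]; ring
  have h3 : 0 ≤ C / c := by positivity
  rw [h2] at h1
  nlinarith

/-- Picard's fixed point argument for y(t) = e^{-ct} x(t) on the whole half-line at once. With c = K
+ 1 the contraction factor is K / (K + 1), so no continuation argument is needed. -/
theorem exists_global_solution [CompleteSpace E] {Φ : E → E} {K : NNReal} (hΦ : LipschitzWith K Φ)
    (x₀ : E) : ∃ x : ℝ → E, x 0 = x₀ ∧ ∀ t, 0 ≤ t → HasDerivAt x (Φ (x t)) t := by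
  set c : ℝ := K + 1 with hc_def
  have hc : 0 < c := by positivity
  have hgrowth : ∀ z, ‖Φ z‖ ≤ ‖Φ 0‖ + K * ‖z‖ := fun z => by
    have h1 := hΦ.norm_sub_le z 0
    rw [sub_zero] at h1
    have h2 : ‖Φ z‖ ≤ ‖Φ z - Φ 0‖ + ‖Φ 0‖ := by simpa using norm_add_le (Φ z - Φ 0) (Φ 0)
    linarith
  have hcont : ∀ y : BoundedContinuousFunction ℝ E,
      Continuous fun s : ℝ => Φ (Real.exp (c * s) • y s) := fun y =>
    hΦ.continuous.comp ((by fun_prop : Continuous fun s : ℝ => Real.exp (c * s)).smul y.continuous)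
  have hint : ∀ y : BoundedContinuousFunction ℝ E, Continuous fun t : ℝ =>
      ∫ s in (0 : ℝ)..max t 0, Φ (Real.exp (c * s) • y s) := fun y =>
    (intervalIntegral.continuous_primitive (fun a b => (hcont y).intervalIntegrable a b) 0).comp
      (by fun_prop)
  have hbound : ∀ (y : BoundedContinuousFunction ℝ E) (s : ℝ), 0 ≤ s →
      ‖Φ (Real.exp (c * s) • y s)‖ ≤ (‖Φ 0‖ + K * ‖y‖) * Real.exp (c * s) := fun y s hs => by
    have he : 1 ≤ Real.exp (c * s) := Real.one_le_exp (mul_nonneg hc.le hs)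
    refine (hgrowth _).trans ?_
    rw [norm_smul, Real.norm_of_nonneg (Real.exp_pos _).le, add_mul ‖Φ 0‖]
    have := y.norm_coe_le_norm s
    calc _ ≤ ‖Φ 0‖ * Real.exp (c * s) + K * (Real.exp (c * s) * ‖y‖) := by
          gcongr
          exact le_mul_of_one_le_right (norm_nonneg _) he
      _ = _ := by ring
  -- `max t 0` freezes the map at negative times, so that it acts on bounded continuous functions on
  -- all of ℝ.
  let Γ : BoundedContinuousFunction ℝ E → BoundedContinuousFunction ℝ E := fun y =>
    BoundedContinuousFunction.ofNormedAddCommGroup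
      (fun t => Real.exp (-(c * max t 0)) •
        (x₀ + ∫ s in (0 : ℝ)..max t 0, Φ (Real.exp (c * s) • y s)))
      ((by fun_prop : Continuous fun t : ℝ => Real.exp (-(c * max t 0))).smul
        (continuous_const.add (hint y)))
      (‖x₀‖ + (‖Φ 0‖ + K * ‖y‖) / c) (fun t => by
        have hτ : 0 ≤ max t 0 := le_max_right _ _
        have h1 := norm_integral_le_of_le_exp (h := fun s => Φ (Real.exp (c * s) • y s)) hc
          (C := ‖Φ 0‖ + K * ‖y‖) (by positivity) hτ (fun s hs => hbound y s hs.1)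
        rw [norm_smul, Real.norm_of_nonneg (Real.exp_pos _).le]
        have h2 := norm_add_le x₀ (∫ s in (0 : ℝ)..max t 0, Φ (Real.exp (c * s) • y s))
        have hp := Real.exp_pos (-(c * max t 0))
        have h4 : Real.exp (-(c * max t 0)) ≤ 1 := Real.exp_le_one_iff.2 (by
          have := mul_nonneg hc.le hτ; linarith)
        have h5 : Real.exp (-(c * max t 0)) * Real.exp (c * max t 0) = 1 := by
          rw [← Real.exp_add]; simp
        calc _ ≤ Real.exp (-(c * max t 0)) *
              (‖x₀‖ + (‖Φ 0‖ + K * ‖y‖) / c * Real.exp (c * max t 0)) := by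
                gcongr; exact h2.trans (by gcongr)
          _ = Real.exp (-(c * max t 0)) * ‖x₀‖ + (‖Φ 0‖ + K * ‖y‖) / c := by
                rw [mul_add]; linear_combination ((‖Φ 0‖ + K * ‖y‖) / c) * h5
          _ ≤ _ := by nlinarith [norm_nonneg x₀])
  have hΓ : ContractingWith (K / (K + 1)) Γ := by
    refine ⟨by rw [div_lt_one (by positivity)]; exact lt_add_one _,
      LipschitzWith.of_dist_le_mul fun y y' => ?_⟩
    rw [BoundedContinuousFunction.dist_le (by positivity)]
    intro t
    have hτ : 0 ≤ max t 0 := le_max_right _ _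
    rw [dist_eq_norm]
    change ‖Real.exp (-(c * max t 0)) • (x₀ + ∫ s in (0 : ℝ)..max t 0, Φ (Real.exp (c * s) • y s)) -
      Real.exp (-(c * max t 0)) • (x₀ + ∫ s in (0 : ℝ)..max t 0, Φ (Real.exp (c * s) • y' s))‖ ≤ _
    rw [← smul_sub, add_sub_add_left_eq_sub, ← intervalIntegral.integral_sub
      ((hcont y).intervalIntegrable _ _) ((hcont y').intervalIntegrable _ _), norm_smul,
      Real.norm_of_nonneg (Real.exp_pos _).le]
    have h1 := norm_integral_le_of_le_exp
      (h := fun s => Φ (Real.exp (c * s) • y s) - Φ (Real.exp (c * s) • y' s)) hc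
      (C := K * dist y y') (by positivity) hτ (fun s hs => by
        refine (hΦ.norm_sub_le _ _).trans ?_
        rw [← smul_sub, norm_smul, Real.norm_of_nonneg (Real.exp_pos _).le, ← dist_eq_norm]
        have := BoundedContinuousFunction.dist_coe_le_dist (f := y) (g := y') s
        calc _ ≤ (K : ℝ) * (Real.exp (c * s) * dist y y') := by gcongr
          _ = _ := by ring)
    have h5 : Real.exp (-(c * max t 0)) * Real.exp (c * max t 0) = 1 := by
      rw [← Real.exp_add]; simp
    calc _ ≤ Real.exp (-(c * max t 0)) * (K * dist y y' / c * Real.exp (c * max t 0)) := by gcongr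
      _ = K * dist y y' / c := by linear_combination (K * dist y y' / c) * h5
      _ = _ := by push_cast; rw [hc_def]; ring
  obtain ⟨y, hy⟩ : ∃ y, Γ y = y := ⟨_, hΓ.fixedPoint_isFixedPt⟩
  -- The integral, rather than e^{ct} y(t), is taken as the solution: it is differentiable from both
  -- sides at t = 0, and the two need to agree only for t ≥ 0.
  refine ⟨fun t => x₀ + ∫ s in (0 : ℝ)..t, Φ (Real.exp (c * s) • y s), by simp, fun t ht => ?_⟩
  have hz : x₀ + ∫ s in (0 : ℝ)..t, Φ (Real.exp (c * s) • y s) = Real.exp (c * t) • y t := by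
    have h1 : Γ y t = y t := by rw [hy]
    rw [← h1]
    change _ = Real.exp (c * t) • Real.exp (-(c * max t 0)) •
      (x₀ + ∫ s in (0 : ℝ)..max t 0, Φ (Real.exp (c * s) • y s))
    rw [max_eq_left ht, smul_smul, ← Real.exp_add]
    simp
  have h2 := intervalIntegral.integral_hasDerivAt_right ((hcont y).intervalIntegrable 0 t)
    ((hcont y).stronglyMeasurableAtFilter _ _) (hcont y).continuousAt
  simp only [hz]
  exact h2.const_add x₀

end GlobalODE

/-! ### Spectral multipliers and the Galerkin system -/

section Multipliers

variable {V H : Type*} [NormedAddCommGroup V] [InnerProductSpace ℝ V] [CompleteSpace V]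
  [NormedAddCommGroup H] [InnerProductSpace ℝ H] [CompleteSpace H]

/-- The spectral multiplier with symbol `m`, restricted to the spectral values in `s`. -/
def specMul (ι : V →L[ℝ] H) (s : Finset ℝ) (m : ℝ → ℝ) : H →L[ℝ] H := ∑ l ∈ s, m l • specProj ι l

/-- The spectral projection to the spectral values in `s`, with values in `V`. -/
def specLiftSum (ι : V →L[ℝ] H) (s : Finset ℝ) : H →L[ℝ] V := ∑ l ∈ s, specLift ι l

variable {ι : V →L[ℝ] H} {s : Finset ℝ}

theorem specMul_apply (m : ℝ → ℝ) (h : H) :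
    specMul ι s m h = ∑ l ∈ s, m l • specProj ι l h := by
  simp [specMul]

theorem specMul_one_apply (h : H) : specMul ι s 1 h = ∑ l ∈ s, specProj ι l h := by
  simp [specMul_apply]

theorem specLiftSum_apply (h : H) : specLiftSum ι s h = ∑ l ∈ s, specLift ι l h := by
  simp [specLiftSum]

theorem specProj_specMul {l : ℝ} (hl : l ∈ s) (m : ℝ → ℝ) (h : H) :
    specProj ι l (specMul ι s m h) = m l • specProj ι l h := by
  rw [specMul_apply, map_sum, Finset.sum_eq_single l]
  · rw [map_smul, specProj_specProj]
  · intro k _ hk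
    rw [map_smul, specProj_specProj_of_ne hk.symm, smul_zero]
  · exact fun h => absurd hl h

theorem specMul_specMul (m m' : ℝ → ℝ) (h : H) :
    specMul ι s m (specMul ι s m' h) = specMul ι s (m * m') h := by
  rw [specMul_apply m, specMul_apply (m * m')]
  refine Finset.sum_congr rfl fun l hl => ?_
  rw [specProj_specMul hl, smul_smul, Pi.mul_apply]

theorem inner_specMul_left (m : ℝ → ℝ) (h k : H) :
    ⟪specMul ι s m h, k⟫_ℝ = ⟪h, specMul ι s m k⟫_ℝ := by
  rw [specMul_apply, specMul_apply, sum_inner, inner_sum]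
  refine Finset.sum_congr rfl fun l _ => ?_
  rw [inner_smul_left, inner_smul_right, inner_specProj_left, conj_trivial]

theorem inner_specMul_self (m : ℝ → ℝ) (h : H) :
    ⟪specMul ι s m h, h⟫_ℝ = ∑ l ∈ s, m l * ‖specProj ι l h‖ ^ 2 := by
  rw [specMul_apply, sum_inner]
  refine Finset.sum_congr rfl fun l _ => ?_
  rw [inner_smul_left, inner_specProj_self, conj_trivial]

theorem norm_specMul_one_le (h : H) : ‖specMul ι s 1 h‖ ≤ ‖h‖ := by
  refine le_of_sq_le_sq ?_ (norm_nonneg _)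
  rw [specMul_one_apply, norm_sq_sum_of_orthogonal _ fun l m hlm => inner_specProj_of_ne hlm h h]
  exact sum_norm_sq_le_of_orthogonal (fun l m hlm => inner_specProj_of_ne hlm h h)
    (fun l => inner_specProj_self l h) s

/-- The inner product of `V` is the form of 1 - Δ, whose symbol 1 + l splits into the multipliers
`1` and `id`; thus `specMul ι s id` plays the role of -Δ. -/
theorem inner_specLiftSum (h : H) (z : V) : ⟪specLiftSum ι s h, z⟫_ℝ =
    ⟪specMul ι s 1 h, ι z⟫_ℝ + ⟪specMul ι s id h, ι z⟫_ℝ := by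
  rw [specLiftSum_apply, sum_inner, specMul_apply, specMul_apply, sum_inner, sum_inner,
    ← Finset.sum_add_distrib]
  refine Finset.sum_congr rfl fun l _ => ?_
  rw [inner_specLift, inner_smul_left, inner_smul_left]
  simp only [Pi.one_apply, id, conj_trivial]
  ring

namespace IsCompactEmbedding

theorem map_specLiftSum (hι : IsCompactEmbedding ι) (h : H) :
    ι (specLiftSum ι s h) = specMul ι s 1 h := by
  rw [specLiftSum_apply, specMul_one_apply, map_sum]
  exact Finset.sum_congr rfl fun l _ => hι.map_specLift l h

theorem norm_specLiftSum_le (hι : IsCompactEmbedding ι) (w : V) :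
    ‖specLiftSum ι s (ι w)‖ ≤ ‖w‖ := by
  refine le_of_sq_le_sq ?_ (norm_nonneg _)
  rw [specLiftSum_apply, norm_sq_sum_of_orthogonal _ fun l m hlm => hι.inner_specLift_of_ne hlm _ _]
  exact sum_norm_sq_le_of_orthogonal (fun l m hlm => hι.inner_specLift_of_ne hlm _ _)
    (fun l => hι.inner_specLift_self l w) s

theorem norm_sq_specLiftSum (hι : IsCompactEmbedding ι) {h : H} (hh : specMul ι s 1 h = h) :
    ‖specLiftSum ι s h‖ ^ 2 = ‖h‖ ^ 2 + ⟪specMul ι s id h, h⟫_ℝ := by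
  rw [← real_inner_self_eq_norm_sq, inner_specLiftSum, hι.map_specLiftSum, hh,
    real_inner_self_eq_norm_sq]

end IsCompactEmbedding

/-- The spectral Galerkin system for
`u'' + γ (-Δ)^{1/2} u' + α u' - Δ u + G u = g`. -/
structure IsGalerkinSolution (ι : V →L[ℝ] H) (s : Finset ℝ) (γ α : ℝ) (G : H → H) (g : H)
    (u v : ℝ → H) : Prop where
  proj_fst : ∀ t, specMul ι s 1 (u t) = u t
  proj_snd : ∀ t, specMul ι s 1 (v t) = v t
  deriv_fst : ∀ t, 0 ≤ t → HasDerivAt u (v t) t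
  deriv_snd : ∀ t, 0 ≤ t → HasDerivAt v (specMul ι s 1
    (g - G (u t) - γ • specMul ι s Real.sqrt (v t) - α • v t - specMul ι s id (u t))) t

/-- With the projection inserted in front of every argument the field is globally Lipschitz on all
of `H × H`. The projected trajectories solve the Galerkin system, so neither coordinates nor an
invariant subspace are needed. -/
theorem exists_isGalerkinSolution (ι : V →L[ℝ] H) (s : Finset ℝ) (γ α : ℝ) {G : H → H} {L : NNReal}
    (hG : LipschitzWith L G) (g u₀ u₁ : H) : ∃ u v : ℝ → H, IsGalerkinSolution ι s γ α G g u v ∧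
      u 0 = specMul ι s 1 u₀ ∧ v 0 = specMul ι s 1 u₁ := by
  have hPP : ∀ h : H, specMul ι s 1 (specMul ι s 1 h) = specMul ι s 1 h := fun h => by
    rw [specMul_specMul, one_mul]
  let P := specMul ι s 1
  let A : H × H →L[ℝ] H := P ∘L (γ • (specMul ι s Real.sqrt ∘L P ∘L ContinuousLinearMap.snd ℝ H H) +
    α • (P ∘L ContinuousLinearMap.snd ℝ H H) +
    specMul ι s id ∘L P ∘L ContinuousLinearMap.fst ℝ H H)
  let Φ : H × H → H × H := fun x => (P x.2, P g - P (G (P x.1)) - A x)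
  have hΦ : ∃ K, LipschitzWith K Φ :=
    ⟨_, (P.lipschitz.comp LipschitzWith.prod_snd).prodMk
      (((LipschitzWith.const (P g)).sub
        (P.lipschitz.comp (hG.comp (P.lipschitz.comp LipschitzWith.prod_fst)))).sub A.lipschitz)⟩
  obtain ⟨K, hK⟩ := hΦ
  obtain ⟨x, hx0, hx⟩ := exists_global_solution hK (u₀, u₁)
  refine ⟨fun t => P (x t).1, fun t => P (x t).2, ⟨fun t => hPP _, fun t => hPP _, ?_, ?_⟩,
    by simp [hx0, P], by simp [hx0, P]⟩
  · intro t ht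
    have h1 : HasDerivAt (fun t => P (x t).1) (P (Φ (x t)).1) t :=
      P.hasFDerivAt.comp_hasDerivAt t (hx t ht).fst
    exact h1.congr_deriv (hPP _)
  · intro t ht
    have h1 : HasDerivAt (fun t => P (x t).2) (P (Φ (x t)).2) t :=
      P.hasFDerivAt.comp_hasDerivAt t (hx t ht).snd
    refine h1.congr_deriv ?_
    have h2 : A (x t) = P (γ • specMul ι s Real.sqrt (P (x t).2) + α • P (x t).2 +
      specMul ι s id (P (x t).1)) := rfl
    simp only [Φ, h2, map_sub, map_add, P, hPP]
    abel

end Multipliers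

/-! ### Real inequalities behind the dissipative estimate -/

section ScalarEstimates

/-- The algebra of the energy method. Here N = ‖u'‖, U = ‖u‖, Γ = ‖g‖, a, b are the forms of -Δ and
(-Δ)^{1/2} at u, d is the latter at u', F is the potential, and p = (g, u), q = (u, u'), r = (f(u),
u). The three conclusions are the differential inequality for the energy functional, its coercivity,
and its upper bound used at time 0. -/
theorem exists_energy_constants {ε κ α γ C : ℝ} (hε : 0 < ε) (hκ : 0 < κ) (hα : 0 < α) (hγ : 0 < γ)
    (hC : 0 ≤ C) : ∃ δ β K : ℝ, 0 < δ ∧ 0 < β ∧ 0 < K ∧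
      ∀ N U a b d F Γ p q r : ℝ, 0 ≤ N → 0 ≤ U → 0 ≤ a → b ≤ a + U ^ 2 → 0 ≤ b → 0 ≤ Γ →
        κ * U ^ 2 - C ≤ F → |p| ≤ Γ * U → |q| ≤ U * N → ε * F + κ * U ^ 2 - C ≤ r →
        -γ * d - (α - δ) * N ^ 2 - δ * a - δ * r + δ * p ≤
          -β * (N ^ 2 / 2 + a / 2 + F - p + δ * q + δ * α / 2 * U ^ 2 + δ * γ / 2 * b)
            - (γ * d + α / 4 * N ^ 2) + K * (1 + Γ ^ 2) ∧
        N ^ 2 + a + U ^ 2 ≤ K * (N ^ 2 / 2 + a / 2 + F - p + δ * q + δ * α / 2 * U ^ 2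
          + δ * γ / 2 * b + K * (1 + Γ ^ 2)) ∧
        N ^ 2 / 2 + a / 2 + F - p + δ * q + δ * α / 2 * U ^ 2 + δ * γ / 2 * b ≤
          F + K * (Γ ^ 2 + N ^ 2 + a + U ^ 2) := by
  -- δ ≤ α / 2 keeps half of the damping of N²; the other two bounds let δ q be absorbed into N² / 4
  -- and κ U² / 4.
  obtain ⟨δ, hδ, hδα, hδ1, hδκ⟩ : ∃ δ : ℝ, 0 < δ ∧ δ ≤ α / 2 ∧ δ ≤ 1 / 2 ∧ δ ≤ κ / 2 :=
    ⟨min (α / 2) (min (1 / 2) (κ / 2)), by positivity, min_le_left _ _,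
      (min_le_right _ _).trans (min_le_left _ _), (min_le_right _ _).trans (min_le_right _ _)⟩
  have hs : 0 < 1 + α + γ := by positivity
  -- β times the functional is to be dominated term by term: β ≤ δ ε serves the potential, β ≤ α / 4
  -- serves N², and the bounds with 1 + α + γ serve a and U².
  obtain ⟨β, hβ, hβε, hβα, hβδ, hβκ, hβ1⟩ : ∃ β : ℝ, 0 < β ∧ β ≤ δ * ε ∧ β ≤ α / 4 ∧
      β * (1 + α + γ) ≤ δ ∧ β * (1 + α + γ) ≤ κ * δ ∧ β ≤ 1 := by
    refine ⟨min (δ * ε) (min (α / 4) (min (δ / (1 + α + γ)) (min (κ * δ / (1 + α + γ)) 1))),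
      by positivity, min_le_left _ _, (min_le_right _ _).trans (min_le_left _ _), ?_, ?_,
      (min_le_right _ _).trans <| (min_le_right _ _).trans <| (min_le_right _ _).trans <|
        min_le_right _ _⟩
    · rw [← le_div_iff₀ hs]
      exact (min_le_right _ _).trans <| (min_le_right _ _).trans <| min_le_left _ _
    · rw [← le_div_iff₀ hs]
      exact (min_le_right _ _).trans <| (min_le_right _ _).trans <| (min_le_right _ _).trans <|
        min_le_left _ _
  obtain ⟨K, hK1, hK2, hK3, hK4, hK5, hK6, hK7⟩ : ∃ K : ℝ, 2 / (δ * κ) ≤ K ∧ δ * C + δ * ε * C ≤ K ∧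
      4 ≤ K ∧ 4 / κ ≤ K ∧ C ≤ K ∧ 1 / (2 * κ) ≤ K ∧ 2 + α + γ ≤ K := by
    refine ⟨2 / (δ * κ) + (δ * C + δ * ε * C) + 4 + 4 / κ + C + 1 / (2 * κ) + (2 + α + γ), ?_⟩
    have h1 : 0 < 2 / (δ * κ) := by positivity
    have h2 : 0 ≤ δ * C + δ * ε * C := by positivity
    have h3 : 0 < 4 / κ := by positivity
    have h4 : 0 < 1 / (2 * κ) := by positivity
    refine ⟨?_, ?_, ?_, ?_, ?_, ?_, ?_⟩ <;> linarith
  refine ⟨δ, β, K, hδ, hβ, by linarith, ?_⟩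
  intro N U a b d F Γ p q r hN hU ha hba hb hΓ hF hp hq hr
  have hpl := (abs_le.1 hp).1
  have hpu := (abs_le.1 hp).2
  have hqu : q ≤ (U ^ 2 + N ^ 2) / 2 := by
    have := (abs_le.1 hq).2; nlinarith [sq_nonneg (U - N)]
  have hql : -((U ^ 2 + N ^ 2) / 2) ≤ q := by
    have := (abs_le.1 hq).1; nlinarith [sq_nonneg (U - N)]
  have hN2 : 0 ≤ N ^ 2 := sq_nonneg N
  have hU2 : 0 ≤ U ^ 2 := sq_nonneg U
  have hG2 : 0 ≤ Γ ^ 2 := sq_nonneg Γ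
  have hΓU : 0 ≤ Γ * U := by positivity
  refine ⟨?_, ?_, ?_⟩
  · have e1 : δ * (ε * F + κ * U ^ 2 - C) ≤ δ * r := by gcongr
    have e2 : β * (F + C) ≤ δ * ε * (F + C) := by
      exact mul_le_mul_of_nonneg_right hβε (by nlinarith only [hF, mul_nonneg hκ.le hU2])
    -- Half of the dissipative term δ κ U² pays for the forcing; the other half is kept for `e9`.
    have e3 : (δ - β) * p ≤ δ * κ / 2 * U ^ 2 + K * Γ ^ 2 := by
      have y1 : 2 * (Γ * U) ≤ δ * κ / 2 * U ^ 2 + 2 / (δ * κ) * Γ ^ 2 := by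
        have hdk : 0 < δ * κ := by positivity
        have : 0 ≤ (δ * κ * U - 2 * Γ) ^ 2 / (2 * (δ * κ)) := by positivity
        have e : (δ * κ * U - 2 * Γ) ^ 2 / (2 * (δ * κ)) =
            δ * κ / 2 * U ^ 2 + 2 / (δ * κ) * Γ ^ 2 - 2 * (Γ * U) := by field_simp; ring
        linarith only [this, e]
      have y2 : 2 / (δ * κ) * Γ ^ 2 ≤ K * Γ ^ 2 := by gcongr
      have y3 : (δ - β) * p ≤ (δ + β) * (Γ * U) := by
        linarith only [mul_le_mul_of_nonneg_left hpu hδ.le, mul_le_mul_of_nonneg_left hpl hβ.le]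
      have y4 : (δ + β) * (Γ * U) ≤ 2 * (Γ * U) :=
        mul_le_mul_of_nonneg_right (by linarith only [hδ1, hβ1]) hΓU
      linarith only [y1, y2, y3, y4]
    have e4 : β * (δ * q) ≤ β * ((U ^ 2 + N ^ 2) / 4) := by
      refine mul_le_mul_of_nonneg_left ?_ hβ.le
      have h1 : δ * q ≤ δ * ((U ^ 2 + N ^ 2) / 2) := mul_le_mul_of_nonneg_left hqu hδ.le
      have h2 : δ * ((U ^ 2 + N ^ 2) / 2) ≤ 1 / 2 * ((U ^ 2 + N ^ 2) / 2) :=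
        mul_le_mul_of_nonneg_right hδ1 (by positivity)
      linarith only [h1, h2]
    have e5 : β * (δ * γ / 2 * b) ≤ β * (γ / 4 * (a + U ^ 2)) := by
      refine mul_le_mul_of_nonneg_left ?_ hβ.le
      have h1 : δ * (γ / 2 * b) ≤ 1 / 2 * (γ / 2 * b) :=
        mul_le_mul_of_nonneg_right hδ1 (by positivity)
      have h2 : γ / 4 * b ≤ γ / 4 * (a + U ^ 2) := mul_le_mul_of_nonneg_left hba (by positivity)
      linarith only [h1, h2]
    have e6 : β * (δ * α / 2 * U ^ 2) ≤ β * (α / 4 * U ^ 2) := by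
      refine mul_le_mul_of_nonneg_left (mul_le_mul_of_nonneg_right ?_ hU2) hβ.le
      have h1 : δ * α ≤ 1 / 2 * α := mul_le_mul_of_nonneg_right hδ1 hα.le
      linarith only [h1]
    have hβα' : 0 ≤ β * α := by positivity
    have hβγ' : 0 ≤ β * γ := by positivity
    have e7 : β * (3 / 4) * N ^ 2 ≤ α / 4 * N ^ 2 :=
      mul_le_mul_of_nonneg_right (by linarith only [hβα, hβ]) hN2
    have e8 : β * (1 / 2 + γ / 4) * a ≤ δ * a :=
      mul_le_mul_of_nonneg_right (by linarith only [hβδ, hβ, hβα', hβγ']) ha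
    have e9 : β * (1 / 4 + α / 4 + γ / 4) * U ^ 2 ≤ δ * κ / 2 * U ^ 2 :=
      mul_le_mul_of_nonneg_right (by linarith only [hβκ, hβ, hβα', hβγ']) hU2
    have e10 : (α / 2) * N ^ 2 ≤ (α - δ) * N ^ 2 :=
      mul_le_mul_of_nonneg_right (by linarith only [hδα]) hN2
    have e11 : 0 ≤ β * C := by positivity
    linarith only [e1, e2, e3, e4, e5, e6, e7, e8, e9, e10, e11, hK2]
  · have e1 : Γ * U ≤ κ / 2 * U ^ 2 + 1 / (2 * κ) * Γ ^ 2 := by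
      have : 0 ≤ (κ * U - Γ) ^ 2 / (2 * κ) := by positivity
      have e : (κ * U - Γ) ^ 2 / (2 * κ) = κ / 2 * U ^ 2 + 1 / (2 * κ) * Γ ^ 2 - Γ * U := by
        field_simp; ring
      linarith only [this, e]
    have e2 : 1 / (2 * κ) * Γ ^ 2 ≤ K * Γ ^ 2 := by gcongr
    have e3 : δ * -((U ^ 2 + N ^ 2) / 2) ≤ δ * q := mul_le_mul_of_nonneg_left hql hδ.le
    have e4 : δ * ((U ^ 2 + N ^ 2) / 2) ≤ κ / 4 * U ^ 2 + 1 / 4 * N ^ 2 := by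
      linarith only [mul_le_mul_of_nonneg_right hδκ hU2, mul_le_mul_of_nonneg_right hδ1 hN2]
    have e5 : 0 ≤ δ * α / 2 * U ^ 2 + δ * γ / 2 * b := by positivity
    have e6 : N ^ 2 / 4 + a / 4 + κ / 4 * U ^ 2 ≤ N ^ 2 / 2 + a / 2 + F - p + δ * q +
        δ * α / 2 * U ^ 2 + δ * γ / 2 * b + K * (1 + Γ ^ 2) := by
      linarith only [e1, e2, e3, e4, e5, hF, hpu, hK5, ha]
    have hK0 : 0 ≤ K := by linarith
    have e7 : 1 ≤ K * (κ / 4) := by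
      have := mul_le_mul_of_nonneg_right hK4 (by positivity : 0 ≤ κ / 4)
      have e : 4 / κ * (κ / 4) = 1 := by field_simp
      linarith
    have e8 := mul_le_mul_of_nonneg_left e6 hK0
    have e9 := mul_nonneg (sub_nonneg.2 hK3) hN2
    have e10 := mul_nonneg (sub_nonneg.2 hK3) ha
    have e11 := mul_nonneg (sub_nonneg.2 e7) hU2
    linarith only [e8, e9, e10, e11]
  · have e1 : -p ≤ Γ ^ 2 / 2 + U ^ 2 / 2 := by
      linarith only [hpl, sq_nonneg (Γ - U)]
    have e2 : δ * q ≤ (U ^ 2 + N ^ 2) / 2 := by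
      linarith only [mul_le_mul_of_nonneg_left hqu hδ.le, mul_le_mul_of_nonneg_right hδ1 hU2,
        mul_le_mul_of_nonneg_right hδ1 hN2, hU2, hN2]
    have e3 : δ * α / 2 * U ^ 2 ≤ α * U ^ 2 :=
      mul_le_mul_of_nonneg_right (by linarith only [mul_le_mul_of_nonneg_right hδ1 hα.le, hα]) hU2
    have e4 : δ * γ / 2 * b ≤ γ * (a + U ^ 2) := by
      have : δ * γ / 2 ≤ γ := by linarith only [mul_le_mul_of_nonneg_right hδ1 hγ.le, hγ]
      gcongr
    have e5 : (2 + α + γ) * (Γ ^ 2 + N ^ 2 + a + U ^ 2) ≤ K * (Γ ^ 2 + N ^ 2 + a + U ^ 2) := by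
      gcongr
    linarith only [e1, e2, e3, e4, e5, hN2, hU2, hG2, ha, mul_nonneg hα.le ha, mul_nonneg hα.le hN2, mul_nonneg hα.le hG2,
      mul_nonneg hγ.le hN2, mul_nonneg hγ.le hG2]

/-- Consequences of the differential inequality `E' ≤ -β E - D + k`. -/
theorem le_exp_add_of_deriv_le {E E' D : ℝ → ℝ} {β k : ℝ} (hβ : 0 < β)
    (hE : ∀ t, 0 ≤ t → HasDerivAt E (E' t) t) (hD : ∀ t, 0 ≤ t → 0 ≤ D t)
    (hle : ∀ t, 0 ≤ t → E' t ≤ -β * E t - D t + k) {t : ℝ} (ht : 0 ≤ t) :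
    E t ≤ (E 0 - k / β) * Real.exp (-β * t) + k / β := by
  have hder : ∀ s, 0 ≤ s → HasDerivAt (fun s => Real.exp (β * s) * (E s - k / β))
      (Real.exp (β * s) * β * (E s - k / β) + Real.exp (β * s) * E' s) s := fun s hs => by
    have h1 : HasDerivAt (fun s => Real.exp (β * s)) (Real.exp (β * s) * β) s := by
      simpa using ((hasDerivAt_id s).const_mul β).exp
    exact h1.mul ((hE s hs).sub_const _)
  have hanti : AntitoneOn (fun s => Real.exp (β * s) * (E s - k / β)) (Ici 0) := by
    refine antitoneOn_of_deriv_nonpos (convex_Ici 0)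
      (fun s hs => (hder s hs).continuousAt.continuousWithinAt) (fun s hs => ?_) (fun s hs => ?_)
    · rw [interior_Ici] at hs
      exact (hder s hs.le).differentiableAt.differentiableWithinAt
    · rw [interior_Ici] at hs
      rw [(hder s hs.le).deriv]
      have h1 := hle s hs.le
      have h2 := hD s hs.le
      have h3 : β * (k / β) = k := by field_simp
      have h4 := Real.exp_pos (β * s)
      nlinarith
  have h1 := hanti (mem_Ici.2 le_rfl) (mem_Ici.2 ht) ht
  simp only [mul_zero, Real.exp_zero, one_mul] at h1
  have h2 : Real.exp (-β * t) * Real.exp (β * t) = 1 := by rw [← Real.exp_add]; simp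
  have h3 := mul_le_mul_of_nonneg_left h1 (Real.exp_pos (-β * t)).le
  rw [← mul_assoc, h2] at h3
  linarith

/-- The inequality bounds D by -E' - β E + k. Over a unit interval -E' integrates to boundary
values, and E ≥ -m controls the rest. -/
theorem integral_le_of_deriv_le {E E' D : ℝ → ℝ} {β k m : ℝ} (hβ : 0 < β)
    (hE : ∀ t, 0 ≤ t → HasDerivAt E (E' t) t) (hD : ContinuousOn D (Ici 0))
    (hle : ∀ t, 0 ≤ t → E' t ≤ -β * E t - D t + k) (hm : ∀ t, 0 ≤ t → -m ≤ E t) {t : ℝ}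
    (ht : 0 ≤ t) : ∫ s in t..t + 1, D s ≤ E t + m + β * m + k := by
  have hsub : Icc t (t + 1) ⊆ Ici 0 := fun s hs => ht.trans hs.1
  have hint : IntegrableOn D (Icc t (t + 1)) := (hD.mono hsub).integrableOn_Icc
  have h1 := intervalIntegral.integral_le_sub_of_hasDeriv_right_of_le (a := t) (b := t + 1)
    (g := fun s => -E s) (g' := fun s => -E' s) (φ := fun s => D s - (β * m + k)) (by linarith)
    (fun s hs => (hE s (hsub hs)).neg.continuousAt.continuousWithinAt)
    (fun s hs => (hE s (ht.trans hs.1.le)).neg.hasDerivWithinAt)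
    (hint.sub (by simp))
    (fun s hs => by
      have h2 := hle s (ht.trans hs.1.le)
      have h3 := hm s (ht.trans hs.1.le)
      have h4 := mul_le_mul_of_nonneg_left h3 hβ.le
      linarith)
  rw [intervalIntegral.integral_sub ((intervalIntegrable_iff_integrableOn_Icc_of_le
    (by linarith)).2 hint) intervalIntegrable_const] at h1
  simp only [intervalIntegral.integral_const, add_sub_cancel_left, one_smul] at h1
  have h5 := hm (t + 1) (by linarith)
  linarith

end ScalarEstimates

/-! ### The dissipative energy estimate for Galerkin solutions -/

section GalerkinEstimates

variable {V H : Type*} [NormedAddCommGroup V] [InnerProductSpace ℝ V] [CompleteSpace V]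
  [NormedAddCommGroup H] [InnerProductSpace ℝ H] [CompleteSpace H]

/-- A Lipschitz gradient field `G = ∇Φ` with dissipativity constants `ε`, `κ`, `C`. -/
structure IsDissipative (G : H → H) (Φ : H → ℝ) (ε κ C : ℝ) : Prop where
  lipschitz : ∃ L, LipschitzWith L G
  hasFDerivAt : ∀ u, HasFDerivAt Φ (innerSL ℝ (G u)) u
  le_inner : ∀ u, ε * Φ u + κ * ‖u‖ ^ 2 - C ≤ ⟪G u, u⟫_ℝ
  le_potential : ∀ u, κ * ‖u‖ ^ 2 - C ≤ Φ u

variable {ι : V →L[ℝ] H} {s : Finset ℝ} {γ α : ℝ} {G : H → H} {g : H} {u v : ℝ → H}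

namespace IsGalerkinSolution

theorem continuousOn_fst (hsol : IsGalerkinSolution ι s γ α G g u v) : ContinuousOn u (Ici 0) :=
  fun t ht => (hsol.deriv_fst t ht).continuousAt.continuousWithinAt

theorem continuousOn_snd (hsol : IsGalerkinSolution ι s γ α G g u v) : ContinuousOn v (Ici 0) :=
  fun t ht => (hsol.deriv_snd t ht).continuousAt.continuousWithinAt

/-- The Galerkin equation tested with v + δ u. The last two terms of the functional are chosen so
that their derivatives cancel the cross terms α δ ⟪u, v⟫ and γ δ ⟪(-Δ)^{1/2} v, u⟫; since G is the
gradient of Φ, its pairing with v cancels too. -/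
theorem hasDerivAt_energy {Φ : H → ℝ} (hΦ : ∀ u, HasFDerivAt Φ (innerSL ℝ (G u)) u) (δ : ℝ)
    (hsol : IsGalerkinSolution ι s γ α G g u v) {t : ℝ} (ht : 0 ≤ t) :
    HasDerivAt (fun t => ‖v t‖ ^ 2 / 2 + ⟪specMul ι s id (u t), u t⟫_ℝ / 2 + Φ (u t) - ⟪g, u t⟫_ℝ
      + δ * ⟪u t, v t⟫_ℝ + δ * α / 2 * ‖u t‖ ^ 2
      + δ * γ / 2 * ⟪specMul ι s Real.sqrt (u t), u t⟫_ℝ)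
      (-γ * ⟪specMul ι s Real.sqrt (v t), v t⟫_ℝ - (α - δ) * ‖v t‖ ^ 2
        - δ * ⟪specMul ι s id (u t), u t⟫_ℝ - δ * ⟪G (u t), u t⟫_ℝ + δ * ⟪g, u t⟫_ℝ) t := by
  have hu := hsol.deriv_fst t ht
  have hv := hsol.deriv_snd t ht
  set y := g - G (u t) - γ • specMul ι s Real.sqrt (v t) - α • v t - specMul ι s id (u t) with hy
  have hvy : ⟪v t, specMul ι s 1 y⟫_ℝ = ⟪v t, y⟫_ℝ := by
    rw [← inner_specMul_left, hsol.proj_snd]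
  have huy : ⟪u t, specMul ι s 1 y⟫_ℝ = ⟪u t, y⟫_ℝ := by
    rw [← inner_specMul_left, hsol.proj_fst]
  have hm : ∀ m : ℝ → ℝ, HasDerivAt (fun t => ⟪specMul ι s m (u t), u t⟫_ℝ)
      (⟪specMul ι s m (u t), v t⟫_ℝ + ⟪specMul ι s m (v t), u t⟫_ℝ) t := fun m =>
    ((specMul ι s m).hasFDerivAt.comp_hasDerivAt t hu).inner ℝ hu
  have hF : HasDerivAt (fun t => Φ (u t)) ⟪G (u t), v t⟫_ℝ t :=
    (hΦ (u t)).comp_hasDerivAt t hu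
  have hg : HasDerivAt (fun t => ⟪g, u t⟫_ℝ) ⟪g, v t⟫_ℝ t :=
    (innerSL ℝ g).hasFDerivAt.comp_hasDerivAt t hu
  refine ((((((hv.norm_sq.div_const 2).add ((hm id).div_const 2)).add hF).sub hg).add
    ((hu.inner ℝ hv).const_mul δ)).add (hu.norm_sq.const_mul (δ * α / 2))).add
    ((hm Real.sqrt).const_mul (δ * γ / 2)) |>.congr_deriv ?_
  rw [hvy, huy, hy]
  have hA := inner_specMul_left (ι := ι) (s := s) id (v t) (u t)
  have hB := inner_specMul_left (ι := ι) (s := s) Real.sqrt (v t) (u t)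
  simp only [inner_sub_right, inner_smul_right, hA, hB, real_inner_self_eq_norm_sq]
  rw [← inner_specMul_left Real.sqrt (u t), real_inner_comm g (v t), real_inner_comm (G (u t)) (v t),
    real_inner_comm (specMul ι s Real.sqrt (v t)) (v t), real_inner_comm (specMul ι s id (u t)) (v t),
    real_inner_comm g (u t), real_inner_comm (G (u t)) (u t), real_inner_comm (v t) (u t),
    real_inner_comm (specMul ι s id (u t)) (u t),
    real_inner_comm (specMul ι s Real.sqrt (u t)) (v t)]
  ring

end IsGalerkinSolution

theorem inner_specMul_nonneg (hs : ∀ l ∈ s, 0 ≤ l) {m : ℝ → ℝ} (hm : ∀ l, 0 ≤ l → 0 ≤ m l) (h : H) :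
    0 ≤ ⟪specMul ι s m h, h⟫_ℝ := by
  rw [inner_specMul_self]
  exact Finset.sum_nonneg fun l hl => mul_nonneg (hm l (hs l hl)) (sq_nonneg _)

theorem inner_specMul_sqrt_le (hs : ∀ l ∈ s, 0 ≤ l) {h : H} (hh : specMul ι s 1 h = h) :
    ⟪specMul ι s Real.sqrt h, h⟫_ℝ ≤ ⟪specMul ι s id h, h⟫_ℝ + ‖h‖ ^ 2 := by
  have h1 : ‖h‖ ^ 2 = ⟪specMul ι s 1 h, h⟫_ℝ := by rw [hh, real_inner_self_eq_norm_sq]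
  rw [h1, inner_specMul_self, inner_specMul_self, inner_specMul_self, ← Finset.sum_add_distrib]
  refine Finset.sum_le_sum fun l hl => ?_
  rw [← add_mul]
  gcongr
  simp only [id, Pi.one_apply]
  nlinarith [Real.sqrt_nonneg l, Real.sq_sqrt (hs l hl), sq_nonneg (√l - 1)]

/-- The dissipative energy estimate, uniform over all Galerkin systems. -/
theorem exists_galerkin_estimate (hι : IsCompactEmbedding ι) {ε κ C : ℝ} (hε : 0 < ε) (hκ : 0 < κ)
    (hC : 0 ≤ C) (hα : 0 < α) (hγ : 0 < γ) : ∃ β M : ℝ, 0 < β ∧ 0 < M ∧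
      ∀ (s : Finset ℝ) (G : H → H) (Φ : H → ℝ) (g : H) (u v : ℝ → H), (∀ l ∈ s, 0 ≤ l) →
        IsDissipative G Φ ε κ C → IsGalerkinSolution ι s γ α G g u v → ∀ t, 0 ≤ t →
          ‖specLiftSum ι s (u t)‖ ^ 2 + ‖v t‖ ^ 2 +
            (∫ τ in t..t + 1, (γ * ⟪specMul ι s Real.sqrt (v τ), v τ⟫_ℝ + α / 4 * ‖v τ‖ ^ 2)) ≤
          M * ((|Φ (u 0)| + ‖specLiftSum ι s (u 0)‖ ^ 2 + ‖v 0‖ ^ 2) * Real.exp (-β * t)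
            + 1 + ‖g‖ ^ 2) := by
  obtain ⟨δ, β, K, hδ, hβ, hK, hmain⟩ := exists_energy_constants hε hκ hα hγ hC
  refine ⟨β, (K + 1) * (K + 1 + K / β + K + K + β * K + K), hβ, by positivity, ?_⟩
  intro s G Φ g u v hs hG hsol t ht
  set a : ℝ → ℝ := fun t => ⟪specMul ι s id (u t), u t⟫_ℝ with ha_def
  set b : ℝ → ℝ := fun t => ⟪specMul ι s Real.sqrt (u t), u t⟫_ℝ with hb_def
  set D : ℝ → ℝ := fun t => γ * ⟪specMul ι s Real.sqrt (v t), v t⟫_ℝ + α / 4 * ‖v t‖ ^ 2 with hD_def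
  set E : ℝ → ℝ := fun t => ‖v t‖ ^ 2 / 2 + a t / 2 + Φ (u t) - ⟪g, u t⟫_ℝ
      + δ * ⟪u t, v t⟫_ℝ + δ * α / 2 * ‖u t‖ ^ 2 + δ * γ / 2 * b t with hE_def
  have ha : ∀ t, 0 ≤ a t := fun t => inner_specMul_nonneg hs (fun l hl => hl) _
  have hb : ∀ t, 0 ≤ b t := fun t => inner_specMul_nonneg hs (fun l hl => Real.sqrt_nonneg _) _
  have hX : ∀ t, ‖specLiftSum ι s (u t)‖ ^ 2 = ‖u t‖ ^ 2 + a t := fun t =>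
    hι.norm_sq_specLiftSum (hsol.proj_fst t)
  have hD0 : ∀ t, 0 ≤ D t := fun t => by
    have := inner_specMul_nonneg (ι := ι) hs (fun l _ => Real.sqrt_nonneg l) (v t)
    simp only [hD_def]; positivity
  have hDc : ContinuousOn D (Ici 0) := by
    have h1 := hsol.continuousOn_snd
    have h2 : ContinuousOn (fun t => specMul ι s Real.sqrt (v t)) (Ici 0) :=
      (specMul ι s Real.sqrt).continuous.comp_continuousOn h1
    exact ((h2.inner h1).const_mul γ).add ((h1.norm.pow 2).const_mul (α / 4))
  have key := fun t => hmain ‖v t‖ ‖u t‖ (a t) (b t) ⟪specMul ι s Real.sqrt (v t), v t⟫_ℝ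
    (Φ (u t)) ‖g‖ ⟪g, u t⟫_ℝ ⟪u t, v t⟫_ℝ ⟪G (u t), u t⟫_ℝ (norm_nonneg _) (norm_nonneg _) (ha t)
    (inner_specMul_sqrt_le hs (hsol.proj_fst t)) (hb t) (norm_nonneg _) (hG.le_potential _)
    (abs_real_inner_le_norm _ _) (abs_real_inner_le_norm _ _) (hG.le_inner _)
  have hder := fun t (ht : 0 ≤ t) => hsol.hasDerivAt_energy hG.hasFDerivAt δ ht
  have hle : ∀ t, 0 ≤ t → -γ * ⟪specMul ι s Real.sqrt (v t), v t⟫_ℝ - (α - δ) * ‖v t‖ ^ 2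
        - δ * ⟪specMul ι s id (u t), u t⟫_ℝ - δ * ⟪G (u t), u t⟫_ℝ + δ * ⟪g, u t⟫_ℝ ≤
        -β * E t - D t + K * (1 + ‖g‖ ^ 2) := fun t _ => by
    exact (key t).1
  -- Coercivity has a nonnegative left side, hence yields a lower bound for E that is uniform in
  -- time.
  have hm : ∀ t, 0 ≤ t → -(K * (1 + ‖g‖ ^ 2)) ≤ E t := fun t _ => by
    have h1 := (key t).2.1
    have h2 : 0 ≤ K * (E t + K * (1 + ‖g‖ ^ 2)) := le_trans (by have := ha t; positivity) h1
    have h3 := nonneg_of_mul_nonneg_right h2 hK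
    linarith
  have h1 := le_exp_add_of_deriv_le hβ hder (fun t _ => hD0 t) hle ht
  have h2 := integral_le_of_deriv_le hβ hder hDc hle hm ht
  have h3 := (key t).2.1
  have h4 := (key 0).2.2
  change E 0 ≤ _ at h4
  change E t ≤ (E 0 - _) * _ + _ at h1
  change _ ≤ E t + _ + _ + _ at h2
  change _ ≤ K * (E t + _) at h3
  rw [hX, hX]
  set X0 := ‖u 0‖ ^ 2 + a 0 with hX0_def
  have hX0 : 0 ≤ X0 := by have := ha 0; positivity
  set e := Real.exp (-β * t)
  have he : 0 < e := Real.exp_pos _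
  have he1 : e ≤ 1 := Real.exp_le_one_iff.2 (by nlinarith)
  have hΓ : 0 ≤ ‖g‖ ^ 2 := sq_nonneg _
  have hN0 : 0 ≤ ‖v 0‖ ^ 2 := sq_nonneg _
  have hF0 := le_abs_self (Φ (u 0))
  have hF1 := abs_nonneg (Φ (u 0))
  have hq : 0 ≤ K / β := by positivity
  set Y := |Φ (u 0)| + X0 + ‖v 0‖ ^ 2 with hY
  have hY0 : 0 ≤ Y := by positivity
  have h5 : E 0 ≤ (K + 1) * Y + K * ‖g‖ ^ 2 := by
    have : K * (‖g‖ ^ 2 + ‖v 0‖ ^ 2 + a 0 + ‖u 0‖ ^ 2) = K * ‖g‖ ^ 2 + K * ‖v 0‖ ^ 2 + K * X0 := by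
      rw [hX0_def]; ring
    rw [this] at h4
    rw [hY]
    linarith only [h4, hF0, mul_nonneg hK.le hF1, hX0, hN0]
  have h6 : E t ≤ (K + 1) * Y * e + (K + K / β) * (1 + ‖g‖ ^ 2) := by
    have e1 : K * (1 + ‖g‖ ^ 2) / β = K / β * (1 + ‖g‖ ^ 2) := by ring
    rw [e1] at h1
    have e2 : (E 0 - K / β * (1 + ‖g‖ ^ 2)) * e ≤ ((K + 1) * Y + K * ‖g‖ ^ 2) * e := by
      gcongr
      have : 0 ≤ K / β * (1 + ‖g‖ ^ 2) := by positivity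
      linarith
    have e3 : K * ‖g‖ ^ 2 * e ≤ K * ‖g‖ ^ 2 := mul_le_of_le_one_right (by positivity) he1
    linarith only [h1, e2, e3, hK]
  -- The norms cost K · E by coercivity and the dissipation integral costs one more E, which
  -- explains the factor K + 1.
  have h7 : ‖u t‖ ^ 2 + a t + ‖v t‖ ^ 2 + ∫ τ in t..t + 1, D τ ≤
      (K + 1) * E t + (K * K + K + β * K + K) * (1 + ‖g‖ ^ 2) := by
    linarith only [h2, h3]
  refine h7.trans ?_
  have h8 := mul_le_mul_of_nonneg_left h6 (by positivity : 0 ≤ K + 1)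
  have h9 : 0 ≤ (K + 1) * (K / β + K + K + β * K + K) * (Y * e) := by positivity
  have h10 : 0 ≤ (1 + ‖g‖ ^ 2) * (K * (β * K) + 2 * K * K + 2 * K + 1) := by positivity
  linarith only [h8, h9, h10]

end GalerkinEstimates

/-! ### Weak limits and pointwise compactness of Lipschitz paths -/

section WeakConvergence

variable {X Y : Type*} [NormedAddCommGroup X] [InnerProductSpace ℝ X]

theorem tendsto_inner_of_weak {x h : ℕ → X} {x' h' : X} {M : ℝ} (hb : ∀ n, ‖x n‖ ≤ M)
    (hx : ∀ z, Tendsto (fun n => ⟪z, x n⟫_ℝ) atTop (𝓝 ⟪z, x'⟫_ℝ)) (hh : Tendsto h atTop (𝓝 h')) :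
    Tendsto (fun n => ⟪x n, h n⟫_ℝ) atTop (𝓝 ⟪x', h'⟫_ℝ) := by
  have h1 : Tendsto (fun n => ⟪x n, h n - h'⟫_ℝ) atTop (𝓝 0) := by
    refine squeeze_zero_norm (a := fun n => M * ‖h n - h'‖) (fun n => ?_) ?_
    · exact (norm_inner_le_norm _ _).trans (by gcongr; exact hb n)
    · simpa using (tendsto_iff_norm_sub_tendsto_zero.1 hh).const_mul M
  have h2 := h1.add (hx h')
  rw [zero_add, real_inner_comm] at h2
  refine h2.congr fun n => ?_
  rw [inner_sub_right, real_inner_comm (x n) h', sub_add_cancel]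

/-- Boundedness extends the convergence from a dense set to all vectors; the limit functional is
bounded by `M` and Riesz's theorem represents it. -/
theorem exists_weak_limit [CompleteSpace X] {x : ℕ → X} {M : ℝ} (hb : ∀ n, ‖x n‖ ≤ M) {j : Y → X}
    (hj : DenseRange j) (hc : ∀ y, ∃ c, Tendsto (fun n => ⟪j y, x n⟫_ℝ) atTop (𝓝 c)) :
    ∃ x' : X, ∀ z, Tendsto (fun n => ⟪z, x n⟫_ℝ) atTop (𝓝 ⟪z, x'⟫_ℝ) := by
  have hM : 0 ≤ M := (norm_nonneg _).trans (hb 0)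
  have hlim : ∀ z, ∃ c, Tendsto (fun n => ⟪z, x n⟫_ℝ) atTop (𝓝 c) := fun z => by
    refine cauchySeq_tendsto_of_complete (Metric.cauchySeq_iff'.2 fun ε hε => ?_)
    obtain ⟨y, hy⟩ := hj.exists_dist_lt z (ε := ε / (3 * (M + 1))) (by positivity)
    obtain ⟨c, hcy⟩ := hc y
    obtain ⟨N, hN⟩ := Metric.cauchySeq_iff'.1 hcy.cauchySeq (ε / 3) (by positivity)
    refine ⟨N, fun n hn => ?_⟩
    have h1 : ∀ m, |⟪z, x m⟫_ℝ - ⟪j y, x m⟫_ℝ| ≤ ε / 3 := fun m => by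
      rw [← inner_sub_left]
      refine (abs_real_inner_le_norm _ _).trans ?_
      rw [← dist_eq_norm]
      calc dist z (j y) * ‖x m‖ ≤ ε / (3 * (M + 1)) * (M + 1) := by
            gcongr; linarith [hb m]
        _ = ε / 3 := by field_simp
    have h2 := hN n hn
    rw [Real.dist_eq] at h2 ⊢
    have h3 := abs_le.1 (h1 n)
    have h4 := abs_le.1 (h1 N)
    have h5 := abs_lt.1 h2
    rw [abs_lt]
    constructor <;> linarith [h3.1, h3.2, h4.1, h4.2, h5.1, h5.2]
  choose L hL using hlim
  let F : X →ₗ[ℝ] ℝ :=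
    { toFun := L
      map_add' := fun z z' => tendsto_nhds_unique (hL (z + z'))
        (((hL z).add (hL z')).congr fun n => (inner_add_left _ _ _).symm)
      map_smul' := fun c z => tendsto_nhds_unique (hL (c • z))
        (((hL z).const_mul c).congr fun n => by rw [inner_smul_left, conj_trivial]) }
  let F' : X →L[ℝ] ℝ := F.mkContinuous M fun z =>
    le_of_tendsto (hL z).norm (Eventually.of_forall fun n =>
      (norm_inner_le_norm _ _).trans (by rw [mul_comm]; gcongr; exact hb n))
  refine ⟨(InnerProductSpace.toDual ℝ X).symm F', fun z => ?_⟩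
  rw [real_inner_comm, InnerProductSpace.toDual_symm_apply]
  exact hL z

/-- Expanding ‖x' - x n‖² ≥ 0 gives 2 ⟪x', x n⟫ - ‖x'‖² ≤ ‖x n‖², whose left side tends to ‖x'‖². -/
theorem norm_sq_le_liminf_of_weak {x : ℕ → X} {x' : X}
    (hx : ∀ z, Tendsto (fun n => ⟪z, x n⟫_ℝ) atTop (𝓝 ⟪z, x'⟫_ℝ)) :
    ENNReal.ofReal (‖x'‖ ^ 2) ≤ liminf (fun n => ENNReal.ofReal (‖x n‖ ^ 2)) atTop := by
  have h1 : Tendsto (fun n => ENNReal.ofReal (2 * ⟪x', x n⟫_ℝ - ‖x'‖ ^ 2)) atTop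
      (𝓝 (ENNReal.ofReal (‖x'‖ ^ 2))) := by
    refine ENNReal.tendsto_ofReal ?_
    have := ((hx x').const_mul 2).sub_const (‖x'‖ ^ 2)
    rw [real_inner_self_eq_norm_sq] at this
    convert this using 2
    ring
  rw [← h1.liminf_eq]
  refine liminf_le_liminf (Eventually.of_forall fun n => ENNReal.ofReal_le_ofReal ?_)
  have := norm_sub_sq_real x' (x n)
  nlinarith [sq_nonneg ‖x' - x n‖]

/-- By the bound on the path, the function for z is a uniform limit of those for vectors in the
range of j. -/
theorem continuousOn_inner_of_dense {x : ℝ → X} {S : Set ℝ} {M : ℝ} (hb : ∀ t ∈ S, ‖x t‖ ≤ M)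
    {j : Y → X} (hj : DenseRange j) (hc : ∀ y, ContinuousOn (fun t => ⟪j y, x t⟫_ℝ) S) (z : X) :
    ContinuousOn (fun t => ⟪z, x t⟫_ℝ) S := by
  refine continuousOn_of_uniform_approx_of_continuousOn fun W hW => ?_
  obtain ⟨ε, hε, hεW⟩ := Metric.mem_uniformity_dist.1 hW
  obtain ⟨y, hy⟩ := hj.exists_dist_lt z (ε := ε / (|M| + 1)) (by positivity)
  refine ⟨_, hc y, fun t ht => hεW ?_⟩
  rw [Real.dist_eq, ← inner_sub_left]
  refine (abs_real_inner_le_norm _ _).trans_lt ?_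
  rw [← dist_eq_norm]
  have h1 : ‖x t‖ < |M| + 1 := by linarith [hb t ht, le_abs_self M]
  calc dist z (j y) * ‖x t‖ ≤ dist z (j y) * (|M| + 1) := by gcongr
    _ < ε / (|M| + 1) * (|M| + 1) := by gcongr
    _ = ε := by field_simp

end WeakConvergence

/-- Arzelà–Ascoli in pointwise form: a product of compact sets over the countably many nonnegative
rational times is sequentially compact, and the common Lipschitz constant carries convergence to all
other times. -/
theorem exists_subseq_tendsto_of_lipschitz {Y : Type*} [MetricSpace Y] {K : Set Y}
    (hK : IsCompact K) {x : ℕ → ℝ → Y} {L : ℝ} (hxK : ∀ n t, 0 ≤ t → x n t ∈ K)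
    (hL : ∀ n s t, 0 ≤ s → 0 ≤ t → dist (x n s) (x n t) ≤ L * |s - t|) :
    ∃ k : ℕ → ℕ, StrictMono k ∧ ∃ y : ℝ → Y, ∀ t, 0 ≤ t →
      Tendsto (fun n => x (k n) t) atTop (𝓝 (y t)) := by
  have hKpi : IsCompact (Set.pi univ fun _ : NNRat => K) := isCompact_univ_pi fun _ => hK
  obtain ⟨a, -, k, hk, ha⟩ := hKpi.tendsto_subseq (x := fun n (q : NNRat) => x n (q : ℝ))
    (fun n q _ => hxK n _ (by positivity))
  rw [tendsto_pi_nhds] at ha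
  have key : ∀ t : ℝ, ∃ y, 0 ≤ t → Tendsto (fun n => x (k n) t) atTop (𝓝 y) := by
    intro t
    by_cases ht : 0 ≤ t
    swap
    · exact ⟨x 0 0, fun h => absurd h ht⟩
    have hcau : CauchySeq fun n => x (k n) t := by
      refine Metric.cauchySeq_iff'.2 fun ε hε => ?_
      obtain ⟨q, hq1, hq2⟩ := exists_rat_btwn (show t < t + ε / (3 * (|L| + 1)) by
        have : 0 < ε / (3 * (|L| + 1)) := by positivity
        linarith)
      have hq0 : (0 : ℝ) ≤ q := ht.trans hq1.le
      lift q to NNRat using by exact_mod_cast hq0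
      obtain ⟨N, hN⟩ := Metric.cauchySeq_iff'.1 (ha q).cauchySeq (ε / 3) (by positivity)
      have hd : ∀ n, dist (x (k n) t) (x (k n) q) < ε / 3 := fun n => by
        refine (hL _ _ _ ht hq0).trans_lt ?_
        have h1 : |t - ((q : ℚ) : ℝ)| < ε / (3 * (|L| + 1)) := by
          rw [abs_sub_comm, abs_of_pos (by linarith)]; linarith
        calc L * |t - ((q : ℚ) : ℝ)| ≤ (|L| + 1) * |t - ((q : ℚ) : ℝ)| := by
              gcongr; linarith [le_abs_self L]
          _ < (|L| + 1) * (ε / (3 * (|L| + 1))) := by gcongr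
          _ = ε / 3 := by field_simp
      refine ⟨N, fun n hn => ?_⟩
      have h1 := hN n hn
      have h2 := dist_triangle4 (x (k n) t) (x (k n) q) (x (k N) q) (x (k N) t)
      have h3 := hd n
      have h4 := hd N
      rw [dist_comm] at h4
      simp only [Function.comp_apply] at h1
      linarith
    obtain ⟨y, -, hy⟩ := cauchySeq_tendsto_of_isComplete hK.isComplete
      (fun n => hxK (k n) t ht) hcau
    exact ⟨y, fun _ => hy⟩
  choose y hy using key
  exact ⟨k, hk, y, hy⟩

theorem tendsto_integral_Ioo_of_bounded {X : ℕ → ℝ → ℝ} {Y : ℝ → ℝ} {T C : ℝ}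
    (hc : ∀ n, ContinuousOn (X n) (Icc 0 T)) (hb : ∀ n, ∀ t ∈ Ioo 0 T, |X n t| ≤ C)
    (hlim : ∀ t ∈ Ioo 0 T, Tendsto (fun n => X n t) atTop (𝓝 (Y t))) :
    Tendsto (fun n => ∫ t in Ioo 0 T, X n t) atTop (𝓝 (∫ t in Ioo 0 T, Y t)) := by
  refine tendsto_integral_of_dominated_convergence (fun _ => C)
    (fun n => ((hc n).mono Ioo_subset_Icc_self).aestronglyMeasurable measurableSet_Ioo)
    (by simp) (fun n => ?_) ?_
  · exact (ae_restrict_iff' measurableSet_Ioo).2 (Eventually.of_forall fun t ht => hb n t ht)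
  · exact (ae_restrict_iff' measurableSet_Ioo).2 (Eventually.of_forall fun t ht => hlim t ht)

theorem ennreal_liminf_add_le (u v : ℕ → ℝ≥0∞) :
    liminf u atTop + liminf v atTop ≤ liminf (fun n => u n + v n) atTop := by
  rw [liminf_eq_iSup_iInf_of_nat, liminf_eq_iSup_iInf_of_nat, liminf_eq_iSup_iInf_of_nat,
    ENNReal.iSup_add_iSup_of_monotone]
  · exact iSup_mono fun n => le_iInf₂ fun i hi => add_le_add (iInf₂_le i hi) (iInf₂_le i hi)
  · exact fun a b hab => le_iInf₂ fun i hi => iInf₂_le i (hab.trans hi)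
  · exact fun a b hab => le_iInf₂ fun i hi => iInf₂_le i (hab.trans hi)

theorem integral_linear_combination {Ω : Type*} [MeasurableSpace Ω] {ν : Measure Ω}
    {f₁ f₂ f₃ f₄ f₅ f₆ : Ω → ℝ} (γ α : ℝ) (h₁ : Integrable f₁ ν) (h₂ : Integrable f₂ ν)
    (h₃ : Integrable f₃ ν) (h₄ : Integrable f₄ ν) (h₅ : Integrable f₅ ν) (h₆ : Integrable f₆ ν) :
    ∫ t, (f₁ t + f₂ t - f₃ t - γ * f₄ t - α * f₅ t - f₆ t) ∂ν =
      (∫ t, f₁ t ∂ν) + (∫ t, f₂ t ∂ν) - (∫ t, f₃ t ∂ν) - γ * (∫ t, f₄ t ∂ν) - α * (∫ t, f₅ t ∂ν)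
        - ∫ t, f₆ t ∂ν := by
  have i2 : Integrable (fun t => f₁ t + f₂ t) ν := h₁.add h₂
  have i3 : Integrable (fun t => f₁ t + f₂ t - f₃ t) ν := i2.sub h₃
  have i4 : Integrable (fun t => f₁ t + f₂ t - f₃ t - γ * f₄ t) ν := i3.sub (h₄.const_mul γ)
  have i5 : Integrable (fun t => f₁ t + f₂ t - f₃ t - γ * f₄ t - α * f₅ t) ν :=
    i4.sub (h₅.const_mul α)
  rw [integral_sub i5 h₆, integral_sub i4 (h₅.const_mul α), integral_sub i3 (h₄.const_mul γ),
    integral_sub i2 h₃, integral_add h₁ h₂, integral_const_mul, integral_const_mul]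

/-! ### Weak form of the Galerkin equations and spectral norms -/

section GalerkinLimit

variable {V H : Type*} [NormedAddCommGroup V] [InnerProductSpace ℝ V] [CompleteSpace V]
  [NormedAddCommGroup H] [InnerProductSpace ℝ H] [CompleteSpace H]
  {ι : V →L[ℝ] H} {s : Finset ℝ} {γ α : ℝ} {G : H → H} {g : H} {u v : ℝ → H}

theorem specProj_specMul_of_notMem {l : ℝ} (hl : l ∉ s) (m : ℝ → ℝ) (h : H) :
    specProj ι l (specMul ι s m h) = 0 := by
  rw [specMul_apply, map_sum]
  refine Finset.sum_eq_zero fun k hk => ?_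
  have hlk : l ≠ k := fun h => hl (by rwa [h])
  rw [map_smul, specProj_specProj_of_ne hlk, smul_zero]

namespace IsCompactEmbedding

theorem denseRange_adjoint (hι : IsCompactEmbedding ι) : DenseRange ι.adjoint := by
  have h1 := ι.orthogonal_ker
  rw [LinearMap.ker_eq_bot.2 hι.injective, Submodule.bot_orthogonal_eq_top] at h1
  have h2 := (Submodule.dense_iff_topologicalClosure_eq_top).2 h1.symm
  exact h2

theorem denseRange_greenOp (hι : IsCompactEmbedding ι) : DenseRange (greenOp ι) :=
  hι.denseRange.comp hι.denseRange_adjoint ι.continuous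

theorem norm_specMul_sqrt_le (hι : IsCompactEmbedding ι) (hs : ∀ l ∈ s, 0 ≤ l) (z : V) :
    ‖specMul ι s Real.sqrt (ι z)‖ ≤ ‖z‖ := by
  refine le_of_sq_le_sq ?_ (norm_nonneg _)
  refine le_trans ?_ (sum_norm_sq_le_of_orthogonal
    (fun l m hlm => hι.inner_specLift_of_ne hlm (ι z) (ι z)) (fun l => hι.inner_specLift_self l z) s)
  rw [specMul_apply, norm_sq_sum_of_orthogonal]
  · refine Finset.sum_le_sum fun l hl => ?_
    rw [hι.norm_sq_specLift, norm_smul, mul_pow, Real.norm_of_nonneg (Real.sqrt_nonneg _),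
      Real.sq_sqrt (hs l hl)]
    gcongr
    linarith
  · intro l m hlm
    rw [inner_smul_left, inner_smul_right, inner_specProj_of_ne hlm, mul_zero, mul_zero]

theorem specLiftSum_specMul_one (h : H) :
    specLiftSum ι s (specMul ι s 1 h) = specLiftSum ι s h := by
  refine ext_inner_right ℝ fun z => ?_
  rw [inner_specLiftSum, inner_specLiftSum, specMul_specMul, specMul_specMul, mul_one, mul_one]

end IsCompactEmbedding

namespace IsGalerkinSolution

/-- The Galerkin equation tested with an element of `V`. -/
theorem inner_deriv_snd (hι : IsCompactEmbedding ι) (hsol : IsGalerkinSolution ι s γ α G g u v)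
    (t : ℝ) (z : V) :
    ⟪specMul ι s 1 (g - G (u t) - γ • specMul ι s Real.sqrt (v t) - α • v t
      - specMul ι s id (u t)), ι z⟫_ℝ =
    ⟪g, specMul ι s 1 (ι z)⟫_ℝ - ⟪G (u t), ι (specLiftSum ι s (ι z))⟫_ℝ
      - γ * ⟪v t, specMul ι s Real.sqrt (ι z)⟫_ℝ - α * ⟪v t, ι z⟫_ℝ
      - (⟪specLiftSum ι s (u t), z⟫_ℝ - ⟪u t, ι z⟫_ℝ) := by
  rw [inner_specLiftSum, hsol.proj_fst, hι.map_specLiftSum, inner_specMul_left]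
  simp only [inner_sub_left, inner_smul_left, conj_trivial]
  rw [inner_specMul_left Real.sqrt, inner_specMul_left id, specMul_specMul, specMul_specMul,
    mul_one, mul_one, ← inner_specMul_left 1 (v t), hsol.proj_snd, inner_specMul_left id]
  ring

theorem map_specLiftSum (hι : IsCompactEmbedding ι) (hsol : IsGalerkinSolution ι s γ α G g u v)
    (t : ℝ) : ι (specLiftSum ι s (u t)) = u t := by
  rw [hι.map_specLiftSum, hsol.proj_fst]

/-- The Galerkin equation tested with a path in `V`, integrated by parts in time. -/
theorem integral_eq (hι : IsCompactEmbedding ι) (hsol : IsGalerkinSolution ι s γ α G g u v)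
    {L : NNReal} (hG : LipschitzWith L G) {Z : ℝ → V} {ψ : ℝ → H} {T : ℝ} (hT : 0 ≤ T)
    (hZ : ∀ t ∈ Icc 0 T, HasDerivAt (fun t => ι (Z t)) (ψ t) t) (hψ : ContinuousOn ψ (Icc 0 T))
    (h0 : Z 0 = 0) (h1 : Z T = 0) :
    (∫ t in Ioo 0 T, ⟪v t, ψ t⟫_ℝ) + (∫ t in Ioo 0 T, ⟪g, specMul ι s 1 (ι (Z t))⟫_ℝ)
      - (∫ t in Ioo 0 T, ⟪G (u t), ι (specLiftSum ι s (ι (Z t)))⟫_ℝ)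
      - γ * (∫ t in Ioo 0 T, ⟪v t, specMul ι s Real.sqrt (ι (Z t))⟫_ℝ)
      - α * (∫ t in Ioo 0 T, ⟪v t, ι (Z t)⟫_ℝ)
      - (∫ t in Ioo 0 T, (⟪specLiftSum ι s (u t), Z t⟫_ℝ - ⟪u t, ι (Z t)⟫_ℝ)) = 0 ∧
    ContinuousOn (fun t => ⟪v t, ψ t⟫_ℝ) (Icc 0 T) ∧
    ContinuousOn (fun t => ⟪g, specMul ι s 1 (ι (Z t))⟫_ℝ) (Icc 0 T) ∧
    ContinuousOn (fun t => ⟪G (u t), ι (specLiftSum ι s (ι (Z t)))⟫_ℝ) (Icc 0 T) ∧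
    ContinuousOn (fun t => ⟪v t, specMul ι s Real.sqrt (ι (Z t))⟫_ℝ) (Icc 0 T) ∧
    ContinuousOn (fun t => ⟪v t, ι (Z t)⟫_ℝ) (Icc 0 T) ∧
    ContinuousOn (fun t => ⟪specLiftSum ι s (u t), Z t⟫_ℝ - ⟪u t, ι (Z t)⟫_ℝ) (Icc 0 T) := by
  have hu : ContinuousOn u (Icc 0 T) := hsol.continuousOn_fst.mono Icc_subset_Ici_self
  have hv : ContinuousOn v (Icc 0 T) := hsol.continuousOn_snd.mono Icc_subset_Ici_self
  have hιZ : ContinuousOn (fun t => ι (Z t)) (Icc 0 T) :=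
    fun t ht => (hZ t ht).continuousAt.continuousWithinAt
  have c1 : ContinuousOn (fun t => ⟪v t, ψ t⟫_ℝ) (Icc 0 T) := hv.inner hψ
  have c2 : ContinuousOn (fun t => ⟪g, specMul ι s 1 (ι (Z t))⟫_ℝ) (Icc 0 T) :=
    continuousOn_const.inner ((specMul ι s 1).continuous.comp_continuousOn hιZ)
  have c3 : ContinuousOn (fun t => ⟪G (u t), ι (specLiftSum ι s (ι (Z t)))⟫_ℝ) (Icc 0 T) :=
    (hG.continuous.comp_continuousOn hu).inner
      ((ι ∘L specLiftSum ι s).continuous.comp_continuousOn hιZ)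
  have c4 : ContinuousOn (fun t => ⟪v t, specMul ι s Real.sqrt (ι (Z t))⟫_ℝ) (Icc 0 T) :=
    hv.inner ((specMul ι s Real.sqrt).continuous.comp_continuousOn hιZ)
  have c5 : ContinuousOn (fun t => ⟪v t, ι (Z t)⟫_ℝ) (Icc 0 T) := hv.inner hιZ
  have c6 : ContinuousOn (fun t => ⟪specLiftSum ι s (u t), Z t⟫_ℝ - ⟪u t, ι (Z t)⟫_ℝ)
      (Icc 0 T) := by
    -- The difference is ⟪-Δ u, ι Z⟫, in which only ι Z occurs; no continuity of Z in `V` is needed.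
    simp only [inner_specLiftSum, hsol.proj_fst, add_sub_cancel_left]
    exact ((specMul ι s id).continuous.comp_continuousOn hu).inner hιZ
  refine ⟨?_, c1, c2, c3, c4, c5, c6⟩
  have hi : ∀ {f : ℝ → ℝ}, ContinuousOn f (Icc 0 T) → IntegrableOn f (Ioo 0 T) := fun hf =>
    hf.integrableOn_Icc.mono_set Ioo_subset_Icc_self
  have hder : ∀ t ∈ uIcc 0 T, HasDerivAt (fun t => ⟪v t, ι (Z t)⟫_ℝ) (⟪v t, ψ t⟫_ℝ +
      ⟪g, specMul ι s 1 (ι (Z t))⟫_ℝ - ⟪G (u t), ι (specLiftSum ι s (ι (Z t)))⟫_ℝ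
      - γ * ⟪v t, specMul ι s Real.sqrt (ι (Z t))⟫_ℝ - α * ⟪v t, ι (Z t)⟫_ℝ
      - (⟪specLiftSum ι s (u t), Z t⟫_ℝ - ⟪u t, ι (Z t)⟫_ℝ)) t := fun t ht => by
    rw [uIcc_of_le hT] at ht
    refine ((hsol.deriv_snd t ht.1).inner ℝ (hZ t ht)).congr_deriv ?_
    rw [hsol.inner_deriv_snd hι]
    ring
  have hfin := intervalIntegral.integral_eq_sub_of_hasDerivAt hder
    (ContinuousOn.intervalIntegrable (by
      rw [uIcc_of_le hT]
      exact ((((c1.add c2).sub c3).sub (c4.const_mul γ)).sub (c5.const_mul α)).sub c6))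
  rw [h0, h1, map_zero, inner_zero_right, inner_zero_right, sub_zero,
    intervalIntegral.integral_of_le hT, integral_Ioc_eq_integral_Ioo] at hfin
  rw [← integral_linear_combination γ α (hi c1) (hi c2) (hi c3) (hi c4) (hi c5) (hi c6)]
  exact hfin

end IsGalerkinSolution

/-- `‖w‖²` in the domain of the spectral multiplier `(1 + λ)^θ`, grouped by spectral values. -/
def specNormSq (ι : V →L[ℝ] H) (θ : ℝ) (h : H) : ℝ≥0∞ :=
  ∑' l : ℝ, ENNReal.ofReal ((1 + l) ^ θ) * ‖specProj ι l h‖ₑ ^ 2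

theorem specNormSq_eq_sum (hs : ∀ l ∈ s, 0 ≤ l) (θ : ℝ) {h : H} (hh : specMul ι s 1 h = h) :
    specNormSq ι θ h = ENNReal.ofReal (∑ l ∈ s, (1 + l) ^ θ * ‖specProj ι l h‖ ^ 2) := by
  rw [specNormSq, tsum_eq_sum (s := s), ENNReal.ofReal_sum_of_nonneg]
  · refine Finset.sum_congr rfl fun l hl => ?_
    have := hs l hl
    rw [ENNReal.ofReal_mul (by positivity), ENNReal.ofReal_pow (norm_nonneg _), ofReal_norm]
  · intro l hl
    have := hs l hl
    positivity
  · intro l hl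
    rw [← hh, specProj_specMul_of_notMem hl, enorm_zero]
    simp

/-- On each eigenspace (1 + l)^{1/2} ≤ 1 + √l ≤ c (γ √l + α): the fractional damping controls high
frequencies and α the low ones. -/
theorem specNormSq_half_le (hs : ∀ l ∈ s, 0 ≤ l) {h : H} (hh : specMul ι s 1 h = h)
    {c : ℝ} (hc : 1 ≤ c * γ) (hc' : 1 ≤ c * α) :
    specNormSq ι (1 / 2) h ≤
      ENNReal.ofReal (c * (γ * ⟪specMul ι s Real.sqrt h, h⟫_ℝ + α * ‖h‖ ^ 2)) := by
  rw [specNormSq_eq_sum hs _ hh]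
  refine ENNReal.ofReal_le_ofReal ?_
  have h1 : ‖h‖ ^ 2 = ⟪specMul ι s 1 h, h⟫_ℝ := by rw [hh, real_inner_self_eq_norm_sq]
  rw [h1, inner_specMul_self, inner_specMul_self, Finset.mul_sum, Finset.mul_sum,
    ← Finset.sum_add_distrib, Finset.mul_sum]
  refine Finset.sum_le_sum fun l hl => ?_
  have hl0 := hs l hl
  have h2 : (1 + l) ^ (1 / 2 : ℝ) ≤ 1 + √l := by
    rw [← Real.sqrt_eq_rpow]
    refine Real.sqrt_le_iff.2 ⟨by positivity, ?_⟩
    nlinarith [Real.sqrt_nonneg l, Real.sq_sqrt hl0]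
  have h3 : 1 + √l ≤ c * (γ * √l + α) := by nlinarith [Real.sqrt_nonneg l]
  calc (1 + l) ^ (1 / 2 : ℝ) * ‖specProj ι l h‖ ^ 2
      ≤ c * (γ * √l + α) * ‖specProj ι l h‖ ^ 2 := by gcongr; exact h2.trans h3
    _ = _ := by simp only [Pi.one_apply]; ring

/-- Each finite partial sum passes to the limit, and the norm is the supremum of these sums. -/
theorem specNormSq_le_liminf {x : ℕ → H} {x' : H}
    (hx : ∀ l, Tendsto (fun n => specProj ι l (x n)) atTop (𝓝 (specProj ι l x'))) (θ : ℝ) :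
    specNormSq ι θ x' ≤ liminf (fun n => specNormSq ι θ (x n)) atTop := by
  rw [specNormSq, ENNReal.tsum_eq_iSup_sum]
  refine iSup_le fun F => ?_
  have h1 : Tendsto (fun n => ∑ l ∈ F, ENNReal.ofReal ((1 + l) ^ θ) * ‖specProj ι l (x n)‖ₑ ^ 2)
      atTop (𝓝 (∑ l ∈ F, ENNReal.ofReal ((1 + l) ^ θ) * ‖specProj ι l x'‖ₑ ^ 2)) := by
    refine tendsto_finsetSum _ fun l _ => ENNReal.Tendsto.const_mul ?_ (Or.inr ENNReal.ofReal_ne_top)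
    exact ENNReal.Tendsto.pow (hx l).enorm
  rw [← h1.liminf_eq]
  exact liminf_le_liminf (Eventually.of_forall fun n => ENNReal.sum_le_tsum F)

end GalerkinLimit

/-! ### Compactness of Galerkin solutions and passage to the limit -/

section LimitSolution

variable {V H : Type} [NormedAddCommGroup V] [InnerProductSpace ℝ V] [CompleteSpace V]
  [NormedAddCommGroup H] [InnerProductSpace ℝ H] [CompleteSpace H] {ι : V →L[ℝ] H}

/-- On a single eigenspace `greenOp` is multiplication by (1 + l)⁻¹, which can be undone;
convergence in the weak norm thus gives convergence of each spectral component. -/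
theorem greenOp_tendsto_specProj (hι : IsCompactEmbedding ι) {x : ℕ → H} {x' : H}
    (hx : Tendsto (fun n => greenOp ι (x n)) atTop (𝓝 (greenOp ι x'))) (l : ℝ) :
    Tendsto (fun n => specProj ι l (x n)) atTop (𝓝 (specProj ι l x')) := by
  rcases lt_or_ge l 0 with hl | hl
  · simp only [hι.specProj_eq_zero hl]; exact tendsto_const_nhds
  have h1 : ∀ h : H, specProj ι l h = (1 + l) • specProj ι l (greenOp ι h) := fun h => by
    rw [specProj_greenOp, smul_smul, mul_inv_cancel₀ (by positivity), one_smul]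
  rw [h1]
  simp only [h1 (x _)]
  exact (((specProj ι l).continuous.tendsto _).comp hx).const_smul _

/-- Compactness of bounded paths whose second derivatives are bounded in the dual of `V`. -/
theorem exists_subseq_tendsto_path (hι : IsCompactEmbedding ι) {U : ℕ → ℝ → V} {v w : ℕ → ℝ → H}
    {R C : ℝ} (hU : ∀ n t, 0 ≤ t → ‖U n t‖ ≤ R) (hv : ∀ n t, 0 ≤ t → ‖v n t‖ ≤ R)
    (hdU : ∀ n t, 0 ≤ t → HasDerivAt (fun t => ι (U n t)) (v n t) t)
    (hdv : ∀ n t, 0 ≤ t → HasDerivAt (v n) (w n t) t)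
    (hw : ∀ n t, 0 ≤ t → ∀ z, ‖z‖ ≤ 1 → |⟪w n t, ι z⟫_ℝ| ≤ C) :
    ∃ k : ℕ → ℕ, StrictMono k ∧ ∃ (U' : ℝ → V) (v' : ℝ → H),
      (∀ t, 0 ≤ t → ∀ z, Tendsto (fun n => ⟪z, U (k n) t⟫_ℝ) atTop (𝓝 ⟪z, U' t⟫_ℝ)) ∧
      (∀ t, 0 ≤ t → Tendsto (fun n => ι (U (k n) t)) atTop (𝓝 (ι (U' t)))) ∧
      (∀ t, 0 ≤ t → ∀ z, Tendsto (fun n => ⟪z, v (k n) t⟫_ℝ) atTop (𝓝 ⟪z, v' t⟫_ℝ)) ∧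
      (∀ t, 0 ≤ t → Tendsto (fun n => greenOp ι (v (k n) t)) atTop (𝓝 (greenOp ι (v' t)))) ∧
      ContinuousOn (fun t => ι (U' t)) (Ici 0) ∧
      ContinuousOn (fun t => greenOp ι (v' t)) (Ici 0) := by
  have hR : 0 ≤ R := (norm_nonneg _).trans (hU 0 0 le_rfl)
  have hC : 0 ≤ C := (abs_nonneg _).trans (hw 0 0 le_rfl 0 (by simp))
  -- Duality: with e the unit vector in the direction of ιι* w, the test vector ι* e has norm at
  -- most 1 in `V` and pairs with w to ‖ιι* w‖.
  have hgw : ∀ n t, 0 ≤ t → ‖greenOp ι (w n t)‖ ≤ C := fun n t ht => by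
    by_cases h0 : greenOp ι (w n t) = 0
    · rw [h0, norm_zero]; exact hC
    set e := ‖greenOp ι (w n t)‖⁻¹ • greenOp ι (w n t) with he
    have hpos : ‖greenOp ι (w n t)‖ ≠ 0 := norm_ne_zero_iff.2 h0
    have he1 : ‖e‖ = 1 := by rw [he, norm_smul, norm_inv, norm_norm, inv_mul_cancel₀ hpos]
    have h1 := hw n t ht (ι.adjoint e) ((hι.norm_adjoint_le e).trans he1.le)
    have h2 : ⟪w n t, ι (ι.adjoint e)⟫_ℝ = ⟪greenOp ι (w n t), e⟫_ℝ := by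
      rw [inner_greenOp_left, ContinuousLinearMap.adjoint_inner_left]
    rw [h2, he, inner_smul_right, real_inner_self_eq_norm_sq, sq, ← mul_assoc,
      inv_mul_cancel₀ hpos, one_mul, abs_norm] at h1
    exact h1
  have hLip : ∀ {y y' : ℝ → H} {D : ℝ}, (∀ t, 0 ≤ t → HasDerivAt y (y' t) t) →
      (∀ t, 0 ≤ t → ‖y' t‖ ≤ D) → ∀ s t, 0 ≤ s → 0 ≤ t → dist (y s) (y t) ≤ D * |s - t| := by
    intro y y' D hy hy' s t hs ht
    rw [dist_eq_norm, ← Real.norm_eq_abs]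
    exact Convex.norm_image_sub_le_of_norm_hasDerivWithin_le (s := Ici 0)
      (fun x hx => (hy x hx).hasDerivWithinAt) hy' (convex_Ici 0) ht hs
  -- At every time both components stay in the closed image of a ball under a compact operator,
  -- which is the fixed compact set required for the pointwise selection.
  have hc1 : IsCompact (closure (ι '' Metric.closedBall 0 R)) :=
    IsCompactOperator.isCompact_closure_image_closedBall (f := ι.toLinearMap) hι.compact R
  have hc2 : IsCompact (closure (greenOp ι '' Metric.closedBall 0 R)) :=
    IsCompactOperator.isCompact_closure_image_closedBall (f := (greenOp ι).toLinearMap)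
      (hι.compact.comp_clm ι.adjoint) R
  have hlipx : ∀ n s t, 0 ≤ s → 0 ≤ t → dist (ι (U n s), greenOp ι (v n s))
      (ι (U n t), greenOp ι (v n t)) ≤ max R C * |s - t| := fun n s t hs ht => by
    rw [Prod.dist_eq, max_mul_of_nonneg _ _ (abs_nonneg _)]
    refine max_le_max (hLip (hdU n) (hv n) s t hs ht) (hLip (y := fun t => greenOp ι (v n t))
      (fun t ht => (greenOp ι).hasFDerivAt.comp_hasDerivAt t (hdv n t ht)) (hgw n) s t hs ht)
  obtain ⟨k, hk, y, hy⟩ := exists_subseq_tendsto_of_lipschitz (hc1.prod hc2)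
    (x := fun n t => (ι (U n t), greenOp ι (v n t))) (fun n t ht =>
      ⟨subset_closure ⟨_, mem_closedBall_zero_iff.2 (hU n t ht), rfl⟩,
        subset_closure ⟨_, mem_closedBall_zero_iff.2 (hv n t ht), rfl⟩⟩) hlipx
  have hy1 : ∀ t, 0 ≤ t → Tendsto (fun n => ι (U (k n) t)) atTop (𝓝 (y t).1) := fun t ht =>
    (continuous_fst.tendsto _).comp (hy t ht)
  have hy2 : ∀ t, 0 ≤ t → Tendsto (fun n => greenOp ι (v (k n) t)) atTop (𝓝 (y t).2) := fun t ht =>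
    (continuous_snd.tendsto _).comp (hy t ht)
  have hylip : LipschitzOnWith (max R C).toNNReal y (Ici 0) := by
    refine LipschitzOnWith.of_dist_le_mul fun s hs t ht => ?_
    rw [Real.coe_toNNReal _ (hR.trans (le_max_left _ _)), Real.dist_eq]
    exact le_of_tendsto ((hy s hs).dist (hy t ht))
      (Eventually.of_forall fun n => hlipx (k n) s t hs ht)
  -- Convergence of ι U in `H` is convergence of U against the dense range of ι*; boundedness
  -- upgrades it to weak convergence in `V`.
  have hex1 : ∀ t, ∃ x : V, 0 ≤ t → ∀ z, Tendsto (fun n => ⟪z, U (k n) t⟫_ℝ) atTop (𝓝 ⟪z, x⟫_ℝ) := by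
    intro t
    by_cases ht : 0 ≤ t
    · obtain ⟨x, hx⟩ := exists_weak_limit (fun n => hU (k n) t ht) hι.denseRange_adjoint
        (fun h => ⟨_, ((tendsto_const_nhds (x := h)).inner (𝕜 := ℝ) (hy1 t ht)).congr fun n =>
          (ContinuousLinearMap.adjoint_inner_left _ _ _).symm⟩)
      exact ⟨x, fun _ => hx⟩
    · exact ⟨0, fun h => absurd h ht⟩
  have hex2 : ∀ t, ∃ x : H, 0 ≤ t → ∀ z, Tendsto (fun n => ⟪z, v (k n) t⟫_ℝ) atTop (𝓝 ⟪z, x⟫_ℝ) := by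
    intro t
    by_cases ht : 0 ≤ t
    · obtain ⟨x, hx⟩ := exists_weak_limit (fun n => hv (k n) t ht) hι.denseRange_greenOp
        (fun h => ⟨_, ((tendsto_const_nhds (x := h)).inner (𝕜 := ℝ) (hy2 t ht)).congr fun n =>
          (greenOp_isSymmetric ι h (v (k n) t)).symm⟩)
      exact ⟨x, fun _ => hx⟩
    · exact ⟨0, fun h => absurd h ht⟩
  choose U' hU' using hex1
  choose v' hv' using hex2
  have hyU : ∀ t, 0 ≤ t → (y t).1 = ι (U' t) := fun t ht => by
    refine ext_inner_left ℝ fun h => ?_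
    refine tendsto_nhds_unique ((tendsto_const_nhds (x := h)).inner (𝕜 := ℝ) (hy1 t ht)) ?_
    rw [← ContinuousLinearMap.adjoint_inner_left]
    exact (hU' t ht _).congr fun n => ContinuousLinearMap.adjoint_inner_left _ _ _
  have hyv : ∀ t, 0 ≤ t → (y t).2 = greenOp ι (v' t) := fun t ht => by
    refine ext_inner_left ℝ fun h => ?_
    refine tendsto_nhds_unique ((tendsto_const_nhds (x := h)).inner (𝕜 := ℝ) (hy2 t ht)) ?_
    have h1 : ∀ x, ⟪h, greenOp ι x⟫_ℝ = ⟪greenOp ι h, x⟫_ℝ := fun x =>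
      (greenOp_isSymmetric ι h x).symm
    simp only [h1]
    exact hv' t ht _
  refine ⟨k, hk, U', v', hU', fun t ht => hyU t ht ▸ hy1 t ht, hv', fun t ht => hyv t ht ▸ hy2 t ht,
    ?_, ?_⟩
  · exact (continuous_fst.comp_continuousOn hylip.continuousOn).congr fun t ht => (hyU t ht).symm
  · exact (continuous_snd.comp_continuousOn hylip.continuousOn).congr fun t ht => (hyv t ht).symm

/-- A family of dissipative gradient fields `G n` that approximates the form `B` on `V × V`. -/
structure IsApproximation (ι : V →L[ℝ] H) (G : ℕ → H → H) (Φ : ℕ → H → ℝ) (B : V → V → ℝ)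
    (ε κ C : ℝ) : Prop where
  dissipative : ∀ n, IsDissipative (G n) (Φ n) ε κ C
  potential_le : ∀ n w, |Φ n (ι w)| ≤ C * (1 + ‖w‖ ^ 6)
  bounded : ∀ M, ∃ D, ∀ n w z, ‖w‖ ≤ M → ‖z‖ ≤ M → |⟪G n (ι w), ι z⟫_ℝ| ≤ D
  tendsto : ∀ (k : ℕ → ℕ) (w : ℕ → V) (w' : V) (z : ℕ → V) (z' : V) (M : ℝ),
    Tendsto k atTop atTop → (∀ n, ‖w n‖ ≤ M) → Tendsto (fun n => ι (w n)) atTop (𝓝 (ι w')) →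
    Tendsto z atTop (𝓝 z') →
    Tendsto (fun n => ⟪G (k n) (ι (w n)), ι (z n)⟫_ℝ) atTop (𝓝 (B w' z'))

/-- A bounded path in `V` vanishing at `0` and `T`, continuously differentiable as a path
in `H`. -/
structure IsTestPath (ι : V →L[ℝ] H) (T : ℝ) (Z : ℝ → V) (ψ : ℝ → H) : Prop where
  bounded : ∃ M, ∀ t ∈ Icc 0 T, ‖Z t‖ ≤ M
  hasDerivAt : ∀ t ∈ Icc 0 T, HasDerivAt (fun t => ι (Z t)) (ψ t) t
  continuousOn : ContinuousOn ψ (Icc 0 T)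
  left : Z 0 = 0
  right : Z T = 0

/-- Weak solutions of `u'' + γ (-Δ)^{1/2} u' + α u' - Δ u + B(u, ·) = g`. -/
structure IsLimitSolution (ι : V →L[ℝ] H) (γ α : ℝ) (B : V → V → ℝ) (g : H) (u₀ : V) (u₁ : H)
    (U : ℝ → V) (v : ℝ → H) : Prop where
  initial_fst : U 0 = u₀
  initial_snd : v 0 = u₁
  continuousOn_map : ContinuousOn (fun t => ι (U t)) (Ici 0)
  continuousOn_green : ContinuousOn (fun t => greenOp ι (v t)) (Ici 0)
  weak_fst : ∀ z, ContinuousOn (fun t => ⟪z, U t⟫_ℝ) (Ici 0)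
  weak_snd : ∀ z, ContinuousOn (fun t => ⟪z, v t⟫_ℝ) (Ici 0)
  time_deriv : ∀ T > 0, ∀ Z ψ, IsTestPath ι T Z ψ →
    ∫ t in Ioo 0 T, ⟪ι (U t), ψ t⟫_ℝ = -∫ t in Ioo 0 T, ⟪v t, ι (Z t)⟫_ℝ
  equation : ∀ T > 0, ∀ Z ψ, IsTestPath ι T Z ψ →
    -(∫ t in Ioo 0 T, ⟪v t, ψ t⟫_ℝ) + (∫ t in Ioo 0 T, (⟪U t, Z t⟫_ℝ - ⟪ι (U t), ι (Z t)⟫_ℝ))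
      + α * (∫ t in Ioo 0 T, ⟪v t, ι (Z t)⟫_ℝ)
      + γ * (∫ t in Ioo 0 T, ⟪v t, ∑' l : ℝ, √l • specProj ι l (ι (Z t))⟫_ℝ)
      + (∫ t in Ioo 0 T, B (U t) (Z t))
      = ∫ t in Ioo 0 T, ⟪g, ι (Z t)⟫_ℝ

theorem specProj_eq_zero_of_specSpace_eq_bot {l : ℝ} (hl : specSpace ι l = ⊥) (h : H) :
    specProj ι l h = 0 := by
  have := specProj_mem (ι := ι) l h
  rwa [hl, Submodule.mem_bot] at this

theorem specLift_eq_zero_of_specSpace_eq_bot {l : ℝ} (hl : specSpace ι l = ⊥) (h : H) :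
    specLift ι l h = 0 := by
  simp [specLift, specProj_eq_zero_of_specSpace_eq_bot hl]

end LimitSolution

section LimitSolution

variable {V H : Type} [NormedAddCommGroup V] [InnerProductSpace ℝ V] [CompleteSpace V]
  [NormedAddCommGroup H] [InnerProductSpace ℝ H] [CompleteSpace H] {ι : V →L[ℝ] H}
  {G : ℕ → H → H} {Φ : ℕ → H → ℝ} {B : V → V → ℝ} {ε κ C γ α : ℝ} {s : ℕ → Finset ℝ} {g : H}
  {u v : ℕ → ℝ → H}

theorem IsGalerkinSolution.hasDerivAt_map {s : Finset ℝ} {G : H → H} {u v : ℝ → H}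
    (hι : IsCompactEmbedding ι) (hsol : IsGalerkinSolution ι s γ α G g u v) {t : ℝ} (ht : 0 ≤ t) :
    HasDerivAt (fun t => ι (specLiftSum ι s (u t))) (v t) t := by
  simp only [hsol.map_specLiftSum hι]
  exact hsol.deriv_fst t ht

/-- Passage to the limit in the Galerkin equations along a sequence with the convergence properties
of `exists_subseq_tendsto_path`. -/
theorem isLimitSolution_of_tendsto (hι : IsCompactEmbedding ι)
    (happ : IsApproximation ι G Φ B ε κ C) {s : ℕ → Finset ℝ} (hs : ∀ n, ∀ l ∈ s n, 0 ≤ l)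
    (hsum : ∀ {X : Type} [AddCommGroup X] [TopologicalSpace X] (F : ℝ → X) (a : X),
      (∀ l, specSpace ι l = ⊥ → F l = 0) → HasSum F a →
        Tendsto (fun n => ∑ l ∈ s n, F l) atTop (𝓝 a))
    {k : ℕ → ℕ} (hk : Tendsto k atTop atTop) {u v : ℕ → ℝ → H} {u₀ : V} {u₁ : H}
    (hsol : ∀ n, IsGalerkinSolution ι (s n) γ α (G (k n)) g (u n) (v n))
    (hu0 : ∀ n, u n 0 = specMul ι (s n) 1 (ι u₀)) (hv0 : ∀ n, v n 0 = specMul ι (s n) 1 u₁)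
    {R : ℝ} (hUb : ∀ n t, 0 ≤ t → ‖specLiftSum ι (s n) (u n t)‖ ≤ R)
    (hvb : ∀ n t, 0 ≤ t → ‖v n t‖ ≤ R) {U : ℝ → V} {w : ℝ → H}
    (hU : ∀ t, 0 ≤ t → ∀ z, Tendsto (fun n => ⟪z, specLiftSum ι (s n) (u n t)⟫_ℝ) atTop
      (𝓝 ⟪z, U t⟫_ℝ))
    (hιU : ∀ t, 0 ≤ t → Tendsto (fun n => ι (specLiftSum ι (s n) (u n t))) atTop (𝓝 (ι (U t))))
    (hw : ∀ t, 0 ≤ t → ∀ z, Tendsto (fun n => ⟪z, v n t⟫_ℝ) atTop (𝓝 ⟪z, w t⟫_ℝ))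
    (hUc : ContinuousOn (fun t => ι (U t)) (Ici 0))
    (hwc : ContinuousOn (fun t => greenOp ι (w t)) (Ici 0)) :
    IsLimitSolution ι γ α B g u₀ u₁ U w := by
  have hR : 0 ≤ R := (norm_nonneg _).trans (hUb 0 0 le_rfl)
  have hP : ∀ h : H, Tendsto (fun n => specMul ι (s n) 1 h) atTop (𝓝 h) := fun h => by
    simp only [specMul_one_apply]
    exact hsum _ _ (fun l hl => specProj_eq_zero_of_specSpace_eq_bot hl h) (hι.hasSum_specProj h)
  have hL : ∀ z : V, Tendsto (fun n => specLiftSum ι (s n) (ι z)) atTop (𝓝 z) := fun z => by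
    simp only [specLiftSum_apply]
    exact hsum _ _ (fun l hl => specLift_eq_zero_of_specSpace_eq_bot hl _) (hι.hasSum_specLift z)
  have hS : ∀ z : V, Tendsto (fun n => specMul ι (s n) Real.sqrt (ι z)) atTop
      (𝓝 (∑' l : ℝ, √l • specProj ι l (ι z))) := fun z => by
    simp only [specMul_apply]
    exact hsum _ _ (fun l hl => by rw [specProj_eq_zero_of_specSpace_eq_bot hl, smul_zero])
      (hι.summable_sqrt_smul_specProj z).hasSum
  have hUR : ∀ t ∈ Ici (0 : ℝ), ‖U t‖ ≤ R := fun t ht => by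
    have h1 := hU t ht (U t)
    rw [real_inner_self_eq_norm_sq] at h1
    have h2 : ‖U t‖ ^ 2 ≤ ‖U t‖ * R := le_of_tendsto h1 (Eventually.of_forall fun n =>
      (real_inner_le_norm _ _).trans (by gcongr; exact hUb n t ht))
    nlinarith [norm_nonneg (U t)]
  have hwR : ∀ t ∈ Ici (0 : ℝ), ‖w t‖ ≤ R := fun t ht => by
    have h1 := hw t ht (w t)
    rw [real_inner_self_eq_norm_sq] at h1
    have h2 : ‖w t‖ ^ 2 ≤ ‖w t‖ * R := le_of_tendsto h1 (Eventually.of_forall fun n =>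
      (real_inner_le_norm _ _).trans (by gcongr; exact hvb n t ht))
    nlinarith [norm_nonneg (w t)]
  have hιle : ∀ {z : V} {M : ℝ}, ‖z‖ ≤ M → ‖ι z‖ ≤ M := fun hz => (hι.norm_le _).trans hz
  refine ⟨?_, ?_, hUc, hwc, ?_, ?_, ?_, ?_⟩
  · refine hι.injective (tendsto_nhds_unique (hιU 0 le_rfl) ?_)
    refine (hP (ι u₀)).congr fun n => ?_
    rw [(hsol n).map_specLiftSum hι, hu0]
  · refine ext_inner_left ℝ fun z => tendsto_nhds_unique (hw 0 le_rfl z) ?_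
    simp only [hv0]
    exact tendsto_const_nhds.inner (hP u₁)
  -- Norm continuity in `H` together with a bound in `V` gives weak continuity in `V`, because the
  -- range of ι* is dense.
  · refine continuousOn_inner_of_dense hUR hι.denseRange_adjoint fun h => ?_
    simp only [ContinuousLinearMap.adjoint_inner_left]
    exact continuousOn_const.inner hUc
  · refine continuousOn_inner_of_dense hwR hι.denseRange_greenOp fun h => ?_
    have h1 : ∀ x, ⟪greenOp ι h, x⟫_ℝ = ⟪h, greenOp ι x⟫_ℝ := greenOp_isSymmetric ι h
    simp only [h1]
    exact continuousOn_const.inner hwc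
  · intro T hT Z ψ hZ
    obtain ⟨M, hM⟩ := hZ.bounded
    obtain ⟨M', hM'⟩ := isCompact_Icc.exists_bound_of_continuousOn hZ.continuousOn
    have hιZ : ContinuousOn (fun t => ι (Z t)) (Icc 0 T) :=
      fun t ht => (hZ.hasDerivAt t ht).continuousAt.continuousWithinAt
    have huc : ∀ n, ContinuousOn (u n) (Icc 0 T) := fun n =>
      (hsol n).continuousOn_fst.mono Icc_subset_Ici_self
    have hvc : ∀ n, ContinuousOn (v n) (Icc 0 T) := fun n =>
      (hsol n).continuousOn_snd.mono Icc_subset_Ici_self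
    have c1 : ∀ n, ContinuousOn (fun t => ⟪u n t, ψ t⟫_ℝ) (Icc 0 T) := fun n =>
      (huc n).inner hZ.continuousOn
    have c2 : ∀ n, ContinuousOn (fun t => ⟪v n t, ι (Z t)⟫_ℝ) (Icc 0 T) := fun n =>
      (hvc n).inner hιZ
    have e : ∀ n, ∫ t in Ioo 0 T, ⟪u n t, ψ t⟫_ℝ = -∫ t in Ioo 0 T, ⟪v n t, ι (Z t)⟫_ℝ := fun n => by
      have h1 := intervalIntegral.integral_eq_sub_of_hasDerivAt (a := 0) (b := T)
        (f := fun t => ⟪u n t, ι (Z t)⟫_ℝ) (f' := fun t => ⟪u n t, ψ t⟫_ℝ + ⟪v n t, ι (Z t)⟫_ℝ)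
        (fun t ht => by
          rw [uIcc_of_le hT.le] at ht
          exact ((hsol n).deriv_fst t ht.1).inner ℝ (hZ.hasDerivAt t ht))
        (ContinuousOn.intervalIntegrable (by rw [uIcc_of_le hT.le]; exact (c1 n).add (c2 n)))
      rw [hZ.left, hZ.right, map_zero, inner_zero_right, inner_zero_right, sub_zero,
        intervalIntegral.integral_of_le hT.le, integral_Ioc_eq_integral_Ioo, integral_add
          ((c1 n).integrableOn_Icc.mono_set Ioo_subset_Icc_self)
          ((c2 n).integrableOn_Icc.mono_set Ioo_subset_Icc_self)] at h1
      linarith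
    have t1 : Tendsto (fun n => ∫ t in Ioo 0 T, ⟪u n t, ψ t⟫_ℝ) atTop
        (𝓝 (∫ t in Ioo 0 T, ⟪ι (U t), ψ t⟫_ℝ)) := by
      refine tendsto_integral_Ioo_of_bounded (C := R * M') c1 (fun n t ht => ?_) fun t ht => ?_
      · refine (abs_real_inner_le_norm _ _).trans ?_
        gcongr
        · rw [← (hsol n).map_specLiftSum hι]; exact hιle (hUb n t ht.1.le)
        · exact hM' t (Ioo_subset_Icc_self ht)
      · refine (((hιU t ht.1.le).congr fun n => (hsol n).map_specLiftSum hι t)).inner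
          tendsto_const_nhds
    have t2 : Tendsto (fun n => ∫ t in Ioo 0 T, ⟪v n t, ι (Z t)⟫_ℝ) atTop
        (𝓝 (∫ t in Ioo 0 T, ⟪w t, ι (Z t)⟫_ℝ)) := by
      refine tendsto_integral_Ioo_of_bounded (C := R * M) c2 (fun n t ht => ?_) fun t ht => ?_
      · refine (abs_real_inner_le_norm _ _).trans ?_
        gcongr
        · exact hvb n t ht.1.le
        · exact hιle (hM t (Ioo_subset_Icc_self ht))
      · exact tendsto_inner_of_weak (fun n => hvb n t ht.1.le) (hw t ht.1.le) tendsto_const_nhds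
    simp only [e] at t1
    exact tendsto_nhds_unique t1 t2.neg
  · intro T hT Z ψ hZ
    obtain ⟨M, hM⟩ := hZ.bounded
    obtain ⟨M', hM'⟩ := isCompact_Icc.exists_bound_of_continuousOn hZ.continuousOn
    have hM0 : 0 ≤ M := (norm_nonneg _).trans (hM 0 ⟨le_rfl, hT.le⟩)
    obtain ⟨D, hD⟩ := happ.bounded (max R M)
    have key := fun n => (hsol n).integral_eq hι (happ.dissipative (k n)).lipschitz.choose_spec
      hT.le hZ.hasDerivAt hZ.continuousOn hZ.left hZ.right
    have hUn : ∀ n t, G (k n) (u n t) = G (k n) (ι (specLiftSum ι (s n) (u n t))) := fun n t => by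
      rw [(hsol n).map_specLiftSum hι]
    have hun : ∀ n t, u n t = ι (specLiftSum ι (s n) (u n t)) := fun n t =>
      ((hsol n).map_specLiftSum hι t).symm
    have t1 := tendsto_integral_Ioo_of_bounded (C := R * M') (fun n => (key n).2.1)
      (fun n t ht => (abs_real_inner_le_norm _ _).trans (by
        gcongr
        · exact hvb n t ht.1.le
        · exact hM' t (Ioo_subset_Icc_self ht)))
      (fun t ht => tendsto_inner_of_weak (fun n => hvb n t ht.1.le) (hw t ht.1.le)
        tendsto_const_nhds)
    have t2 := tendsto_integral_Ioo_of_bounded (C := ‖g‖ * M) (fun n => (key n).2.2.1)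
      (fun n t ht => (abs_real_inner_le_norm _ _).trans (by
        gcongr
        exact (norm_specMul_one_le _).trans (hιle (hM t (Ioo_subset_Icc_self ht)))))
      (fun t ht => tendsto_const_nhds.inner (hP (ι (Z t))))
    -- The only nonlinear term. The projected test vectors converge strongly in `V`, whereas the
    -- states converge strongly only in `H` and are bounded in `V`; `IsApproximation.tendsto` is
    -- tailored to this.
    have t3 := tendsto_integral_Ioo_of_bounded (C := D) (fun n => (key n).2.2.2.1)
      (fun n t ht => by
        rw [hUn]
        exact hD _ _ _ ((hUb n t ht.1.le).trans (le_max_left _ _))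
          ((hι.norm_specLiftSum_le _).trans ((hM t (Ioo_subset_Icc_self ht)).trans
            (le_max_right _ _))))
      (fun t ht => by
        simp only [hUn]
        exact happ.tendsto k _ (U t) _ (Z t) R hk (fun n => hUb n t ht.1.le) (hιU t ht.1.le)
          (hL (Z t)))
    have t4 := tendsto_integral_Ioo_of_bounded (C := R * M) (fun n => (key n).2.2.2.2.1)
      (fun n t ht => (abs_real_inner_le_norm _ _).trans (by
        gcongr
        · exact hvb n t ht.1.le
        · exact (hι.norm_specMul_sqrt_le (hs n) _).trans (hM t (Ioo_subset_Icc_self ht))))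
      (fun t ht => tendsto_inner_of_weak (fun n => hvb n t ht.1.le) (hw t ht.1.le) (hS (Z t)))
    have t5 := tendsto_integral_Ioo_of_bounded (C := R * M) (fun n => (key n).2.2.2.2.2.1)
      (fun n t ht => (abs_real_inner_le_norm _ _).trans (by
        gcongr
        · exact hvb n t ht.1.le
        · exact hιle (hM t (Ioo_subset_Icc_self ht))))
      (fun t ht => tendsto_inner_of_weak (fun n => hvb n t ht.1.le) (hw t ht.1.le)
        tendsto_const_nhds)
    have t6 := tendsto_integral_Ioo_of_bounded (C := R * M + R * M)
      (Y := fun t => ⟪U t, Z t⟫_ℝ - ⟪ι (U t), ι (Z t)⟫_ℝ) (fun n => (key n).2.2.2.2.2.2)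
      (fun n t ht => by
        refine (abs_sub _ _).trans (add_le_add ((abs_real_inner_le_norm _ _).trans ?_)
          ((abs_real_inner_le_norm _ _).trans ?_))
        · gcongr
          · exact hUb n t ht.1.le
          · exact hM t (Ioo_subset_Icc_self ht)
        · gcongr
          · rw [hun]; exact hιle (hUb n t ht.1.le)
          · exact hιle (hM t (Ioo_subset_Icc_self ht)))
      (fun t ht => by
        refine (tendsto_inner_of_weak (fun n => hUb n t ht.1.le) (hU t ht.1.le)
          tendsto_const_nhds).sub ?_
        exact ((hιU t ht.1.le).congr fun n => (hsol n).map_specLiftSum hι t).inner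
          tendsto_const_nhds)
    have hfin := ((((t1.add t2).sub t3).sub (t4.const_mul γ)).sub (t5.const_mul α)).sub t6
    have h0 := tendsto_nhds_unique hfin (tendsto_const_nhds.congr fun n => ((key n).1).symm)
    linarith

end LimitSolution

/-! ### Existence with the energy estimate for the abstract equation -/

section LimitSolution

variable {V H : Type} [NormedAddCommGroup V] [InnerProductSpace ℝ V] [CompleteSpace V]
  [NormedAddCommGroup H] [InnerProductSpace ℝ H] [CompleteSpace H] {ι : V →L[ℝ] H}
  {γ α : ℝ} {g : H}

/-- Translates the dissipation of the energy estimate into the H^{1/2} norm of the velocity. The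
coefficient α / 4 is what that estimate leaves of the damping; measurability holds because the
spectral sum is finite and v is continuous. -/
theorem IsGalerkinSolution.lintegral_specNormSq_le {s : Finset ℝ} {G : H → H} {u v : ℝ → H}
    (hsol : IsGalerkinSolution ι s γ α G g u v) (hs : ∀ l ∈ s, 0 ≤ l) (hγ : 0 < γ) (hα : 0 < α)
    {c : ℝ} (hc : 1 ≤ c * γ) (hc' : 1 ≤ c * (α / 4)) (hc0 : 0 ≤ c) {t : ℝ} (ht : 0 ≤ t) :
    AEMeasurable (fun τ => specNormSq ι (1 / 2) (v τ)) (volume.restrict (Ioc t (t + 1))) ∧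
    ∫⁻ τ in Ioc t (t + 1), specNormSq ι (1 / 2) (v τ) ≤ ENNReal.ofReal (c *
      ∫ τ in t..t + 1, (γ * ⟪specMul ι s Real.sqrt (v τ), v τ⟫_ℝ + α / 4 * ‖v τ‖ ^ 2)) := by
  have hsub : Icc t (t + 1) ⊆ Ici 0 := fun τ hτ => ht.trans hτ.1
  have hv : ContinuousOn v (Icc t (t + 1)) := hsol.continuousOn_snd.mono hsub
  constructor
  · simp only [specNormSq_eq_sum hs _ (hsol.proj_snd _)]
    have h1 : ContinuousOn (fun τ => ∑ l ∈ s, (1 + l) ^ (1 / 2 : ℝ) * ‖specProj ι l (v τ)‖ ^ 2)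
        (Icc t (t + 1)) := continuousOn_finsetSum _ fun l _ =>
      continuousOn_const.mul (((specProj ι l).continuous.comp_continuousOn hv).norm.pow 2)
    exact ((h1.mono Ioc_subset_Icc_self).aemeasurable measurableSet_Ioc).ennreal_ofReal
  · have hDc : ContinuousOn (fun τ => c * (γ * ⟪specMul ι s Real.sqrt (v τ), v τ⟫_ℝ +
        α / 4 * ‖v τ‖ ^ 2)) (Icc t (t + 1)) :=
      continuousOn_const.mul (((((specMul ι s Real.sqrt).continuous.comp_continuousOn hv).inner
        hv).const_mul γ |>.add ((hv.norm.pow 2).const_mul (α / 4))))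
    have hint := (hDc.integrableOn_Icc (μ := volume)).mono_set (Ioc_subset_Icc_self (a := t) (b := t + 1))
    rw [← intervalIntegral.integral_const_mul, intervalIntegral.integral_of_le (by linarith),
      ofReal_integral_eq_lintegral_ofReal hint (Eventually.of_forall fun τ => by
        have := inner_specMul_nonneg (ι := ι) hs (fun l _ => Real.sqrt_nonneg l) (v τ)
        simp only [Pi.zero_apply]
        positivity)]
    exact lintegral_mono fun τ => specNormSq_half_le hs (hsol.proj_snd τ) hc hc'

/-- Existence of weak solutions with the dissipative energy estimate, in abstract form. -/
theorem exists_isLimitSolution [TopologicalSpace.SeparableSpace H] (hι : IsCompactEmbedding ι)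
    {G : ℕ → H → H} {Φ : ℕ → H → ℝ} {B : V → V → ℝ} {ε κ C : ℝ}
    (happ : IsApproximation ι G Φ B ε κ C) (hε : 0 < ε) (hκ : 0 < κ) (hC : 0 ≤ C)
    (hα : 0 < α) (hγ : 0 < γ) : ∃ β M : ℝ, 0 < β ∧ 0 < M ∧ ∀ (g : H) (u₀ : V) (u₁ : H),
      ∃ (U : ℝ → V) (v : ℝ → H), IsLimitSolution ι γ α B g u₀ u₁ U v ∧ ∀ t, 0 ≤ t →
        ENNReal.ofReal (‖U t‖ ^ 2) + ENNReal.ofReal (‖v t‖ ^ 2) +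
          ∫⁻ τ in Ioc t (t + 1), specNormSq ι (1 / 2) (v τ) ≤
        ENNReal.ofReal (M * ((1 + ‖u₀‖ ^ 6 + ‖u₁‖ ^ 2) * Real.exp (-β * t) + 1 + ‖g‖ ^ 2)) := by
  obtain ⟨β, M, hβ, hM, hest⟩ := exists_galerkin_estimate hι hε hκ hC hα hγ
  obtain ⟨c, hc0, hc1, hc2, hc3⟩ : ∃ c : ℝ, 0 ≤ c ∧ 1 ≤ c ∧ 1 ≤ c * γ ∧ 1 ≤ c * (α / 4) := by
    have h1 : 0 < γ⁻¹ := inv_pos.2 hγ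
    have h2 : 0 < (α / 4)⁻¹ := by positivity
    refine ⟨1 + γ⁻¹ + (α / 4)⁻¹, by positivity, by linarith, ?_, ?_⟩
    · have : γ⁻¹ * γ = 1 := inv_mul_cancel₀ hγ.ne'
      nlinarith
    · have : (α / 4)⁻¹ * (α / 4) = 1 := inv_mul_cancel₀ (by positivity)
      nlinarith
  obtain ⟨s, hs, hsum⟩ := hι.exists_exhaustion
  -- C + 2 collects the initial potential, at most C (1 + ‖u₀‖⁶), and the two squared norms of the
  -- data; c converts the dissipation into the H^{1/2} norm.
  refine ⟨β, c * (M * (C + 2)), hβ, by positivity, fun g u₀ u₁ => ?_⟩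
  choose u v hsol hu0 hv0 using fun n => exists_isGalerkinSolution ι (s n) γ α
    (happ.dissipative n).lipschitz.choose_spec g (ι u₀) u₁
  set W : ℕ → ℝ → V := fun n t => specLiftSum ι (s n) (u n t) with hW
  have hW0 : ∀ n, ‖W n 0‖ ≤ ‖u₀‖ := fun n => by
    simp only [hW, hu0, IsCompactEmbedding.specLiftSum_specMul_one]
    exact hι.norm_specLiftSum_le u₀
  have hΦ0 : ∀ n, |Φ n (u n 0)| ≤ C * (1 + ‖u₀‖ ^ 6) := fun n => by
    rw [← (hsol n).map_specLiftSum hι]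
    refine (happ.potential_le n _).trans ?_
    gcongr
    exact hW0 n
  have hv0' : ∀ n, ‖v n 0‖ ≤ ‖u₁‖ := fun n => by rw [hv0]; exact norm_specMul_one_le u₁
  set b : ℝ → ℝ := fun t => M * (C + 2) * ((1 + ‖u₀‖ ^ 6 + ‖u₁‖ ^ 2) * Real.exp (-β * t) + 1 +
    ‖g‖ ^ 2) with hb
  set D : ℕ → ℝ → ℝ := fun n τ => γ * ⟪specMul ι (s n) Real.sqrt (v n τ), v n τ⟫_ℝ +
    α / 4 * ‖v n τ‖ ^ 2 with hD
  have hD0 : ∀ n τ, 0 ≤ D n τ := fun n τ => by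
    have := inner_specMul_nonneg (ι := ι) (hs n) (fun l _ => Real.sqrt_nonneg l) (v n τ)
    simp only [hD]
    positivity
  have hmain : ∀ n t, 0 ≤ t → ‖W n t‖ ^ 2 + ‖v n t‖ ^ 2 + (∫ τ in t..t + 1, D n τ) ≤ b t := by
    intro n t ht
    refine (hest (s n) (G n) (Φ n) g (u n) (v n) (hs n) (happ.dissipative n) (hsol n) t ht).trans ?_
    simp only [hb]
    rw [mul_assoc]
    refine mul_le_mul_of_nonneg_left ?_ hM.le
    have h1 : ‖u₀‖ ^ 2 ≤ 1 + ‖u₀‖ ^ 6 := by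
      nlinarith [sq_nonneg (‖u₀‖ ^ 2 - 1), sq_nonneg ‖u₀‖, sq_nonneg (‖u₀‖ ^ 3)]
    have h2 : |Φ n (u n 0)| + ‖W n 0‖ ^ 2 + ‖v n 0‖ ^ 2 ≤
        (C + 2) * (1 + ‖u₀‖ ^ 6 + ‖u₁‖ ^ 2) := by
      have h3 : ‖W n 0‖ ^ 2 ≤ ‖u₀‖ ^ 2 := by gcongr; exact hW0 n
      have h4 : ‖v n 0‖ ^ 2 ≤ ‖u₁‖ ^ 2 := by gcongr; exact hv0' n
      have h5 : 0 ≤ C * ‖u₁‖ ^ 2 := by positivity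
      have h6 : 0 ≤ ‖u₀‖ ^ 6 := by positivity
      have h7 : 0 ≤ ‖u₁‖ ^ 2 := by positivity
      linarith [hΦ0 n]
    have h8 := mul_le_mul_of_nonneg_right h2 (Real.exp_pos (-β * t)).le
    have h9 : 0 ≤ (C + 1) * (1 + ‖g‖ ^ 2) := by positivity
    linarith
  have hb0 : ∀ t, 0 ≤ t → b t ≤ b 0 := fun t ht => by
    have h1 : Real.exp (-β * t) ≤ Real.exp (-β * 0) := Real.exp_le_exp.2 (by nlinarith)
    simp only [hb]
    gcongr ?_ * (?_ * ?_ + _ + _)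
  have hint0 : ∀ n t, 0 ≤ ∫ τ in t..t + 1, D n τ := fun n t =>
    intervalIntegral.integral_nonneg (by linarith) fun τ _ => hD0 n τ
  set R : ℝ := √(b 0) with hR
  have hWR : ∀ n t, 0 ≤ t → ‖W n t‖ ≤ R := fun n t ht => by
    refine Real.le_sqrt_of_sq_le ?_
    linarith [hmain n t ht, hb0 t ht, hint0 n t, sq_nonneg ‖v n t‖]
  have hvR : ∀ n t, 0 ≤ t → ‖v n t‖ ≤ R := fun n t ht => by
    refine Real.le_sqrt_of_sq_le ?_
    linarith [hmain n t ht, hb0 t ht, hint0 n t, sq_nonneg ‖W n t‖]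
  have hR0 : 0 ≤ R := Real.sqrt_nonneg _
  obtain ⟨E, hE⟩ := happ.bounded (max R 1)
  -- The constant bounds v' in the dual of `V`, one summand for each term of the equation; R + R
  -- comes from writing -Δ as (1 - Δ) - 1.
  obtain ⟨k, hk, U, w, hU, hιU, hw, hgw, hUc, hwc⟩ := exists_subseq_tendsto_path hι (U := W)
    (R := R) (C := ‖g‖ + E + γ * R + α * R + (R + R)) hWR hvR
    (fun n t ht => (hsol n).hasDerivAt_map hι ht) (fun n t ht => (hsol n).deriv_snd t ht)
    (fun n t ht z hz => by
      rw [(hsol n).inner_deriv_snd hι]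
      have hιz : ‖ι z‖ ≤ 1 := (hι.norm_le z).trans hz
      have hv1 : ∀ h : H, ‖h‖ ≤ 1 → |⟪v n t, h⟫_ℝ| ≤ R := fun h hh =>
        (abs_real_inner_le_norm _ _).trans
          ((mul_le_mul (hvR n t ht) hh (norm_nonneg _) hR0).trans (mul_one R).le)
      have b1 : |⟪g, specMul ι (s n) 1 (ι z)⟫_ℝ| ≤ ‖g‖ :=
        (abs_real_inner_le_norm _ _).trans (mul_le_of_le_one_right (norm_nonneg _)
          ((norm_specMul_one_le _).trans hιz))
      have b2 : |⟪G n (u n t), ι (specLiftSum ι (s n) (ι z))⟫_ℝ| ≤ E := by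
        rw [← (hsol n).map_specLiftSum hι t]
        exact hE n _ _ ((hWR n t ht).trans (le_max_left _ _))
          ((hι.norm_specLiftSum_le z).trans (hz.trans (le_max_right _ _)))
      have b3 := hv1 _ ((hι.norm_specMul_sqrt_le (hs n) z).trans hz)
      have b4 := hv1 _ hιz
      have b5 : |⟪specLiftSum ι (s n) (u n t), z⟫_ℝ| ≤ R := (abs_real_inner_le_norm _ _).trans
          ((mul_le_mul (hWR n t ht) hz (norm_nonneg _) hR0).trans (mul_one R).le)
      have b6 : |⟪u n t, ι z⟫_ℝ| ≤ R := by
        refine (abs_real_inner_le_norm _ _).trans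
          ((mul_le_mul ?_ hιz (norm_nonneg _) hR0).trans (mul_one R).le)
        rw [← (hsol n).map_specLiftSum hι t]
        exact (hι.norm_le _).trans (hWR n t ht)
      rw [abs_le] at b1 b2 b3 b4 b5 b6 ⊢
      constructor <;> nlinarith)
  refine ⟨U, w, isLimitSolution_of_tendsto hι happ (s := fun n => s (k n)) (fun n => hs (k n))
    (fun F a hF ha => (hsum F a hF ha).comp hk.tendsto_atTop) hk.tendsto_atTop
    (fun n => hsol (k n)) (fun n => hu0 (k n)) (fun n => hv0 (k n)) (fun n => hWR (k n))
    (fun n => hvR (k n)) hU hιU hw hUc hwc, fun t ht => ?_⟩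
  have l1 := norm_sq_le_liminf_of_weak (hU t ht)
  have l2 := norm_sq_le_liminf_of_weak (hw t ht)
  -- Fatou's lemma in time, applied after lower semicontinuity of the spectral norm at each fixed
  -- time.
  have l3 : ∫⁻ τ in Ioc t (t + 1), specNormSq ι (1 / 2) (w τ) ≤
      liminf (fun n => ∫⁻ τ in Ioc t (t + 1), specNormSq ι (1 / 2) (v (k n) τ)) atTop := by
    refine le_trans (setLIntegral_mono' measurableSet_Ioc fun τ hτ => ?_)
      (lintegral_liminf_le' fun n => ((hsol (k n)).lintegral_specNormSq_le (hs _) hγ hα hc2 hc3 hc0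
        ht).1)
    exact specNormSq_le_liminf (greenOp_tendsto_specProj hι (hgw τ (ht.trans hτ.1.le))) _
  refine (add_le_add (add_le_add l1 l2) l3).trans ?_
  -- The estimate is available only for the sum of the three terms, so the lower limits are merged
  -- by superadditivity before it is applied.
  refine (add_le_add_left (ennreal_liminf_add_le _ _) _).trans ?_
  refine (ennreal_liminf_add_le _ _).trans ?_
  refine (liminf_le_liminf (v := fun _ => ENNReal.ofReal (c * b t))
    (Eventually.of_forall fun n => ?_)).trans ?_
  · refine (add_le_add le_rfl ((hsol (k n)).lintegral_specNormSq_le (hs _) hγ hα hc2 hc3 hc0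
      ht).2).trans ?_
    rw [← ENNReal.ofReal_add (by positivity) (by positivity),
      ← ENNReal.ofReal_add (by positivity) (mul_nonneg hc0 (hint0 (k n) t))]
    refine ENNReal.ofReal_le_ofReal ?_
    have h1 := mul_le_mul_of_nonneg_left (hmain (k n) t ht) hc0
    have h2 : 0 ≤ (c - 1) * (‖W (k n) t‖ ^ 2 + ‖v (k n) t‖ ^ 2) :=
      mul_nonneg (by linarith) (by positivity)
    linarith
  · rw [liminf_const, hb, mul_assoc c]

end LimitSolution

/-! ### Lipschitz truncation of the nonlinearity -/

/-- `p n` are globally Lipschitz approximations of the nonlinearity `f`, with potentials `F n`,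
satisfying the structural conditions uniformly in `n`. -/
structure IsTruncation (f : ℝ → ℝ) (p F : ℕ → ℝ → ℝ) (ε κ C : ℝ) : Prop where
  continuous : Continuous f
  lipschitz : ∀ n, ∃ L, LipschitzWith L (p n)
  hasDerivAt : ∀ n s, HasDerivAt (F n) (p n s) s
  le_mul : ∀ n s, ε * F n s + κ * s ^ 2 - C ≤ p n s * s
  le_potential : ∀ n s, κ * s ^ 2 - C ≤ F n s
  abs_le : ∀ n s, |p n s| ≤ C * (1 + |s| ^ 5)
  abs_potential_le : ∀ n s, |F n s| ≤ C * (1 + |s| ^ 6)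
  tendsto : ∀ (k : ℕ → ℕ) (x : ℕ → ℝ) (s : ℝ), Tendsto k atTop atTop → Tendsto x atTop (𝓝 s) →
    Tendsto (fun n => p (k n) (x n)) atTop (𝓝 (f s))

/-- If `F' = p` and `p s + K s` is monotone, then `F s ≤ F 0 + p s * s + K s² / 2`. -/
theorem le_mul_add_of_monotone {p F : ℝ → ℝ} {K : ℝ} (hF : ∀ s, HasDerivAt F (p s) s)
    (hp : Monotone fun s => p s + K * s) (s : ℝ) : F s ≤ F 0 + p s * s + K / 2 * s ^ 2 := by
  -- F + K s² / 2 is convex, and the claim says that its tangent at s lies below its value at 0.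
  have hconv : ConvexOn ℝ univ fun s => F s + K / 2 * s ^ 2 := by
    have hd : ∀ s, HasDerivAt (fun s => F s + K / 2 * s ^ 2) (p s + K * s) s := fun s => by
      exact HasDerivAt.congr_deriv ((hF s).add (((hasDerivAt_id' s).pow 2).const_mul (K / 2))) (by ring)
    refine Monotone.convexOn_univ_of_deriv (fun s => (hd s).differentiableAt) ?_
    rwa [show deriv (fun s => F s + K / 2 * s ^ 2) = fun s => p s + K * s from
      funext fun s => (hd s).deriv]
  have hd : HasDerivAt (fun s => F s + K / 2 * s ^ 2) (p s + K * s) s := by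
    exact HasDerivAt.congr_deriv ((hF s).add (((hasDerivAt_id' s).pow 2).const_mul (K / 2))) (by ring)
  rcases lt_trichotomy s 0 with h | h | h
  · have := hconv.le_slope_of_hasDerivAt (mem_univ s) (mem_univ 0) h hd
    rw [slope_def_field, le_div_iff₀ (by linarith)] at this
    nlinarith
  · simp [h]
  · have := hconv.slope_le_of_hasDerivAt (mem_univ 0) (mem_univ s) h hd
    rw [slope_def_field, div_le_iff₀ (by linarith)] at this
    nlinarith

/-- A lower bound of linear growth for `p` integrates to a quadratic one for its primitive. -/
theorem quadratic_le_of_linear_le {p F : ℝ → ℝ} {m A : ℝ} (hF : ∀ s, HasDerivAt F (p s) s)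
    (hF0 : F 0 = 0) (hpos : ∀ s, 0 ≤ s → m * s - A ≤ p s) (hneg : ∀ s, s ≤ 0 → p s ≤ m * s + A)
    (s : ℝ) : m / 2 * s ^ 2 - A * |s| ≤ F s := by
  rcases le_total 0 s with h | h
  · have hd : ∀ t, HasDerivAt (fun t => F t - (m / 2 * t ^ 2 - A * t)) (p t - (m * t - A)) t :=
      fun t => by
      exact HasDerivAt.congr_deriv ((hF t).sub ((((hasDerivAt_id' t).pow 2).const_mul (m / 2)).sub
        ((hasDerivAt_id' t).const_mul A))) (by ring)
    have hmono : MonotoneOn (fun t => F t - (m / 2 * t ^ 2 - A * t)) (Ici 0) :=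
      monotoneOn_of_deriv_nonneg (convex_Ici 0)
        (fun t _ => (hd t).continuousAt.continuousWithinAt)
        (fun t _ => (hd t).differentiableAt.differentiableWithinAt) (fun t ht => by
          rw [(hd t).deriv]
          rw [interior_Ici] at ht
          linarith [hpos t (le_of_lt ht)])
    have := hmono (mem_Ici.2 le_rfl) (mem_Ici.2 h) h
    simp only [hF0] at this
    rw [abs_of_nonneg h]
    linarith
  · have hd : ∀ t, HasDerivAt (fun t => F t - (m / 2 * t ^ 2 + A * t)) (p t - (m * t + A)) t :=
      fun t => by
      exact HasDerivAt.congr_deriv ((hF t).sub ((((hasDerivAt_id' t).pow 2).const_mul (m / 2)).add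
        ((hasDerivAt_id' t).const_mul A))) (by ring)
    have hmono : AntitoneOn (fun t => F t - (m / 2 * t ^ 2 + A * t)) (Iic 0) :=
      antitoneOn_of_deriv_nonpos (convex_Iic 0)
        (fun t _ => (hd t).continuousAt.continuousWithinAt)
        (fun t _ => (hd t).differentiableAt.differentiableWithinAt) (fun t ht => by
          rw [(hd t).deriv]
          rw [interior_Iic] at ht
          linarith [hneg t (le_of_lt ht)])
    have := hmono (mem_Iic.2 h) (mem_Iic.2 le_rfl) h
    simp only [hF0] at this
    rw [abs_of_nonpos h]
    linarith

/-- The projection of the real line onto `[-a, a]`. -/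
def clampReal (a s : ℝ) : ℝ := max (-a) (min a s)

theorem abs_clampReal_le {a : ℝ} (ha : 0 ≤ a) (s : ℝ) : |clampReal a s| ≤ a :=
  abs_le.2 ⟨le_max_left _ _, max_le (by linarith) (min_le_left _ _)⟩

theorem clampReal_of_abs_le {a s : ℝ} (h : |s| ≤ a) : clampReal a s = s := by
  rw [abs_le] at h
  rw [clampReal, min_eq_right h.2, max_eq_right h.1]

theorem clampReal_of_le {a s : ℝ} (ha : 0 ≤ a) (h : a ≤ s) : clampReal a s = a := by
  rw [clampReal, min_eq_left h, max_eq_right (by linarith)]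

theorem clampReal_of_le_neg {a s : ℝ} (ha : 0 ≤ a) (h : s ≤ -a) : clampReal a s = -a := by
  rw [clampReal, min_eq_right (by linarith), max_eq_left h]

theorem lipschitzWith_clampReal (a : ℝ) : LipschitzWith 1 (clampReal a) :=
  (LipschitzWith.id.const_min a).const_max (-a)

theorem monotone_clampReal (a : ℝ) : Monotone (clampReal a) := fun s t h => by
  unfold clampReal; gcongr

theorem monotone_sub_clampReal (a : ℝ) : Monotone fun s => s - clampReal a s := fun s t h => by
  have h1 := (lipschitzWith_clampReal a).dist_le_mul t s
  simp only [Real.dist_eq, NNReal.coe_one, one_mul, abs_of_nonneg (sub_nonneg.2 h),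
    abs_of_nonneg (sub_nonneg.2 (monotone_clampReal a h))] at h1
  simp only
  linarith

theorem abs_clampReal_le_abs {a : ℝ} (ha : 0 ≤ a) (s : ℝ) : |clampReal a s| ≤ |s| := by
  have h1 := (lipschitzWith_clampReal a).dist_le_mul s 0
  have h0 : clampReal a 0 = 0 := clampReal_of_abs_le (by simpa using ha)
  simpa [Real.dist_eq, h0] using h1

/-- The argument of f is clipped to [-a n, a n] and the function is continued linearly with slope κ
/ 2. This keeps the one-sided conditions uniform: p s + K s is a sum of monotone functions of the
clipped argument and of the remainder, and f(±a n) already points outward with size at least κ a n /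
2, so dissipativity persists outside. -/
theorem IsQuinticDissipative.exists_truncation {f : ℝ → ℝ} (hf : IsQuinticDissipative f) :
    ∃ (p F : ℕ → ℝ → ℝ) (ε κ C : ℝ), 0 < ε ∧ 0 < κ ∧ 0 ≤ C ∧ IsTruncation f p F ε κ C := by
  obtain ⟨C, κ, K, hC, hκ, hK, h1, h2, h3⟩ := hf.bounds
  have hdiff : Differentiable ℝ f := hf.contDiff.differentiable one_ne_zero
  have hcont : Continuous f := hdiff.continuous
  -- For a ≥ 1, the condition κ a ≥ 2 C gives κ a² - C ≥ κ a² / 2, which makes f dissipative without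
  -- an additive constant at the clipping points.
  obtain ⟨N, hN⟩ : ∃ N : ℕ, 2 * C ≤ κ * N := by
    obtain ⟨N, hN⟩ := exists_nat_gt (2 * C / κ)
    exact ⟨N, by rw [div_lt_iff₀ hκ] at hN; linarith⟩
  set a : ℕ → ℝ := fun n => n + N + 1 with ha
  have ha1 : ∀ n, 1 ≤ a n := fun n => by simp only [ha]; have := n.cast_nonneg (α := ℝ)
                                         have := N.cast_nonneg (α := ℝ); linarith
  have ha0 : ∀ n, 0 ≤ a n := fun n => zero_le_one.trans (ha1 n)
  have haN : ∀ n, 2 * C ≤ κ * a n := fun n => hN.trans <| by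
    have := n.cast_nonneg (α := ℝ)
    simp only [ha]; gcongr; linarith
  have han : ∀ n : ℕ, (n : ℝ) ≤ a n := fun n => by
    have := N.cast_nonneg (α := ℝ); simp only [ha]; linarith
  set p : ℕ → ℝ → ℝ := fun n s => f (clampReal (a n) s) + κ / 2 * (s - clampReal (a n) s) with hp
  have hpc : ∀ n, Continuous (p n) := fun n => by
    have := (lipschitzWith_clampReal (a n)).continuous
    simp only [hp]; fun_prop
  set F : ℕ → ℝ → ℝ := fun n s => ∫ t in (0 : ℝ)..s, p n t with hF
  have hFd : ∀ n s, HasDerivAt (F n) (p n s) s := fun n s =>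
    intervalIntegral.integral_hasDerivAt_right ((hpc n).intervalIntegrable _ _)
      ((hpc n).stronglyMeasurableAtFilter _ _) (hpc n).continuousAt
  have hF0 : ∀ n, F n 0 = 0 := fun n => by simp [hF]
  -- monotonicity
  have hfm : Monotone fun s => f s + K * s := by
    refine monotone_of_deriv_nonneg (by fun_prop) fun s => ?_
    have : HasDerivAt (fun s => f s + K * s) (deriv f s + K * 1) s :=
      (hdiff s).hasDerivAt.add ((hasDerivAt_id s).const_mul K)
    rw [this.deriv]; linarith [h2 s]
  have hpm : ∀ n, Monotone fun s => p n s + K * s := fun n s t hst => by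
    have e1 := hfm (monotone_clampReal (a n) hst)
    have e2 := mul_le_mul_of_nonneg_left (monotone_sub_clampReal (a n) hst)
      (by positivity : 0 ≤ κ / 2 + K)
    simp only [hp] at e1 e2 ⊢
    linarith
  -- dissipativity
  have hpd : ∀ n s, κ / 2 * s ^ 2 - C ≤ p n s * s := fun n s => by
    simp only [hp]
    rcases le_total |s| (a n) with h | h
    · rw [clampReal_of_abs_le h]
      have := h1 s
      rw [sq_abs] at this
      nlinarith [sq_nonneg s]
    · have hfa : ∀ r, |r| = a n → κ / 2 * (a n) ^ 2 ≤ f r * r := fun r hr => by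
        have := h1 r
        rw [hr] at this
        nlinarith [haN n, ha1 n]
      rcases le_total 0 s with hs | hs
      · rw [abs_of_nonneg hs] at h
        rw [clampReal_of_le (ha0 n) h]
        have := hfa (a n) (abs_of_nonneg (ha0 n))
        have h4 : κ / 2 * a n ≤ f (a n) := le_of_mul_le_mul_right (by linarith)
          (zero_lt_one.trans_le (ha1 n))
        nlinarith
      · rw [abs_of_nonpos hs] at h
        rw [clampReal_of_le_neg (ha0 n) (by linarith)]
        have := hfa (-a n) (by rw [abs_neg, abs_of_nonneg (ha0 n)])
        have h4 : κ / 2 * a n ≤ -f (-a n) := le_of_mul_le_mul_right (by linarith)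
          (zero_lt_one.trans_le (ha1 n))
        nlinarith
  have hp0 : ∀ n, p n 0 = f 0 := fun n => by
    simp only [hp]; rw [clampReal_of_abs_le (by simpa using ha0 n)]; simp
  -- Dissipativity may be divided by s only for |s| ≥ 1; closer to 0 the one-sided Lipschitz bound
  -- starting from f 0 is used. A covers both cases.
  set A : ℝ := C + |f 0| + K + κ / 2 with hA
  have hA0 : 0 ≤ A := by positivity
  have hpos : ∀ n s, 0 ≤ s → κ / 2 * s - A ≤ p n s := fun n s hs => by
    rcases le_total s 1 with h | h
    · have := hpm n hs
      simp only [hp0] at this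
      nlinarith [neg_abs_le (f 0)]
    · refine le_of_mul_le_mul_right ?_ (zero_lt_one.trans_le h)
      have h5 : C ≤ A := by linarith [abs_nonneg (f 0)]
      nlinarith [hpd n s]
  have hneg : ∀ n s, s ≤ 0 → p n s ≤ κ / 2 * s + A := fun n s hs => by
    rcases le_total (-1) s with h | h
    · have := hpm n hs
      simp only [hp0] at this
      nlinarith [le_abs_self (f 0)]
    · have h6 : 0 < -s := by linarith
      refine le_of_mul_le_mul_right ?_ h6
      have h5 : C ≤ A := by linarith [abs_nonneg (f 0)]
      nlinarith [hpd n s]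
  have hFlow : ∀ n s, κ / 8 * s ^ 2 - 2 * A ^ 2 / κ ≤ F n s := fun n s => by
    have := quadratic_le_of_linear_le (hFd n) (hF0 n) (hpos n) (hneg n) s
    have h4 : A * |s| ≤ κ / 8 * s ^ 2 + 2 * A ^ 2 / κ := by
      rw [← sub_nonneg]
      have : κ / 8 * s ^ 2 + 2 * A ^ 2 / κ - A * |s| = (κ * |s| - 4 * A) ^ 2 / (8 * κ) := by
        rw [← sq_abs s]; field_simp; ring
      rw [this]; positivity
    linarith
  have hFup : ∀ n s, F n s ≤ p n s * s + K / 2 * s ^ 2 := fun n s => by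
    have := le_mul_add_of_monotone (hFd n) (hpm n) s
    rwa [hF0, zero_add] at this
  -- growth
  have hfg : ∀ s, |f s| ≤ |f 0| + C * (1 + |s| ^ 4) * |s| := fun s => by
    have := (convex_Icc (-|s|) |s|).norm_image_sub_le_of_norm_deriv_le (f := f)
      (C := C * (1 + |s| ^ 4)) (x := 0) (y := s) (fun x _ => hdiff x) (fun x hx => by
        refine (h3 x).trans ?_
        have : |x| ≤ |s| := abs_le.2 hx
        gcongr) (by simp) ⟨neg_abs_le s, le_abs_self s⟩
    simp only [Real.norm_eq_abs, sub_zero] at this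
    have h4 := abs_sub_abs_le_abs_sub (f s) (f 0)
    linarith
  set D : ℝ := |f 0| + 2 * C + κ with hD
  have hD0 : 0 ≤ D := by positivity
  have hpg : ∀ n s, |p n s| ≤ D * (1 + |s| ^ 5) := fun n s => by
    have hc := abs_clampReal_le_abs (ha0 n) s
    have e0 : |p n s| ≤ |f (clampReal (a n) s)| + κ / 2 * (|s| + |clampReal (a n) s|) := by
      simp only [hp]
      refine (abs_add_le _ _).trans ?_
      rw [abs_mul, abs_of_nonneg (by positivity : 0 ≤ κ / 2)]
      gcongr
      exact abs_sub _ _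
    have e1 : |f (clampReal (a n) s)| ≤ |f 0| + C * (1 + |s| ^ 4) * |s| :=
      (hfg _).trans (by gcongr)
    have e2 : |s| ≤ 1 + |s| ^ 5 := by
      rcases le_total |s| 1 with h | h
      · linarith [pow_nonneg (abs_nonneg s) 5]
      · linarith [le_self_pow₀ h (by norm_num : 5 ≠ 0)]
    have e3 : 0 ≤ |f 0| * |s| ^ 5 := by positivity
    have e4 : C * |s| ≤ C * (1 + |s| ^ 5) := by gcongr
    have e5 : κ * |s| ≤ κ * (1 + |s| ^ 5) := by gcongr
    have e6 : κ / 2 * (|s| + |clampReal (a n) s|) ≤ κ * |s| := by nlinarith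
    have e7 : C * (1 + |s| ^ 4) * |s| = C * |s| + C * |s| ^ 5 := by ring
    simp only [hD]
    linarith
  have hFg : ∀ n s, |F n s| ≤ 2 * D * (1 + |s| ^ 6) := fun n s => by
    have := intervalIntegral.norm_integral_le_of_norm_le_const (a := 0) (b := s) (f := p n)
      (C := D * (1 + |s| ^ 5)) (fun x hx => by
        refine (hpg n x).trans ?_
        have : |x| ≤ |s| := by
          rcases le_total 0 s with h | h
          · rw [uIoc_of_le h] at hx; rw [abs_of_nonneg h, abs_of_pos hx.1]; exact hx.2
          · rw [uIoc_of_ge h] at hx; rw [abs_of_nonpos h, abs_of_nonpos hx.2]; linarith [hx.1]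
        gcongr)
    rw [Real.norm_eq_abs, sub_zero] at this
    refine this.trans ?_
    have e2 : |s| ≤ 1 + |s| ^ 6 := by
      rcases le_total |s| 1 with h | h
      · linarith [pow_nonneg (abs_nonneg s) 6]
      · linarith [le_self_pow₀ h (by norm_num : 6 ≠ 0)]
    have e4 : D * |s| ≤ D * (1 + |s| ^ 6) := by gcongr
    nlinarith
  -- As F ≤ p s * s + K s² / 2, spending the fraction ε of p s * s yields ε F at the cost ε K s² / 2
  -- ≤ κ s² / 8. The remaining fraction gives at least κ s² / 4 up to a constant, whence the final κ
  -- / 8.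
  obtain ⟨ε, hε, hε1, hε2⟩ : ∃ ε : ℝ, 0 < ε ∧ ε ≤ 1 / 2 ∧ ε * K ≤ κ / 4 := by
    refine ⟨min (1 / 2) (κ / 4 / K), by positivity, min_le_left _ _, ?_⟩
    calc _ ≤ κ / 4 / K * K := by gcongr; exact min_le_right _ _
      _ = κ / 4 := by field_simp
  refine ⟨p, F, ε, κ / 8, C + 2 * A ^ 2 / κ + 2 * D, hε, by positivity, by positivity,
    ⟨hcont, fun n => ?_, hFd, fun n s => ?_, fun n s => ?_, fun n s => ?_, fun n s => ?_, ?_⟩⟩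
  · obtain ⟨L, hL⟩ := (hf.contDiff.contDiffOn (s := Icc (-(a n)) (a n))).exists_lipschitzOnWith
      one_ne_zero (convex_Icc _ _) isCompact_Icc
    have hc := lipschitzWith_clampReal (a n)
    have h4 : LipschitzWith L (fun s => f (clampReal (a n) s)) := by
      have := hL.comp (hc.lipschitzOnWith (s := univ))
        (fun s _ => abs_le.1 (abs_clampReal_le (ha0 n) s))
      simpa [lipschitzOnWith_univ, Function.comp_def] using this
    have h5 := (lipschitzWith_smul (κ / 2)).comp (LipschitzWith.id.sub hc)
    exact ⟨_, h4.add h5⟩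
  · have e1 := hFup n s
    have e2 := hpd n s
    have e3 := mul_le_mul_of_nonneg_left e1 hε.le
    have e4 := mul_le_mul_of_nonneg_left e2 (by linarith : 0 ≤ 1 - ε)
    have e5 := mul_le_mul_of_nonneg_right hε2 (sq_nonneg s)
    have e6 : 0 ≤ 2 * A ^ 2 / κ := by positivity
    have e7 : κ / 2 * s ^ 2 * ε ≤ κ / 2 * s ^ 2 * (1 / 2) := by gcongr
    have e8 : 0 ≤ ε * C := by positivity
    nlinarith
  · have e6 : 0 ≤ 2 * A ^ 2 / κ := by positivity
    linarith [hFlow n s]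
  · refine (hpg n s).trans ?_
    have e6 : 0 ≤ 2 * A ^ 2 / κ := by positivity
    gcongr; linarith
  · refine (hFg n s).trans ?_
    have e6 : 0 ≤ 2 * A ^ 2 / κ := by positivity
    gcongr; linarith
  · intro k x s hk hx
    refine Tendsto.congr' ?_ ((hcont.tendsto s).comp hx)
    -- Since a n ≥ n, the clipping is eventually inactive near s.
    obtain ⟨m, hm⟩ := exists_nat_gt (|s| + 1)
    filter_upwards [hk.eventually_ge_atTop m, hx.abs.eventually_lt_const (lt_add_one |s|)] with n
      hn hxn
    have : |x n| ≤ a (k n) := by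
      have : (m : ℝ) ≤ k n := by exact_mod_cast hn
      linarith [han (k n)]
    simp [hp, clampReal_of_abs_le this]

/-! ### Convergence of integrals with critical growth -/

/-- Young's inequality for the exponents 6/5 and 6 with a free weight, proved by comparing c with η
a. It pairs quintic growth with L⁶ while putting an arbitrarily small weight on the state. -/
theorem pow_five_mul_le {a c η : ℝ} (ha : 0 ≤ a) (hc : 0 ≤ c) (hη : 0 < η) :
    a ^ 5 * c ≤ η * a ^ 6 + η⁻¹ ^ 5 * c ^ 6 := by
  rcases le_total c (η * a) with h | h
  · have h1 : a ^ 5 * c ≤ a ^ 5 * (η * a) := by gcongr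
    have h2 : 0 ≤ η⁻¹ ^ 5 * c ^ 6 := by positivity
    linarith
  · have h3 : a ≤ η⁻¹ * c := by
      rw [← div_eq_inv_mul, le_div_iff₀ hη]; linarith
    have h1 : a ^ 5 * c ≤ (η⁻¹ * c) ^ 5 * c := by gcongr
    have h2 : 0 ≤ η * a ^ 6 := by positivity
    linarith

/-- A form of Vitali's theorem: dominated convergence up to an error with small integral. -/
theorem tendsto_integral_of_dominated_up_to {X : Type*} [MeasurableSpace X] {μ : Measure X}
    {h : ℕ → X → ℝ} {h' : X → ℝ} (hint : ∀ n, Integrable (h n) μ) (hint' : Integrable h' μ)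
    (hlim : ∀ᵐ x ∂μ, Tendsto (fun n => h n x) atTop (𝓝 (h' x)))
    (hdom : ∀ η > 0, ∃ (A : ℕ → X → ℝ) (D : X → ℝ), Integrable D μ ∧ (∀ n, Integrable (A n) μ) ∧
      (∀ n x, 0 ≤ A n x) ∧ (∀ᶠ n in atTop, ∫ x, A n x ∂μ ≤ η) ∧
      ∀ n, ∀ᵐ x ∂μ, |h n x - h' x| ≤ A n x + D x) :
    Tendsto (fun n => ∫ x, h n x ∂μ) atTop (𝓝 (∫ x, h' x ∂μ)) := by
  rw [Metric.tendsto_nhds]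
  intro η hη
  obtain ⟨A, D, hD, hA, hA0, hAη, hle⟩ := hdom (η / 2) (by positivity)
  have hsub : ∀ n, Integrable (fun x => |h n x - h' x|) μ := fun n => ((hint n).sub hint').abs
  have hgint : ∀ n, Integrable (fun x => max (|h n x - h' x| - A n x) 0) μ := fun n =>
    ((hsub n).sub (hA n)).pos_part
  -- The excess of |h n - h'| over A n is dominated by D and tends to 0 almost everywhere; the part
  -- cut off eventually has integral at most η / 2.
  have hg : Tendsto (fun n => ∫ x, max (|h n x - h' x| - A n x) 0 ∂μ) atTop (𝓝 (∫ _, 0 ∂μ)) := by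
    refine tendsto_integral_of_dominated_convergence (fun x => |D x|)
      (fun n => (hgint n).aestronglyMeasurable) hD.abs (fun n => ?_) ?_
    · filter_upwards [hle n] with x hx
      rw [Real.norm_eq_abs, abs_of_nonneg (le_max_right _ _)]
      exact max_le (by linarith [le_abs_self (D x)]) (abs_nonneg _)
    · filter_upwards [hlim] with x hx
      have h1 : Tendsto (fun n => |h n x - h' x|) atTop (𝓝 0) := by
        simpa using (hx.sub_const (h' x)).abs
      exact squeeze_zero (fun n => le_max_right _ _)
        (fun n => max_le (by linarith [hA0 n x]) (abs_nonneg _)) h1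
  rw [integral_zero] at hg
  filter_upwards [hAη, hg.eventually_lt_const (by positivity : 0 < η / 2)] with n h1 h2
  rw [Real.dist_eq, ← integral_sub (hint n) hint']
  refine (abs_integral_le_integral_abs).trans_lt ?_
  have h3 : ∫ x, |h n x - h' x| ∂μ ≤
      ∫ x, (max (|h n x - h' x| - A n x) 0 + A n x) ∂μ :=
    integral_mono (hsub n) ((hgint n).add (hA n)) fun x => by
      have := le_max_left (|h n x - h' x| - A n x) 0
      simp only
      linarith
  rw [integral_add (hgint n) (hA n)] at h3
  linarith

/-- A primitive of a Lipschitz function agrees to second order with its linearisation. -/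
theorem abs_sub_linear_le_of_lipschitz {p F : ℝ → ℝ} {L : NNReal} (hp : LipschitzWith L p)
    (hF : ∀ s, HasDerivAt F (p s) s) (a b : ℝ) :
    |F b - F a - p a * (b - a)| ≤ L * (b - a) ^ 2 := by
  have hd : ∀ s, HasDerivAt (fun s => F s - p a * s) (p s - p a) s := fun s =>
    HasDerivAt.congr_deriv ((hF s).sub ((hasDerivAt_id' s).const_mul (p a))) (by ring)
  have := (convex_uIcc a b).norm_image_sub_le_of_norm_hasDerivWithin_le
    (f := fun s => F s - p a * s) (C := L * |b - a|)
    (fun s _ => (hd s).hasDerivWithinAt) (fun s hs => by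
      have h1 := hp.dist_le_mul s a
      rw [Real.dist_eq, Real.dist_eq] at h1
      refine h1.trans ?_
      exact mul_le_mul_of_nonneg_left (abs_sub_left_of_mem_uIcc hs) L.2) left_mem_uIcc right_mem_uIcc
  rw [Real.norm_eq_abs, Real.norm_eq_abs, mul_assoc, ← sq, sq_abs] at this
  convert this using 2
  ring

/-! ### Superposition operators on L² and their approximation property -/

section Superposition

variable {X : Type} [MeasurableSpace X] {μ : Measure X}

theorem L2_inner_eq_integral (u v : Lp ℝ 2 μ) : ⟪u, v⟫_ℝ = ∫ x, u x * v x ∂μ := by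
  rw [L2.inner_def]
  exact integral_congr_ae (Eventually.of_forall fun x => by simp [mul_comm])

theorem L2_norm_sq_eq_integral (u : Lp ℝ 2 μ) : ‖u‖ ^ 2 = ∫ x, u x ^ 2 ∂μ := by
  rw [← real_inner_self_eq_norm_sq, L2_inner_eq_integral]
  simp only [sq]

theorem L2_integrable_mul (u v : Lp ℝ 2 μ) : Integrable (fun x => u x * v x) μ :=
  (Lp.memLp v).integrable_mul (Lp.memLp u) |>.congr (Eventually.of_forall fun x => by
    simp [mul_comm])

theorem L2_integrable_sq (u : Lp ℝ 2 μ) : Integrable (fun x => u x ^ 2) μ := by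
  simpa only [sq] using L2_integrable_mul u u

open Classical in
/-- The superposition operator `u ↦ p ∘ u` on `L²`. -/
def superposition (μ : Measure X) (p : ℝ → ℝ) (u : Lp ℝ 2 μ) : Lp ℝ 2 μ :=
  if h : MemLp (fun x => p (u x)) 2 μ then h.toLp else 0

variable [IsFiniteMeasure μ] {p F : ℝ → ℝ} {L : NNReal}

theorem memLp_comp_of_lipschitz (hp : LipschitzWith L p) (u : Lp ℝ 2 μ) :
    MemLp (fun x => p (u x)) 2 μ := by
  have h1 : LipschitzWith L fun s => p s - p 0 := LipschitzWith.of_dist_le_mul fun s t => by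
    simpa [Real.dist_eq] using hp.dist_le_mul s t
  have h2 := (h1.comp_memLp (by simp) (Lp.memLp u)).add (memLp_const (p 0))
  refine h2.ae_eq (Eventually.of_forall fun x => ?_)
  simp

theorem coeFn_superposition (hp : LipschitzWith L p) (u : Lp ℝ 2 μ) :
    superposition μ p u =ᵐ[μ] fun x => p (u x) := by
  rw [superposition, dif_pos (memLp_comp_of_lipschitz hp u)]
  exact MemLp.coeFn_toLp _

theorem lipschitzWith_superposition (hp : LipschitzWith L p) :
    LipschitzWith L (superposition μ p) :=
  LipschitzWith.of_dist_le_mul fun u v => by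
    rw [dist_eq_norm, dist_eq_norm]
    refine Lp.norm_le_mul_norm_of_ae_le_mul ?_
    filter_upwards [coeFn_superposition hp u, coeFn_superposition hp v,
      Lp.coeFn_sub (superposition μ p u) (superposition μ p v), Lp.coeFn_sub u v] with x h1 h2 h3 h4
    rw [h3, h4, Pi.sub_apply, Pi.sub_apply, h1, h2, ← dist_eq_norm, ← dist_eq_norm]
    exact hp.dist_le_mul _ _

theorem inner_superposition (hp : LipschitzWith L p) (u v : Lp ℝ 2 μ) :
    Integrable (fun x => p (u x) * v x) μ ∧ ⟪superposition μ p u, v⟫_ℝ = ∫ x, p (u x) * v x ∂μ := by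
  have h : (fun x => superposition μ p u x * v x) =ᵐ[μ] fun x => p (u x) * v x := by
    filter_upwards [coeFn_superposition hp u] with x hx
    rw [hx]
  exact ⟨(L2_integrable_mul _ _).congr h, by rw [L2_inner_eq_integral, integral_congr_ae h]⟩

theorem integrable_primitive_comp (hp : LipschitzWith L p) (hF : ∀ s, HasDerivAt F (p s) s)
    (u : Lp ℝ 2 μ) : Integrable (fun x => F (u x)) μ := by
  have hu : Integrable u μ := (Lp.memLp u).integrable one_le_two
  have hFc : Continuous F := continuous_iff_continuousAt.2 fun s => (hF s).continuousAt
  have hb : Integrable (fun x => |F 0| + |p 0| * |u x| + L * u x ^ 2) μ :=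
    ((integrable_const _).add (hu.abs.const_mul _)).add ((L2_integrable_sq u).const_mul _)
  refine hb.mono' (hFc.comp_aestronglyMeasurable (Lp.aestronglyMeasurable u))
    (Eventually.of_forall fun x => ?_)
  have h1 := abs_sub_linear_le_of_lipschitz hp hF 0 (u x)
  rw [sub_zero] at h1
  rw [Real.norm_eq_abs, ← abs_mul]
  rw [abs_le] at h1 ⊢
  constructor <;> linarith [neg_abs_le (F 0), le_abs_self (F 0), neg_abs_le (p 0 * u x),
    le_abs_self (p 0 * u x)]

/-- The pointwise second-order remainder, at most L (v - u)², integrates to L ‖v - u‖². This is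
where the truncation matters: a potential of sextic growth need not even be integrable on L². -/
theorem hasFDerivAt_integral_primitive (hp : LipschitzWith L p) (hF : ∀ s, HasDerivAt F (p s) s)
    (u : Lp ℝ 2 μ) : HasFDerivAt (fun v : Lp ℝ 2 μ => ∫ x, F (v x) ∂μ)
      (innerSL ℝ (superposition μ p u)) u := by
  rw [hasFDerivAt_iff_isLittleO]
  have hbig : ∀ v : Lp ℝ 2 μ, |(∫ x, F (v x) ∂μ) - (∫ x, F (u x) ∂μ) -
      innerSL ℝ (superposition μ p u) (v - u)| ≤ L * ‖v - u‖ ^ 2 := fun v => by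
    have hv := integrable_primitive_comp hp hF v
    have hu := integrable_primitive_comp hp hF u
    obtain ⟨hi, he⟩ := inner_superposition hp u (v - u)
    have e1 : (∫ x, F (v x) ∂μ) - (∫ x, F (u x) ∂μ) - ∫ x, p (u x) * (v - u) x ∂μ =
        ∫ x, (F (v x) - F (u x) - p (u x) * (v - u) x) ∂μ := by
      rw [← integral_sub hv hu]
      exact (integral_sub (hv.sub hu) hi).symm
    rw [innerSL_apply_apply, he, e1, L2_norm_sq_eq_integral, ← integral_const_mul]
    refine (abs_integral_le_integral_abs).trans
      (integral_mono_ae ((hv.sub hu).sub hi).abs ((L2_integrable_sq _).const_mul _) ?_)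
    filter_upwards [Lp.coeFn_sub v u] with x hx
    simp only [hx, Pi.sub_apply]
    exact abs_sub_linear_le_of_lipschitz hp hF (u x) (v x)
  refine Asymptotics.IsBigO.trans_isLittleO (g := fun v => ‖v - u‖ ^ 2)
    (Asymptotics.IsBigO.of_bound L (Eventually.of_forall fun v => ?_)) ?_
  · rw [Real.norm_eq_abs, Real.norm_eq_abs, abs_of_nonneg (by positivity : 0 ≤ ‖v - u‖ ^ 2)]
    exact hbig v
  · exact Asymptotics.isLittleO_pow_sub_sub u one_lt_two

variable {V : Type} [NormedAddCommGroup V] [InnerProductSpace ℝ V]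
  {ι : V →L[ℝ] Lp ℝ 2 μ} {f : ℝ → ℝ} {q Q : ℕ → ℝ → ℝ} {ε κ C S : ℝ}

theorem IsTruncation.abs_limit_le (h : IsTruncation f q Q ε κ C) (s : ℝ) :
    |f s| ≤ C * (1 + |s| ^ 5) :=
  le_of_tendsto (h.tendsto id (fun _ => s) s tendsto_id tendsto_const_nhds).abs
    (Eventually.of_forall fun n => h.abs_le n s)

/-- The truncated superposition operators approximate `f`, provided that `ι` maps boundedly
to `L⁶`. -/
theorem IsTruncation.isApproximation (h : IsTruncation f q Q ε κ C) (hC : 0 ≤ C) (hS : 0 ≤ S)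
    (hint : ∀ w, Integrable (fun x => |ι w x| ^ 6) μ)
    (hsob : ∀ w, ∫ x, |ι w x| ^ 6 ∂μ ≤ S * ‖w‖ ^ 6) :
    IsApproximation ι (fun n => superposition μ (q n)) (fun n u => ∫ x, Q n (u x) ∂μ)
      (fun w z => ∫ x, f (ι w x) * ι z x ∂μ) ε κ (C * (μ.real univ + S)) := by
  have hμ : 0 ≤ μ.real univ := measureReal_nonneg
  choose L hL using h.lipschitz
  have hQ := fun n => integrable_primitive_comp (μ := μ) (hL n) (h.hasDerivAt n)
  have hone : Integrable (fun _ : X => (1 : ℝ)) μ := integrable_const _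
  have hone6 : ∀ w, Integrable (fun x => 1 + |ι w x| ^ 6) μ := fun w => hone.add (hint w)
  have hone' : ∫ _ : X, (1 : ℝ) ∂μ = μ.real univ := by simp
  have hCS : C * μ.real univ ≤ C * (μ.real univ + S) := by gcongr; linarith
  have hconst : ∫ _ : X, C ∂μ = C * μ.real univ := by simp [mul_comm]
  refine ⟨fun n => ⟨⟨L n, lipschitzWith_superposition (hL n)⟩,
    hasFDerivAt_integral_primitive (hL n) (h.hasDerivAt n), fun u => ?_, fun u => ?_⟩,
    fun n w => ?_, fun M => ?_, ?_⟩
  · obtain ⟨hi, he⟩ := inner_superposition (hL n) u u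
    rw [he, L2_norm_sq_eq_integral]
    have h0 : Integrable (fun x => ε * Q n (u x) + κ * u x ^ 2) μ :=
      ((hQ n u).const_mul ε).add ((L2_integrable_sq u).const_mul κ)
    have h1 : Integrable (fun x => ε * Q n (u x) + κ * u x ^ 2 - C) μ :=
      h0.sub (integrable_const C)
    have h2 := integral_mono h1 hi fun x => h.le_mul n (u x)
    have e : ∫ x, (ε * Q n (u x) + κ * u x ^ 2 - C) ∂μ =
        ε * ∫ x, Q n (u x) ∂μ + κ * (∫ x, u x ^ 2 ∂μ) - C * μ.real univ := by
      rw [integral_sub h0 (integrable_const C), integral_add ((hQ n u).const_mul ε)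
        ((L2_integrable_sq u).const_mul κ), integral_const_mul, integral_const_mul, hconst]
    linarith
  · rw [L2_norm_sq_eq_integral]
    have h1 : Integrable (fun x => κ * u x ^ 2 - C) μ :=
      ((L2_integrable_sq u).const_mul κ).sub (integrable_const C)
    have h2 := integral_mono h1 (hQ n u) fun x => h.le_potential n (u x)
    have e : ∫ x, (κ * u x ^ 2 - C) ∂μ = κ * (∫ x, u x ^ 2 ∂μ) - C * μ.real univ := by
      rw [integral_sub ((L2_integrable_sq u).const_mul κ) (integrable_const C),
        integral_const_mul, hconst]
    linarith
  · have h1 : ∫ x, |Q n (ι w x)| ∂μ ≤ ∫ x, C * (1 + |ι w x| ^ 6) ∂μ :=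
      integral_mono (hQ n _).abs ((hone6 w).const_mul C)
        fun x => h.abs_potential_le n _
    rw [integral_const_mul, integral_add hone (hint w), hone'] at h1
    have h2 : μ.real univ + S * ‖w‖ ^ 6 ≤ (μ.real univ + S) * (1 + ‖w‖ ^ 6) := by
      have : 0 ≤ ‖w‖ ^ 6 := by positivity
      nlinarith [mul_nonneg hμ this]
    calc _ ≤ C * (μ.real univ + S * ‖w‖ ^ 6) :=
          (abs_integral_le_integral_abs).trans (h1.trans (by gcongr; exact hsob w))
      _ ≤ C * ((μ.real univ + S) * (1 + ‖w‖ ^ 6)) := by gcongr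
      _ = _ := by ring
  -- Young's inequality with weight 1, applied to a⁵ |z| and to 1⁵ |z|, gives the integrand bound 1
  -- + a⁶ + 2 |z|⁶ with a the size of the state.
  · refine ⟨C * (μ.real univ + S * M ^ 6 + 2 * (S * M ^ 6)), fun n w z hw hz => ?_⟩
    obtain ⟨hi, he⟩ := inner_superposition (hL n) (ι w) (ι z)
    rw [he]
    refine (abs_integral_le_integral_abs).trans ((integral_mono (g := fun x =>
      C * (1 + |ι w x| ^ 6 + 2 * |ι z x| ^ 6)) hi.abs
      (((hone6 w).add ((hint z).const_mul 2)).const_mul C) fun x => ?_).trans ?_)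
    · simp only [abs_mul]
      have h1 := pow_five_mul_le (abs_nonneg (ι w x)) (abs_nonneg (ι z x)) one_pos
      have h2 := pow_five_mul_le zero_le_one (abs_nonneg (ι z x)) one_pos
      simp only [inv_one, one_pow, one_mul, mul_one] at h1 h2
      calc _ ≤ C * (1 + |ι w x| ^ 5) * |ι z x| := by gcongr; exact h.abs_le n _
        _ = C * (|ι z x| + |ι w x| ^ 5 * |ι z x|) := by ring
        _ ≤ _ := mul_le_mul_of_nonneg_left (by linarith) hC
    · rw [integral_const_mul, integral_add (hone6 w) ((hint z).const_mul 2),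
        integral_add hone (hint w), hone', integral_const_mul]
      have h1 : ∫ x, |ι w x| ^ 6 ∂μ ≤ S * M ^ 6 := (hsob w).trans (by gcongr)
      have h2 : ∫ x, |ι z x| ^ 6 ∂μ ≤ S * M ^ 6 := (hsob z).trans (by gcongr)
      gcongr
  · intro k w w' z z' M hk hw hιw hz
    have hM : 0 ≤ M := (norm_nonneg _).trans (hw 0)
    -- Convergence in L² gives almost everywhere convergence only along subsequences, so each
    -- subsequence is thinned twice, for the states and for the test functions.
    refine tendsto_of_subseq_tendsto fun ns hns => ?_
    obtain ⟨m₁, hm₁, hae₁⟩ := (tendstoInMeasure_of_tendsto_Lp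
      (hιw.comp hns)).exists_seq_tendsto_ae
    have hιz := ((ι.continuous.tendsto z').comp hz).comp (hns.comp hm₁.tendsto_atTop)
    obtain ⟨m₂, hm₂, hae₂⟩ := (tendstoInMeasure_of_tendsto_Lp hιz).exists_seq_tendsto_ae
    set j : ℕ → ℕ := fun n => ns (m₁ (m₂ n)) with hj
    have hjt : Tendsto j atTop atTop :=
      hns.comp (hm₁.tendsto_atTop.comp hm₂.tendsto_atTop)
    refine ⟨fun n => m₁ (m₂ n), ?_⟩
    change Tendsto (fun n => ⟪superposition μ (q (k (j n))) (ι (w (j n))), ι (z (j n))⟫_ℝ) atTop _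
    have hin := fun n => inner_superposition (hL (k (j n))) (ι (w (j n))) (ι (z (j n)))
    simp only [fun n => (hin n).2]
    have hint' : Integrable (fun x => f (ι w' x) * ι z' x) μ := by
      refine Integrable.mono' (g := fun x => C * (1 + |ι w' x| ^ 6 + 2 * |ι z' x| ^ 6))
        (((hone6 w').add ((hint z').const_mul 2)).const_mul C)
        ((h.continuous.comp_aestronglyMeasurable (Lp.aestronglyMeasurable _)).mul
          (Lp.aestronglyMeasurable _)) (Eventually.of_forall fun x => ?_)
      rw [Real.norm_eq_abs, abs_mul]
      have h1 := pow_five_mul_le (abs_nonneg (ι w' x)) (abs_nonneg (ι z' x)) one_pos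
      have h2 := pow_five_mul_le zero_le_one (abs_nonneg (ι z' x)) one_pos
      simp only [inv_one, one_pow, one_mul, mul_one] at h1 h2
      calc _ ≤ C * (1 + |ι w' x| ^ 5) * |ι z' x| := by gcongr; exact h.abs_limit_le _
        _ = C * (|ι z' x| + |ι w' x| ^ 5 * |ι z' x|) := by ring
        _ ≤ _ := mul_le_mul_of_nonneg_left (by linarith) hC
    refine tendsto_integral_of_dominated_up_to (fun n => (hin n).1) hint' ?_ fun η hη => ?_
    · filter_upwards [hae₁, hae₂] with x hx₁ hx₂
      exact (h.tendsto (fun n => k (j n)) _ _ (hk.comp hjt)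
        (hx₁.comp hm₂.tendsto_atTop)).mul hx₂
    -- θ makes the contribution of the states, bounded in L⁶ but not compact there, smaller than η /
    -- 2 uniformly in n.
    · obtain ⟨θ, hθ, hθη⟩ : ∃ θ : ℝ, 0 < θ ∧
          2 * C * θ * (μ.real univ + S * M ^ 6) ≤ η / 2 := by
        set Y := 2 * C * (μ.real univ + S * M ^ 6) with hY
        have hY0 : 0 ≤ Y := by positivity
        refine ⟨η / 2 / (Y + 1), by positivity, ?_⟩
        calc _ = η / 2 / (Y + 1) * Y := by rw [hY]; ring
          _ ≤ η / 2 / (Y + 1) * (Y + 1) := by gcongr; linarith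
          _ = η / 2 := by field_simp
      have hzsub : ∀ n, Integrable (fun x => |ι (z (j n)) x - ι z' x| ^ 6) μ ∧
          ∫ x, |ι (z (j n)) x - ι z' x| ^ 6 ∂μ ≤ S * ‖z (j n) - z'‖ ^ 6 := fun n => by
        have e : (fun x => |ι (z (j n) - z') x| ^ 6) =ᵐ[μ]
            fun x => |ι (z (j n)) x - ι z' x| ^ 6 := by
          rw [map_sub]
          filter_upwards [Lp.coeFn_sub (ι (z (j n))) (ι z')] with x hx
          rw [hx, Pi.sub_apply]
        exact ⟨(hint _).congr e, by rw [← integral_congr_ae e]; exact hsob _⟩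
      -- A n collects the terms without a common integrable majorant: a small multiple of the sixth
      -- power of the state, and |z n - z'|⁶, whose integral vanishes in the limit by strong
      -- convergence in `V`. Terms with the limits alone form D.
      refine ⟨fun n x => 2 * C * θ * (1 + |ι (w (j n)) x| ^ 6) +
        2 * C * θ⁻¹ ^ 5 * |ι (z (j n)) x - ι z' x| ^ 6,
        fun x => 2 * C * θ⁻¹ ^ 5 * |ι z' x| ^ 6 + |f (ι w' x) * ι z' x|,
        ((hint z').const_mul _).add hint'.abs, fun n => ((hone6 _).const_mul _).add
          ((hzsub n).1.const_mul _), fun n x => by positivity, ?_, fun n => ?_⟩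
      · have hz0 : Tendsto (fun n => 2 * C * θ⁻¹ ^ 5 * (S * ‖z (j n) - z'‖ ^ 6)) atTop (𝓝 0) := by
          have := ((((tendsto_iff_norm_sub_tendsto_zero.1 (hz.comp hjt)).pow 6).const_mul
            S).const_mul (2 * C * θ⁻¹ ^ 5))
          simpa using this
        filter_upwards [hz0.eventually_lt_const (by positivity : 0 < η / 2)] with n hn
        rw [integral_add ((hone6 _).const_mul _) ((hzsub n).1.const_mul _),
          integral_const_mul, integral_const_mul, integral_add hone (hint _), hone']
        have e1 : ∫ x, |ι (w (j n)) x| ^ 6 ∂μ ≤ S * M ^ 6 :=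
          (hsob _).trans (by gcongr; exact hw _)
        have e2 : 2 * C * θ * (μ.real univ + ∫ x, |ι (w (j n)) x| ^ 6 ∂μ) ≤
            2 * C * θ * (μ.real univ + S * M ^ 6) := by gcongr
        have e3 : 2 * C * θ⁻¹ ^ 5 * ∫ x, |ι (z (j n)) x - ι z' x| ^ 6 ∂μ ≤
            2 * C * θ⁻¹ ^ 5 * (S * ‖z (j n) - z'‖ ^ 6) := by gcongr; exact (hzsub n).2
        linarith
      · refine Eventually.of_forall fun x => ?_
        set a := |ι (w (j n)) x|
        set b := ι (z (j n)) x
        set b' := ι z' x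
        have ha : 0 ≤ a := abs_nonneg _
        have h0 : |q (k (j n)) (ι (w (j n)) x) * b| ≤
            C * ((|b - b'| + a ^ 5 * |b - b'|) + (|b'| + a ^ 5 * |b'|)) := by
          rw [abs_mul]
          have : |b| ≤ |b - b'| + |b'| := by
            have := abs_add_le (b - b') b'
            rwa [sub_add_cancel] at this
          calc _ ≤ C * (1 + a ^ 5) * (|b - b'| + |b'|) := by gcongr; exact h.abs_le _ _
            _ = _ := by ring
        have h1 := pow_five_mul_le ha (abs_nonneg (b - b')) hθ
        have h2 := pow_five_mul_le zero_le_one (abs_nonneg (b - b')) hθ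
        have h3 := pow_five_mul_le ha (abs_nonneg b') hθ
        have h4 := pow_five_mul_le zero_le_one (abs_nonneg b') hθ
        simp only [one_pow, one_mul, mul_one] at h2 h4
        have h5 : C * ((|b - b'| + a ^ 5 * |b - b'|) + (|b'| + a ^ 5 * |b'|)) ≤
            C * (2 * θ * (1 + a ^ 6) + 2 * θ⁻¹ ^ 5 * |b - b'| ^ 6 + 2 * θ⁻¹ ^ 5 * |b'| ^ 6) := by
          exact mul_le_mul_of_nonneg_left (by linarith) hC
        refine (abs_sub _ _).trans ?_
        linarith

theorem IsQuinticDissipative.exists_isApproximation (hf : IsQuinticDissipative f) (hS : 0 ≤ S)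
    (hint : ∀ w, Integrable (fun x => |ι w x| ^ 6) μ)
    (hsob : ∀ w, ∫ x, |ι w x| ^ 6 ∂μ ≤ S * ‖w‖ ^ 6) :
    ∃ (G : ℕ → Lp ℝ 2 μ → Lp ℝ 2 μ) (Φ : ℕ → Lp ℝ 2 μ → ℝ) (ε κ C : ℝ), 0 < ε ∧ 0 < κ ∧ 0 ≤ C ∧
      IsApproximation ι G Φ (fun w z => ∫ x, f (ι w x) * ι z x ∂μ) ε κ C := by
  obtain ⟨p, F, ε, κ, C, hε, hκ, hC, h⟩ := hf.exists_truncation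
  exact ⟨_, _, ε, κ, _, hε, hκ, by positivity, h.isApproximation hC hS hint hsob⟩

end Superposition

/-! ### Test functions and the space H¹ -/

namespace Problem

variable {P : Problem}

theorem domain_periodic_eq : domain periodic = (WithLp.ofLp : R3 → Fin 3 → ℝ) ⁻¹'
    Icc (fun _ => 0) (fun _ => 2 * Real.pi) := by
  ext x
  simp only [domain, mem_ofPred_eq, mem_preimage, mem_Icc, Pi.le_def, forall_and]

theorem isClosed_domain_periodic : IsClosed (domain periodic) := by
  rw [domain_periodic_eq]
  exact isClosed_Icc.preimage (PiLp.continuous_ofLp 2 _)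

theorem isBounded_domain (hP : P.IsAdmissible) : Bornology.IsBounded P.domain := by
  cases P with
  | dirichlet Ω => exact hP.isBounded
  | periodic =>
    rw [domain_periodic_eq]
    have h := (PiLp.antilipschitzWith_ofLp 2 (fun _ : Fin 3 => ℝ)).isBounded_preimage
      (Metric.isBounded_Icc (fun _ => (0 : ℝ)) (fun _ => 2 * Real.pi))
    exact h

theorem measurableSet_domain (hP : P.IsAdmissible) : MeasurableSet P.domain := by
  cases P with
  | dirichlet Ω => exact hP.isOpen.measurableSet
  | periodic => exact isClosed_domain_periodic.measurableSet

theorem isFiniteMeasure (hP : P.IsAdmissible) : IsFiniteMeasure P.μ :=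
  ⟨by rw [Measure.restrict_apply_univ]; exact (isBounded_domain hP).measure_lt_top⟩

/-- The Dirichlet domain is open, and the frontier of the convex periodicity cell is null. Hence
functions on the domain can be tested with bumps supported in its interior. -/
theorem restrict_interior_domain (hP : P.IsAdmissible) :
    volume.restrict (interior P.domain) = P.μ := by
  cases P with
  | dirichlet Ω =>
    change volume.restrict (interior Ω) = volume.restrict Ω
    rw [hP.isOpen.interior_eq]
  | periodic =>
    refine Measure.restrict_congr_set ?_
    refine interior_ae_eq_of_null_frontier (Convex.addHaar_frontier volume ?_)
    intro x hx y hy a b ha hb hab i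
    have h1 := hx i
    have h2 := hy i
    simp only [PiLp.add_apply, PiLp.smul_apply, smul_eq_mul, mem_Icc] at *
    constructor
    · nlinarith
    · nlinarith

theorem memLp_of_continuous (hP : P.IsAdmissible) {E : Type*} [NormedAddCommGroup E]
    [SecondCountableTopologyEither R3 E] {g : R3 → E} (hg : Continuous g) (p : ℝ≥0∞) :
    MemLp g p P.μ := by
  have := isFiniteMeasure hP
  obtain ⟨C, hC⟩ := ((isBounded_domain hP).isCompact_closure).exists_bound_of_continuousOn
    hg.continuousOn
  refine MemLp.of_bound hg.aestronglyMeasurable C ?_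
  filter_upwards [ae_restrict_mem (measurableSet_domain hP)] with x hx
  exact hC x (subset_closure hx)

theorem IsTest.contDiff {φ : R3 → ℝ} (hφ : P.IsTest φ) : ContDiff ℝ ∞ φ := by
  cases P <;> exact hφ.1

theorem continuous_gradient {φ : R3 → ℝ} (hφ : ContDiff ℝ ∞ φ) : Continuous (gradient φ) :=
  (InnerProductSpace.toDual ℝ R3).symm.continuous.comp (hφ.continuous_fderiv (by simp))

theorem gradient_add' {φ ψ : R3 → ℝ} (hφ : ContDiff ℝ ∞ φ) (hψ : ContDiff ℝ ∞ ψ) (x : R3) :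
    gradient (φ + ψ) x = gradient φ x + gradient ψ x := by
  simp only [gradient]
  rw [fderiv_add (hφ.differentiable (by simp) x) (hψ.differentiable (by simp) x), map_add]

theorem gradient_const_smul' {φ : R3 → ℝ} (hφ : ContDiff ℝ ∞ φ) (c : ℝ) (x : R3) :
    gradient (c • φ) x = c • gradient φ x := by
  simp only [gradient]
  rw [fderiv_const_smul (hφ.differentiable (by simp) x), map_smul]

theorem IsTest.zero : P.IsTest 0 := by
  cases P with
  | dirichlet Ω => exact ⟨contDiff_const, HasCompactSupport.zero, by simp⟩
  | periodic => exact ⟨contDiff_const, fun _ _ => rfl⟩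

theorem IsTest.add {φ ψ : R3 → ℝ} (hφ : P.IsTest φ) (hψ : P.IsTest ψ) : P.IsTest (φ + ψ) := by
  cases P with
  | dirichlet Ω => exact ⟨hφ.1.add hψ.1, hφ.2.1.add hψ.2.1,
      (tsupport_add φ ψ).trans (union_subset hφ.2.2 hψ.2.2)⟩
  | periodic => exact ⟨hφ.1.add hψ.1, fun i x => by
      simp only [Pi.add_apply]; rw [hφ.2 i x, hψ.2 i x]⟩

theorem IsTest.const_smul {φ : R3 → ℝ} (hφ : P.IsTest φ) (c : ℝ) : P.IsTest (c • φ) := by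
  cases P with
  | dirichlet Ω => exact ⟨contDiff_const.smul hφ.1, hφ.2.1.smul_left (f := fun _ => c),
      (tsupport_smul_subset_right (fun _ => c) φ).trans hφ.2.2⟩
  | periodic => exact ⟨contDiff_const.smul hφ.1, fun i x => by
      simp only [Pi.smul_apply]; rw [hφ.2 i x]⟩

variable (P) in
/-- The pairs `(φ, ∇φ)` with a test function `φ`. -/
def testSubmodule : Submodule ℝ (WithLp 2 (P.L2 × P.L2vec)) where
  carrier := {a | ∃ φ : R3 → ℝ, P.IsTest φ ∧
    a.fst =ᵐ[P.μ] φ ∧ a.snd =ᵐ[P.μ] fun x => gradient φ x}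
  zero_mem' := by
    refine ⟨0, IsTest.zero, Lp.coeFn_zero _ _ _, ?_⟩
    filter_upwards [Lp.coeFn_zero R3 2 P.μ] with x hx
    refine hx.trans ?_
    simp [gradient]
  add_mem' := by
    rintro a b ⟨φ, hφ, h1, h2⟩ ⟨ψ, hψ, h3, h4⟩
    refine ⟨φ + ψ, hφ.add hψ, ?_, ?_⟩
    · rw [WithLp.add_fst]
      exact (Lp.coeFn_add _ _).trans (h1.add h3)
    · rw [WithLp.add_snd]
      filter_upwards [Lp.coeFn_add a.snd b.snd, h2, h4] with x e1 e2 e3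
      rw [e1, Pi.add_apply, e2, e3, gradient_add' hφ.contDiff hψ.contDiff]
  smul_mem' := by
    rintro c a ⟨φ, hφ, h1, h2⟩
    refine ⟨c • φ, hφ.const_smul c, ?_, ?_⟩
    · rw [WithLp.smul_fst]
      exact (Lp.coeFn_smul _ _).trans (h1.const_smul c)
    · rw [WithLp.smul_snd]
      filter_upwards [Lp.coeFn_smul c a.snd, h2] with x e1 e2
      rw [e1, Pi.smul_apply, e2, gradient_const_smul' hφ.contDiff]

theorem H1_eq : P.H1 = P.testSubmodule.topologicalClosure := by
  rw [H1]
  congr 1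
  exact Submodule.span_eq P.testSubmodule

instance : CompleteSpace P.H1 := by
  unfold H1; infer_instance

/-- The element of `H¹` given by a test function. -/
def testElement (hP : P.IsAdmissible) {φ : R3 → ℝ} (hφ : P.IsTest φ) : P.H1 :=
  ⟨WithLp.toLp 2 ((memLp_of_continuous hP hφ.contDiff.continuous 2).toLp φ,
    (memLp_of_continuous hP (continuous_gradient hφ.contDiff) 2).toLp (gradient φ)), by
    rw [H1_eq]
    exact P.testSubmodule.le_topologicalClosure
      ⟨φ, hφ, (memLp_of_continuous hP hφ.contDiff.continuous 2).coeFn_toLp,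
        (memLp_of_continuous hP (continuous_gradient hφ.contDiff) 2).coeFn_toLp⟩⟩

theorem toL2_testElement (hP : P.IsAdmissible) {φ : R3 → ℝ} (hφ : P.IsTest φ) :
    H1.toL2 (testElement hP hφ) =ᵐ[P.μ] φ :=
  (memLp_of_continuous hP hφ.contDiff.continuous 2).coeFn_toLp

theorem grad_testElement (hP : P.IsAdmissible) {φ : R3 → ℝ} (hφ : P.IsTest φ) :
    H1.grad (testElement hP hφ) =ᵐ[P.μ] gradient φ :=
  (memLp_of_continuous hP (continuous_gradient hφ.contDiff) 2).coeFn_toLp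

theorem exists_seq_testElement (hP : P.IsAdmissible) (w : P.H1) :
    ∃ (φ : ℕ → R3 → ℝ) (hφ : ∀ n, P.IsTest (φ n)),
      Tendsto (fun n => testElement hP (hφ n)) atTop (𝓝 w) := by
  have h : w.1 ∈ closure (P.testSubmodule : Set (WithLp 2 (P.L2 × P.L2vec))) := by
    rw [← Submodule.topologicalClosure_coe, ← H1_eq]
    exact w.2
  obtain ⟨a, ha, hlim⟩ := mem_closure_iff_seq_limit.1 h
  choose φ hφ h1 h2 using ha
  refine ⟨φ, hφ, tendsto_subtype_rng.2 ?_⟩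
  convert hlim using 2 with n
  refine WithLp.ofLp_injective 2 (Prod.ext ?_ ?_)
  · exact Lp.ext ((toL2_testElement hP (hφ n)).trans (h1 n).symm)
  · exact Lp.ext ((grad_testElement hP (hφ n)).trans (h2 n).symm)

theorem H1_induction (hP : P.IsAdmissible) {p : P.H1 → Prop} (hp : IsClosed {w | p w})
    (h : ∀ φ (hφ : P.IsTest φ), p (testElement hP hφ)) (w : P.H1) : p w := by
  obtain ⟨φ, hφ, hlim⟩ := exists_seq_testElement hP w
  exact hp.mem_of_tendsto hlim (Eventually.of_forall fun n => h _ (hφ n))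

variable (P) in
/-- The embedding of `H¹` into `L²`. -/
def embed : P.H1 →L[ℝ] P.L2 := (WithLp.fstL 2 ℝ P.L2 P.L2vec) ∘L P.H1.subtypeL

variable (P) in
/-- The gradient as an operator from `H¹` to `L²`. -/
def gradL : P.H1 →L[ℝ] P.L2vec := (WithLp.sndL 2 ℝ P.L2 P.L2vec) ∘L P.H1.subtypeL

theorem embed_apply (w : P.H1) : P.embed w = H1.toL2 w := rfl

theorem gradL_apply (w : P.H1) : P.gradL w = H1.grad w := rfl

theorem inner_H1_eq (w z : P.H1) :
    ⟪w, z⟫_ℝ = ⟪P.embed w, P.embed z⟫_ℝ + ⟪P.gradL w, P.gradL z⟫_ℝ := by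
  rw [Submodule.coe_inner, WithLp.prod_inner_apply]; rfl

theorem norm_sq_H1_eq (w : P.H1) : ‖w‖ ^ 2 = ‖P.embed w‖ ^ 2 + ‖P.gradL w‖ ^ 2 := by
  simp only [← real_inner_self_eq_norm_sq, inner_H1_eq]

theorem norm_embed_le (w : P.H1) : ‖P.embed w‖ ≤ ‖w‖ :=
  le_of_sq_le_sq (by rw [norm_sq_H1_eq]; linarith [sq_nonneg ‖P.gradL w‖]) (norm_nonneg _)

/-- Integration by parts against test functions supported in the interior of the domain. -/
theorem inner_gradL_eq (hP : P.IsAdmissible) {ψ : R3 → ℝ} (hψ : ContDiff ℝ ∞ ψ)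
    (hsupp : tsupport ψ ⊆ interior P.domain) (v : R3) (w : P.H1) :
    ⟪P.gradL w, (memLp_of_continuous hP (hψ.continuous.smul continuous_const) 2).toLp
      (fun x => ψ x • v)⟫_ℝ = -⟪P.embed w, (memLp_of_continuous hP
        ((hψ.continuous_fderiv (by simp)).clm_apply continuous_const) 2).toLp
          (fun x => fderiv ℝ ψ x v)⟫_ℝ := by
  refine H1_induction hP (p := fun w => ⟪P.gradL w, _⟫_ℝ = -⟪P.embed w, _⟫_ℝ)
    (isClosed_eq (by fun_prop) (by fun_prop)) (fun φ hφ => ?_) w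
  have hsub : tsupport ψ ⊆ P.domain := hsupp.trans interior_subset
  have hcomp : HasCompactSupport ψ :=
    Metric.isCompact_of_isClosed_isBounded (isClosed_tsupport _) ((isBounded_domain hP).subset hsub)
  have hφd := hφ.contDiff.differentiable (by simp)
  have hψd := hψ.differentiable (by simp)
  have hφc := (hφ.contDiff.continuous_fderiv (by simp)).clm_apply (continuous_const (y := v))
  have hψc := (hψ.continuous_fderiv (by simp)).clm_apply (continuous_const (y := v))
  have key := integral_mul_fderiv_eq_neg_fderiv_mul_of_integrable (μ := (volume : Measure R3))
    (f := ψ) (g := φ) (v := v)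
    ((hψc.mul hφ.contDiff.continuous).integrable_of_hasCompactSupport
      ((hcomp.fderiv_apply ℝ v).mul_right))
    ((hψ.continuous.mul hφc).integrable_of_hasCompactSupport hcomp.mul_right)
    ((hψ.continuous.mul hφ.contDiff.continuous).integrable_of_hasCompactSupport hcomp.mul_right)
    (fun x _ => hψd x) (fun x _ => hφd x)
  have e1 : ∫ x in P.domain, ψ x * fderiv ℝ φ x v = ∫ x, ψ x * fderiv ℝ φ x v :=
    setIntegral_eq_integral_of_forall_compl_eq_zero fun x hx => by
      rw [image_eq_zero_of_notMem_tsupport fun h => hx (hsub h), zero_mul]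
  have e2 : ∫ x in P.domain, fderiv ℝ ψ x v * φ x = ∫ x, fderiv ℝ ψ x v * φ x :=
    setIntegral_eq_integral_of_forall_compl_eq_zero fun x hx => by
      rw [image_eq_zero_of_notMem_tsupport fun h => hx (hsub (tsupport_fderiv_apply_subset ℝ v h)),
        zero_mul]
  rw [L2.inner_def, L2.inner_def]
  calc _ = ∫ x in P.domain, ψ x * fderiv ℝ φ x v := by
        refine integral_congr_ae ?_
        filter_upwards [grad_testElement hP hφ, MemLp.coeFn_toLp (memLp_of_continuous hP
          (g := fun x => ψ x • v) (hψ.continuous.smul continuous_const) 2)] with x h1 h2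
        rw [gradL_apply, h1, h2, inner_smul_right, inner_gradient_left]
    _ = _ := by
        rw [e1, key, ← e2]
        congr 1
        refine integral_congr_ae ?_
        filter_upwards [toL2_testElement hP hφ, MemLp.coeFn_toLp (memLp_of_continuous hP hψc 2)]
          with x h1 h2
        rw [embed_apply, h1, h2]
        simp

theorem L2_eq_zero_of_integral (hP : P.IsAdmissible) {E : Type*} [NormedAddCommGroup E]
    [NormedSpace ℝ E] [CompleteSpace E] (u : Lp E 2 P.μ) (h : ∀ ψ : R3 → ℝ, ContDiff ℝ ∞ ψ →
      HasCompactSupport ψ → tsupport ψ ⊆ interior P.domain → ∫ x, ψ x • u x ∂P.μ = 0) : u = 0 := by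
  have := isFiniteMeasure hP
  have hu : IntegrableOn u (interior P.domain) volume := by
    rw [IntegrableOn, restrict_interior_domain hP]
    exact (Lp.memLp u).integrable one_le_two
  have h1 := isOpen_interior.ae_eq_zero_of_integral_contDiff_smul_eq_zero
    hu.locallyIntegrableOn fun ψ h1 h2 h3 => by
      rw [← h ψ h1 h2 h3]
      refine (setIntegral_eq_integral_of_forall_compl_eq_zero fun x hx => ?_).symm
      rw [image_eq_zero_of_notMem_tsupport fun h => hx (interior_subset (h3 h)), zero_smul]
  refine (Lp.eq_zero_iff_ae_eq_zero).2 ?_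
  have h2 : u =ᵐ[volume.restrict (interior P.domain)] 0 := by
    filter_upwards [ae_restrict_of_ae h1, ae_restrict_mem isOpen_interior.measurableSet]
      with x e1 e2
    exact e1 e2
  rwa [restrict_interior_domain hP] at h2

/-- Elements of H¹ are pairs in the closure of a graph, so this is closability of the gradient: if
the function component vanishes, integration by parts makes the gradient component annihilate all
bumps in the interior. -/
theorem injective_embed (hP : P.IsAdmissible) : Function.Injective P.embed := by
  have := isFiniteMeasure hP
  refine (injective_iff_map_eq_zero P.embed).2 fun w hw => ?_
  have hg : P.gradL w = 0 := by
    refine L2_eq_zero_of_integral hP _ fun ψ h1 h2 h3 => ?_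
    have hint : Integrable (fun x => ψ x • P.gradL w x) P.μ := by
      obtain ⟨C, hC⟩ := h1.continuous.bounded_above_of_compact_support h2
      exact ((Lp.memLp (P.gradL w)).integrable one_le_two).bdd_smul C
        h1.continuous.aestronglyMeasurable (Eventually.of_forall hC)
    refine ext_inner_right ℝ fun v => ?_
    rw [inner_zero_left, real_inner_comm, ← integral_inner hint]
    have := inner_gradL_eq hP h1 h3 v w
    rw [hw, inner_zero_left, neg_zero, L2.inner_def] at this
    rw [← this]
    refine integral_congr_ae ?_
    filter_upwards [MemLp.coeFn_toLp (memLp_of_continuous hP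
      (g := fun x => ψ x • v) (h1.continuous.smul continuous_const) 2)] with x hx
    rw [hx, inner_smul_right, inner_smul_right, real_inner_comm]
  rw [← norm_eq_zero, ← sq_eq_zero_iff, norm_sq_H1_eq, hw, hg]
  simp

end Problem

/-! ### The Sobolev embedding into L⁶ -/

theorem eLpNorm_two_sq {X E : Type*} [MeasurableSpace X] {μ : Measure X} [NormedAddCommGroup E]
    (f : X → E) : eLpNorm f 2 μ ^ 2 = ∫⁻ x, ‖f x‖ₑ ^ 2 ∂μ := by
  have := eLpNorm_nnreal_pow_eq_lintegral (μ := μ) (f := f) (p := 2) two_ne_zero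
  simpa using this

theorem Lp_enorm_sq {X E : Type*} [MeasurableSpace X] {μ : Measure X} [NormedAddCommGroup E]
    (u : Lp E 2 μ) {f : X → E} (h : u =ᵐ[μ] f) : ‖u‖ₑ ^ 2 = ∫⁻ x, ‖f x‖ₑ ^ 2 ∂μ := by
  rw [Lp.enorm_def, eLpNorm_congr_ae h, eLpNorm_two_sq]

namespace Problem

variable {P : Problem}

/-- A function on the whole space which is the natural extension of its restriction to the domain:
by zero in the Dirichlet case, by periodicity in the periodic case. -/
def IsExtended {E : Type*} [Zero E] : Problem → (R3 → E) → Prop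
  | dirichlet Ω, h => ∀ x ∉ Ω, h x = 0
  | periodic, h => ∀ (i : Fin 3), Function.Periodic h (EuclideanSpace.single i (2 * Real.pi))

theorem IsExtended.comp {E F : Type*} [Zero E] [Zero F] {h : R3 → E} (hh : P.IsExtended h)
    {g : E → F} (hg : g 0 = 0) : P.IsExtended fun x => g (h x) := by
  cases P with
  | dirichlet Ω => intro x hx; simp only [hh x hx, hg]
  | periodic => intro i x; simp only [hh i x]

theorem IsTest.isExtended {φ : R3 → ℝ} (hφ : P.IsTest φ) : P.IsExtended φ := by
  cases P with
  | dirichlet Ω => exact fun x hx => image_eq_zero_of_notMem_tsupport fun h => hx (hφ.2.2 h)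
  | periodic => exact hφ.2

theorem IsTest.isExtended_fderiv {φ : R3 → ℝ} (hφ : P.IsTest φ) :
    P.IsExtended (fderiv ℝ φ) := by
  cases P with
  | dirichlet Ω =>
    exact fun x hx => image_eq_zero_of_notMem_tsupport fun h =>
      hx (hφ.2.2 (tsupport_fderiv_subset ℝ h))
  | periodic =>
    intro i x
    rw [← fderiv_comp_add_right]
    congr 1
    exact funext (hφ.2 i)

/-- The vectors of the period lattice. -/
def latticeVector (m : Fin 3 → ℤ) : R3 := WithLp.toLp 2 fun i => 2 * Real.pi * m i

theorem periodic_latticeVector {E : Type*} {h : R3 → E}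
    (hh : ∀ (i : Fin 3), Function.Periodic h (EuclideanSpace.single i (2 * Real.pi)))
    (m : Fin 3 → ℤ) : Function.Periodic h (latticeVector m) := by
  have e : latticeVector m = m 0 • EuclideanSpace.single 0 (2 * Real.pi) +
      m 1 • EuclideanSpace.single 1 (2 * Real.pi) +
      m 2 • EuclideanSpace.single 2 (2 * Real.pi) := by
    refine PiLp.ext fun i => ?_
    fin_cases i <;> simp [latticeVector, mul_comm]
  rw [e]
  exact (((hh 0).zsmul (m 0)).add_period ((hh 1).zsmul (m 1))).add_period ((hh 2).zsmul (m 2))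

theorem exists_finset_lattice_cover {B : Set R3} (hB : Bornology.IsBounded B) :
    ∃ s : Finset (Fin 3 → ℤ), ∀ x ∈ B, ∃ m ∈ s, x - latticeVector m ∈ domain periodic := by
  obtain ⟨R, hR⟩ := hB.exists_norm_le
  have hpi := Real.two_pi_pos
  refine ⟨Fintype.piFinset fun _ => Finset.Icc ⌊-R / (2 * Real.pi)⌋ ⌊R / (2 * Real.pi)⌋,
    fun x hx => ⟨fun i => ⌊x i / (2 * Real.pi)⌋, ?_, fun i => ?_⟩⟩
  · have h1 : ∀ i, |x i| ≤ R := fun i => (PiLp.norm_apply_le x i).trans (hR x hx)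
    simp only [Fintype.mem_piFinset, Finset.mem_Icc]
    intro i
    have := abs_le.1 (h1 i)
    constructor
    · exact Int.floor_le_floor (by gcongr; exact this.1)
    · exact Int.floor_le_floor (by gcongr; exact this.2)
  · have h1 := Int.floor_le (x i / (2 * Real.pi))
    have h2 := (Int.lt_floor_add_one (x i / (2 * Real.pi))).le
    rw [le_div_iff₀ hpi] at h1
    rw [div_le_iff₀ hpi] at h2
    simp only [latticeVector, PiLp.sub_apply, mem_Icc]
    constructor <;> nlinarith

/-- The integral of an extended function over a bounded set is controlled by that over the
domain. -/
theorem exists_lintegral_le_of_isBounded (P : Problem) {B : Set R3} (hB : Bornology.IsBounded B) :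
    ∃ N : ℕ, 1 ≤ N ∧ ∀ h : R3 → ℝ≥0∞, P.IsExtended h →
      ∫⁻ x in B, h x ≤ N * ∫⁻ x in P.domain, h x := by
  cases P with
  | dirichlet Ω =>
    refine ⟨1, le_rfl, fun h hh => ?_⟩
    have h0 : Function.support h ⊆ Ω := fun x hx => by
      by_contra h1; exact hx (hh x h1)
    rw [Nat.cast_one, one_mul]
    calc ∫⁻ x in B, h x ≤ ∫⁻ x, h x := setLIntegral_le_lintegral _ _
      _ = ∫⁻ x in Ω, h x := (setLIntegral_eq_of_support_subset h0).symm
  | periodic =>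
    obtain ⟨s, hs⟩ := exists_finset_lattice_cover hB
    refine ⟨s.card + 1, by omega, fun h hh => ?_⟩
    have hsub : B ⊆ ⋃ m : s, (fun x => x - latticeVector m) ⁻¹' domain periodic := fun x hx => by
      obtain ⟨m, hm, hxm⟩ := hs x hx
      exact mem_iUnion.2 ⟨⟨m, hm⟩, hxm⟩
    have hone : ∀ m, ∫⁻ x in (fun x => x - latticeVector m) ⁻¹' domain periodic, h x =
        ∫⁻ x in domain periodic, h x := fun m => by
      refine Eq.trans ?_ ((measurePreserving_sub_right volume
        (latticeVector m)).setLIntegral_comp_preimage_emb (measurableEmbedding_subRight _) h _)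
      refine lintegral_congr fun x => ?_
      have := periodic_latticeVector hh m (x - latticeVector m)
      rw [sub_add_cancel] at this
      exact this
    calc ∫⁻ x in B, h x ≤ ∫⁻ x in ⋃ m : s, (fun x => x - latticeVector m) ⁻¹' domain periodic, h x :=
          lintegral_mono_set hsub
      _ ≤ ∑' m : s, ∫⁻ x in (fun x => x - latticeVector m) ⁻¹' domain periodic, h x :=
          lintegral_iUnion_le _ _
      _ = s.card * ∫⁻ x in domain periodic, h x := by
          rw [tsum_fintype]
          simp [hone]
      _ ≤ _ := by gcongr; exact le_self_add

theorem norm_gradient_eq (φ : R3 → ℝ) (x : R3) : ‖gradient φ x‖ = ‖fderiv ℝ φ x‖ := by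
  simp [gradient]

theorem lintegral_sq_testElement (hP : P.IsAdmissible) {φ : R3 → ℝ} (hφ : P.IsTest φ) :
    ∫⁻ x in P.domain, ‖φ x‖ₑ ^ 2 = ‖P.embed (testElement hP hφ)‖ₑ ^ 2 :=
  (Lp_enorm_sq _ (toL2_testElement hP hφ)).symm

theorem lintegral_fderiv_sq_testElement (hP : P.IsAdmissible) {φ : R3 → ℝ} (hφ : P.IsTest φ) :
    ∫⁻ x in P.domain, ‖fderiv ℝ φ x‖ₑ ^ 2 = ‖P.gradL (testElement hP hφ)‖ₑ ^ 2 := by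
  have h : ∀ x, ‖fderiv ℝ φ x‖ₑ = ‖gradient φ x‖ₑ := fun x => by
    rw [← ofReal_norm, ← ofReal_norm, norm_gradient_eq]
  simp only [h]
  exact (Lp_enorm_sq _ (grad_testElement hP hφ)).symm

theorem enorm_sq_H1_eq (w : P.H1) : ‖w‖ₑ ^ 2 = ‖P.gradL w‖ₑ ^ 2 + ‖P.embed w‖ₑ ^ 2 := by
  simp only [← ofReal_norm, ← ENNReal.ofReal_pow (norm_nonneg _)]
  rw [← ENNReal.ofReal_add (by positivity) (by positivity), norm_sq_H1_eq, add_comm]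

/-- The Sobolev inequality for test functions. -/
theorem exists_eLpNorm_six_testElement_le (hP : P.IsAdmissible) :
    ∃ S : NNReal, ∀ (φ : R3 → ℝ) (hφ : P.IsTest φ),
      eLpNorm φ 6 P.μ ≤ S * ‖testElement hP hφ‖ₑ := by
  obtain ⟨R, hR0, hR⟩ : ∃ R : ℝ, 0 < R ∧ P.domain ⊆ Metric.closedBall 0 R := by
    obtain ⟨R, hR0, hR⟩ := (isBounded_domain hP).subset_closedBall_lt 0 (0 : R3)
    exact ⟨R, hR0, hR⟩
  -- Periodic test functions lack compact support, so the whole-space inequality is applied to χ φ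
  -- with χ = 1 on the domain. Its gradient lives on a larger ball, where the extension by periods
  -- or by zero is controlled by the domain.
  let χ : ContDiffBump (0 : R3) := ⟨R, R + 1, hR0, by linarith⟩
  have hχ : ContDiff ℝ ∞ χ := χ.contDiff
  obtain ⟨A, hA⟩ := (hχ.continuous_fderiv (by simp)).bounded_above_of_compact_support
    (χ.hasCompactSupport.fderiv ℝ)
  have hA0 : 0 ≤ A := (norm_nonneg _).trans (hA 0)
  obtain ⟨N, hN, hcov⟩ := exists_lintegral_le_of_isBounded P
    (Metric.isBounded_closedBall (x := (0 : R3)) (r := R + 1))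
  set D : NNReal := (2 * (1 + A ^ 2)).toNNReal with hD
  set K : NNReal := D * N with hK
  have hK1 : 1 ≤ K := by
    have h1 : 1 ≤ D := Real.one_le_toNNReal.2 (by nlinarith [sq_nonneg A])
    have h2 : (1 : NNReal) ≤ N := by exact_mod_cast hN
    exact one_le_mul h1 h2
  refine ⟨SNormLESNormFDerivOfEqConst ℝ (volume : Measure R3) ((2 : NNReal) : ℝ) * K,
    fun φ hφ => ?_⟩
  have hφ1 := hφ.contDiff
  set u : R3 → ℝ := fun x => χ x * φ x with hu
  have hu1 : ContDiff ℝ 1 u := (hχ.mul hφ1).of_le (by simp)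
  have hu2 : HasCompactSupport u := χ.hasCompactSupport.mul_right
  have hsob : eLpNorm u 6 volume ≤
      SNormLESNormFDerivOfEqConst ℝ (volume : Measure R3) ((2 : NNReal) : ℝ) *
        eLpNorm (fderiv ℝ u) 2 volume := by
    have := eLpNorm_le_eLpNorm_fderiv_of_eq (volume : Measure R3) hu1 hu2 (p := 2) (p' := 6)
      one_le_two (by simp) (by simp; norm_num)
    exact this
  have hzero : ‖(0 : R3 →L[ℝ] ℝ)‖ₑ = 0 := by rw [← ofReal_norm, norm_zero, ENNReal.ofReal_zero]
  have hpt : ∀ x, ‖fderiv ℝ u x‖ₑ ^ 2 ≤ (Metric.closedBall (0 : R3) (R + 1)).indicator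
      (fun x => D * (‖fderiv ℝ φ x‖ₑ ^ 2 + ‖φ x‖ₑ ^ 2)) x := fun x => by
    by_cases hx : x ∈ Metric.closedBall (0 : R3) (R + 1)
    · rw [indicator_of_mem hx]
      have h1 : fderiv ℝ u x = χ x • fderiv ℝ φ x + φ x • fderiv ℝ χ x :=
        fderiv_fun_mul (hχ.differentiable (by simp) x) (hφ1.differentiable (by simp) x)
      have h2 : ‖fderiv ℝ u x‖ ≤ ‖fderiv ℝ φ x‖ + A * ‖φ x‖ := by
        rw [h1]
        refine (norm_add_le _ _).trans (add_le_add ?_ ?_)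
        · rw [norm_smul, Real.norm_of_nonneg χ.nonneg]
          exact mul_le_of_le_one_left (norm_nonneg _) χ.le_one
        · rw [norm_smul, mul_comm]
          gcongr
          exact hA x
      have h3 : ‖fderiv ℝ u x‖ ^ 2 ≤ 2 * (1 + A ^ 2) * (‖fderiv ℝ φ x‖ ^ 2 + ‖φ x‖ ^ 2) := by
        have h4 := pow_le_pow_left₀ (norm_nonneg _) h2 2
        nlinarith [sq_nonneg (‖fderiv ℝ φ x‖ - A * ‖φ x‖), sq_nonneg (A * ‖fderiv ℝ φ x‖),
          sq_nonneg (‖φ x‖)]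
      have e : (D : ℝ≥0∞) = ENNReal.ofReal (2 * (1 + A ^ 2)) := rfl
      rw [e]
      simp only [← ofReal_norm, ← ENNReal.ofReal_pow (norm_nonneg _)]
      rw [← ENNReal.ofReal_add (by positivity) (by positivity),
        ← ENNReal.ofReal_mul (by positivity)]
      exact ENNReal.ofReal_le_ofReal h3
    · have h1 : x ∉ tsupport u := fun h => hx <| by
        have := tsupport_mul_subset_left h
        rwa [χ.tsupport_eq] at this
      rw [image_eq_zero_of_notMem_tsupport fun h => h1 (tsupport_fderiv_subset ℝ h), hzero]
      simp
  have hgrad : eLpNorm (fderiv ℝ u) 2 volume ≤ K * ‖testElement hP hφ‖ₑ := by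
    rw [← ENNReal.pow_le_pow_left_iff two_ne_zero, eLpNorm_two_sq]
    calc ∫⁻ x, ‖fderiv ℝ u x‖ₑ ^ 2 ≤ ∫⁻ x, (Metric.closedBall (0 : R3) (R + 1)).indicator
          (fun x => D * (‖fderiv ℝ φ x‖ₑ ^ 2 + ‖φ x‖ₑ ^ 2)) x := lintegral_mono hpt
      _ = D * ∫⁻ x in Metric.closedBall (0 : R3) (R + 1),
          (‖fderiv ℝ φ x‖ₑ ^ 2 + ‖φ x‖ₑ ^ 2) := by
          rw [lintegral_indicator measurableSet_closedBall, lintegral_const_mul' _ _ (by simp)]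
      _ ≤ D * (N * ∫⁻ x in P.domain, (‖fderiv ℝ φ x‖ₑ ^ 2 + ‖φ x‖ₑ ^ 2)) := by
          gcongr
          refine hcov _ ?_
          have h1 := hφ.isExtended_fderiv.comp (g := fun y => ‖y‖ₑ ^ 2) (by simp [hzero])
          have h2 := hφ.isExtended.comp (g := fun y => ‖y‖ₑ ^ 2) (by simp)
          revert h1 h2
          cases P with
          | dirichlet Ω => exact fun h1 h2 x hx => 
              (congrArg₂ (· + ·) (h1 x hx) (h2 x hx)).trans (add_zero 0)
          | periodic => exact fun h1 h2 i x => congrArg₂ (· + ·) (h1 i x) (h2 i x)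
      _ = K * ‖testElement hP hφ‖ₑ ^ 2 := by
          rw [lintegral_add_right _ (by have := hφ1.continuous; fun_prop),
            lintegral_fderiv_sq_testElement hP hφ, lintegral_sq_testElement hP hφ,
            ← enorm_sq_H1_eq, ← mul_assoc, hK]
          push_cast; rfl
      -- K ≥ 1 permits K ≤ K², which avoids square roots of the constant.
      _ ≤ (K * ‖testElement hP hφ‖ₑ) ^ 2 := by
          rw [mul_pow]
          gcongr
          exact le_self_pow₀ (by exact_mod_cast hK1) two_ne_zero
  calc eLpNorm φ 6 P.μ = eLpNorm u 6 P.μ := by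
        refine eLpNorm_congr_ae ?_
        filter_upwards [ae_restrict_mem (measurableSet_domain hP)] with x hx
        simp only [hu]
        rw [χ.one_of_mem_closedBall (hR hx), one_mul]
    _ ≤ eLpNorm u 6 volume := eLpNorm_mono_measure _ Measure.restrict_le_self
    _ ≤ _ := hsob.trans (by rw [ENNReal.coe_mul, mul_assoc]; gcongr)

/-- The Sobolev embedding of `H¹` into `L⁶`. -/
theorem exists_sobolev (hP : P.IsAdmissible) : ∃ S : ℝ, 0 ≤ S ∧
    (∀ w, Integrable (fun x => |P.embed w x| ^ 6) P.μ) ∧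
    ∀ w, ∫ x, |P.embed w x| ^ 6 ∂P.μ ≤ S * ‖w‖ ^ 6 := by
  obtain ⟨S, hS⟩ := exists_eLpNorm_six_testElement_le hP
  have hle : ∀ w, eLpNorm (P.embed w) 6 P.μ ≤ S * ‖w‖ₑ := fun w => by
    obtain ⟨φ, hφ, hlim⟩ := exists_seq_testElement hP w
    refine le_of_forall_gt_imp_ge_of_dense fun C hC => ?_
    have h1 : Tendsto (fun n => (S : ℝ≥0∞) * ‖testElement hP (hφ n)‖ₑ) atTop (𝓝 (S * ‖w‖ₑ)) :=
      ENNReal.Tendsto.const_mul ((continuous_enorm.tendsto w).comp hlim) (Or.inr (by simp))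
    -- The L⁶ norm is lower semicontinuous under convergence in measure, so the inequality passes
    -- from test functions to their closure.
    refine eLpNorm_le_of_tendstoInMeasure (f := fun n => P.embed (testElement hP (hφ n)))
      (u := atTop) ?_ (tendstoInMeasure_of_tendsto_Lp ((P.embed.continuous.tendsto w).comp hlim))
      fun n => Lp.aestronglyMeasurable _
    filter_upwards [h1.eventually_lt_const hC] with n hn
    exact ((eLpNorm_congr_ae (toL2_testElement hP (hφ n))).trans_le (hS _ _)).trans hn.le
  have hmem : ∀ w, MemLp (P.embed w) (6 : ℕ) P.μ := fun w =>
    ⟨Lp.aestronglyMeasurable _, (hle w).trans_lt (ENNReal.mul_lt_top (by simp) (by simp))⟩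
  refine ⟨S ^ 6, by positivity, fun w => (hmem w).integrable_norm_pow (by norm_num), fun w => ?_⟩
  have h1 := eLpNorm_nnreal_pow_eq_lintegral (μ := P.μ) (f := P.embed w) (p := 6) (by norm_num)
  have h2 : ∫⁻ x, ‖P.embed w x‖ₑ ^ 6 ∂P.μ ≤ (S * ‖w‖ₑ) ^ 6 := by
    have := pow_le_pow_left₀ zero_le (hle w) 6
    refine le_trans (le_of_eq ?_) this
    simpa using h1.symm
  have h3 := integral_eq_lintegral_of_nonneg_ae (μ := P.μ) (f := fun x => |P.embed w x| ^ 6)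
    (Eventually.of_forall fun x => by positivity)
    ((hmem w).integrable_norm_pow (by norm_num)).aestronglyMeasurable
  rw [h3, ← mul_pow]
  refine ENNReal.toReal_le_of_le_ofReal (by positivity) (le_trans (le_of_eq ?_) (h2.trans_eq ?_))
  · refine lintegral_congr fun x => ?_
    rw [ENNReal.ofReal_pow (abs_nonneg _), ← Real.norm_eq_abs, ofReal_norm]
  · rw [ENNReal.ofReal_pow (by positivity), ENNReal.ofReal_mul (by positivity), ofReal_norm,
      ENNReal.ofReal_coe_nnreal]

end Problem

/-! ### Rellich's theorem by averaging over cubes -/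

/-- An operator which is small on subspaces of finite codimension is compact. -/
theorem isCompactOperator_of_forall_exists_finset {V H : Type*} [NormedAddCommGroup V]
    [InnerProductSpace ℝ V] [CompleteSpace V] [NormedAddCommGroup H] [InnerProductSpace ℝ H]
    [CompleteSpace H] {ι : V →L[ℝ] H}
    (h : ∀ ε > 0, ∃ E : Finset H, ∀ w, (∀ e ∈ E, ⟪e, ι w⟫_ℝ = 0) → ‖ι w‖ ≤ ε * ‖w‖) :
    IsCompactOperator ι := by
  have hclosed : IsClosed {f : V →L[ℝ] H | IsCompactOperator f} :=
    isClosed_setOfPred_isCompactOperator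
  have hmem : ι ∈ closure {f : V →L[ℝ] H | IsCompactOperator f} := by
    rw [Metric.mem_closure_iff]
    intro ε hε
    obtain ⟨E, hE⟩ := h (ε / 2) (by positivity)
    -- Orthogonality to F means ⟪e, ι w⟫ = 0 for all e in E, so ι differs by at most ε / 2 from its
    -- finite-rank composition with the projection to F.
    let F : Submodule ℝ V := Submodule.span ℝ (ι.adjoint '' E)
    have : FiniteDimensional ℝ F :=
      FiniteDimensional.span_of_finite ℝ (E.finite_toSet.image _)
    have : ProperSpace F := FiniteDimensional.proper_real F
    have hcomp : IsCompactOperator (ι ∘L F.starProjection) := by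
      have h1 : IsCompactOperator (ι ∘L F.subtypeL) :=
        isCompactOperator_of_locallyCompactSpace_rng _
      exact h1.comp_clm F.orthogonalProjectionOnto
    refine ⟨_, hcomp, ?_⟩
    rw [dist_eq_norm]
    refine (ContinuousLinearMap.opNorm_le_bound _ (by positivity) fun w => ?_).trans_lt
      (half_lt_self hε)
    have h2 : (ι - ι ∘L F.starProjection) w = ι (w - F.starProjection w) := by simp
    rw [h2]
    refine (hE _ fun e he => ?_).trans ?_
    · rw [← ContinuousLinearMap.adjoint_inner_left]
      exact (F.sub_starProjection_mem_orthogonal w) _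
        (Submodule.subset_span (mem_image_of_mem _ he))
    · gcongr
      have h3 : w - F.starProjection w = Fᗮ.starProjection w := by
        rw [Submodule.starProjection_orthogonal']; simp
      rw [h3]
      exact Submodule.norm_starProjection_apply_le _ w
  rwa [hclosed.closure_eq] at hmem

/-- The half-open cells of a cubic grid of side `s`. -/
def gridCell (s : ℝ) (k : Fin 3 → ℤ) : Set R3 :=
  (WithLp.ofLp : R3 → Fin 3 → ℝ) ⁻¹' univ.pi fun i => Ico (k i * s) ((k i + 1) * s)

theorem mem_gridCell_iff {s : ℝ} (hs : 0 < s) {k : Fin 3 → ℤ} {x : R3} :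
    x ∈ gridCell s k ↔ ∀ i, ⌊x i / s⌋ = k i := by
  simp only [gridCell, mem_preimage, mem_univ_pi, mem_Ico, Int.floor_eq_iff, le_div_iff₀ hs,
    div_lt_iff₀ hs]

theorem measurableSet_gridCell (s : ℝ) (k : Fin 3 → ℤ) : MeasurableSet (gridCell s k) :=
  (MeasurableSet.univ_pi fun _ => measurableSet_Ico).preimage
    (PiLp.volume_preserving_ofLp (Fin 3)).measurable

theorem volume_gridCell (s : ℝ) (k : Fin 3 → ℤ) :
    volume (gridCell s k) = ENNReal.ofReal s ^ 3 := by
  rw [gridCell, (PiLp.volume_preserving_ofLp (Fin 3)).measure_preimage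
    (MeasurableSet.univ_pi fun _ => measurableSet_Ico).nullMeasurableSet, Real.volume_pi_Ico]
  simp [add_mul]

theorem pairwiseDisjoint_gridCell {s : ℝ} (hs : 0 < s) (Λ : Set (Fin 3 → ℤ)) :
    Λ.PairwiseDisjoint (gridCell s) := fun k _ l _ hkl =>
  disjoint_left.2 fun x hx hx' => hkl <| funext fun i => by
    rw [← (mem_gridCell_iff hs).1 hx i, (mem_gridCell_iff hs).1 hx' i]

/-- The cube of half-side `s` centred at the origin. -/
def centredCube (s : ℝ) : Set R3 :=
  (WithLp.ofLp : R3 → Fin 3 → ℝ) ⁻¹' Icc (fun _ => -s) (fun _ => s)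

theorem measurableSet_centredCube (s : ℝ) : MeasurableSet (centredCube s) :=
  measurableSet_Icc.preimage (PiLp.volume_preserving_ofLp (Fin 3)).measurable

theorem volume_centredCube (s : ℝ) : volume (centredCube s) = ENNReal.ofReal (2 * s) ^ 3 := by
  rw [centredCube, (PiLp.volume_preserving_ofLp (Fin 3)).measure_preimage
    measurableSet_Icc.nullMeasurableSet, Real.volume_Icc_pi]
  simp [two_mul]

theorem norm_le_of_mem_centredCube {s : ℝ} (hs : 0 ≤ s) {x : R3} (hx : x ∈ centredCube s) :
    ‖x‖ ≤ 2 * s := by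
  have h : ∀ i, ‖x i‖ ^ 2 ≤ s ^ 2 := fun i => by
    have h1 : |x i| ≤ s := abs_le.2 ⟨hx.1 i, hx.2 i⟩
    rw [Real.norm_eq_abs]
    gcongr
  rw [EuclideanSpace.norm_eq]
  refine Real.sqrt_le_iff.2 ⟨by linarith, ?_⟩
  rw [Fin.sum_univ_three]
  nlinarith [h 0, h 1, h 2, sq_nonneg s]

theorem sub_mem_centredCube {s : ℝ} {k : Fin 3 → ℤ} {x y : R3} (hx : x ∈ gridCell s k)
    (hy : y ∈ gridCell s k) : x - y ∈ centredCube s := by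
  have hx' : ∀ i, x i ∈ Ico (k i * s) ((k i + 1) * s) := fun i => hx i trivial
  have hy' : ∀ i, y i ∈ Ico (k i * s) ((k i + 1) * s) := fun i => hy i trivial
  constructor <;> intro i <;> simp only [PiLp.sub_apply] <;>
    linarith [(hx' i).1, (hx' i).2, (hy' i).1, (hy' i).2]

/-- The variance is bounded by the mean square difference. -/
theorem ofReal_variance_mul_le {Q : Set R3} {m : ℝ} (hm : 0 < m)
    (hQm : volume Q = ENNReal.ofReal m) (hQb : Bornology.IsBounded Q) {φ : R3 → ℝ} (hφ : Continuous φ) :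
    ENNReal.ofReal ((∫ x in Q, φ x ^ 2) - (∫ x in Q, φ x) ^ 2 / m) * ENNReal.ofReal m ≤
      ∫⁻ y in Q, ∫⁻ x in Q, ‖φ x - φ y‖ₑ ^ 2 := by
  have hint : ∀ {g : R3 → ℝ}, Continuous g → IntegrableOn g Q := fun {g} hg =>
    (hg.continuousOn.integrableOn_compact hQb.isCompact_closure).mono_set subset_closure
  have hvol : volume.real Q = m := by
    rw [Measure.real, hQm, ENNReal.toReal_ofReal hm.le]
  -- The mean minimises the square deviation, so every constant c bounds the variance; then c = φ y
  -- is integrated over y in Q.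
  have key : ∀ c, (∫ x in Q, φ x ^ 2) - (∫ x in Q, φ x) ^ 2 / m ≤ ∫ x in Q, (φ x - c) ^ 2 := by
    intro c
    have e : ∫ x in Q, (φ x - c) ^ 2 =
        (∫ x in Q, φ x ^ 2) - 2 * c * (∫ x in Q, φ x) + c ^ 2 * m := by
      have h1 : IntegrableOn (fun x => φ x ^ 2) Q := hint (by fun_prop)
      have h2 : IntegrableOn (fun x => 2 * c * φ x) Q := hint (by fun_prop)
      have h3 : IntegrableOn (fun _ => c ^ 2) Q := hint (by fun_prop)
      have h4 : IntegrableOn (fun x => φ x ^ 2 - 2 * c * φ x) Q := h1.sub h2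
      have e1 : ∀ x, (φ x - c) ^ 2 = φ x ^ 2 - 2 * c * φ x + c ^ 2 := fun x => by ring
      simp only [e1]
      rw [integral_add h4 h3, integral_sub h1 h2, integral_const_mul]
      simp [hvol, mul_comm]
    have e2 : (∫ x in Q, (φ x - c) ^ 2) - ((∫ x in Q, φ x ^ 2) - (∫ x in Q, φ x) ^ 2 / m) =
        ((∫ x in Q, φ x) - c * m) ^ 2 / m := by
      rw [e]; field_simp; ring
    have : 0 ≤ ((∫ x in Q, φ x) - c * m) ^ 2 / m := by positivity
    linarith
  rw [← hQm, ← setLIntegral_const]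
  refine lintegral_mono fun y => ?_
  refine (ENNReal.ofReal_le_ofReal (key (φ y))).trans (le_of_eq ?_)
  rw [ofReal_integral_eq_lintegral_ofReal (hint (by fun_prop))
    (Eventually.of_forall fun x => sq_nonneg _)]
  refine lintegral_congr fun x => ?_
  rw [← sq_abs, ENNReal.ofReal_pow (abs_nonneg _), ← Real.norm_eq_abs, ofReal_norm]

/-- The fundamental theorem of calculus along the segment, then Cauchy–Schwarz in t on an interval
of measure 1. -/
theorem enorm_sub_sq_le_lintegral_fderiv {φ : R3 → ℝ} (hφ : ContDiff ℝ ∞ φ) (x h : R3) :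
    ‖φ (x + h) - φ x‖ₑ ^ 2 ≤
      ‖h‖ₑ ^ 2 * ∫⁻ t in Ioc (0 : ℝ) 1, ‖fderiv ℝ φ (x + t • h)‖ₑ ^ 2 := by
  have hfd := hφ.continuous_fderiv (by simp)
  set g : ℝ → ℝ := fun t => fderiv ℝ φ (x + t • h) h with hg
  have hgc : Continuous g := by fun_prop
  have hd : ∀ t : ℝ, HasDerivAt (fun t => φ (x + t • h)) (g t) t := fun t => by
    have h1 : HasDerivAt (fun t : ℝ => x + t • h) h t := by
      simpa using ((hasDerivAt_id t).smul_const h).const_add x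
    exact (hφ.differentiable (by simp) (x + t • h)).hasFDerivAt.comp_hasDerivAt t h1
  have hftc := intervalIntegral.integral_eq_sub_of_hasDerivAt (a := 0) (b := 1)
    (fun t _ => hd t) (hgc.intervalIntegrable _ _)
  rw [intervalIntegral.integral_of_le zero_le_one] at hftc
  simp only [one_smul, zero_smul, add_zero] at hftc
  have hprob : IsProbabilityMeasure (volume.restrict (Ioc (0 : ℝ) 1)) := ⟨by simp⟩
  have h1 : ‖φ (x + h) - φ x‖ₑ ≤ eLpNorm g 2 (volume.restrict (Ioc (0 : ℝ) 1)) := by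
    rw [← hftc]
    refine (enorm_integral_le_lintegral_enorm _).trans ?_
    rw [← eLpNorm_one_eq_lintegral_enorm]
    exact eLpNorm_le_eLpNorm_of_exponent_le one_le_two hgc.aestronglyMeasurable
  refine (pow_le_pow_left₀ zero_le h1 2).trans ?_
  rw [eLpNorm_two_sq, ← lintegral_const_mul' _ _ (by simp)]
  refine lintegral_mono fun t => ?_
  rw [← mul_pow, mul_comm ‖h‖ₑ]
  gcongr
  exact ContinuousLinearMap.le_opENorm _ _

theorem setLIntegral_add_right_le {A B : Set R3} {v : R3} (hAB : ∀ x ∈ A, x + v ∈ B)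
    (g : R3 → ℝ≥0∞) : ∫⁻ x in A, g (x + v) ≤ ∫⁻ x in B, g x := by
  rw [← (measurePreserving_add_right volume v).setLIntegral_comp_preimage_emb
    (measurableEmbedding_addRight _) g]
  exact lintegral_mono_set hAB

/-- Integrating the segment estimate and exchanging integrals leaves, for each t, an integral over a
translate of A inside B. -/
theorem setLIntegral_enorm_sub_sq_le {A B : Set R3} {h : R3}
    (hAB : ∀ x ∈ A, ∀ t ∈ Ioc (0 : ℝ) 1, x + t • h ∈ B) {φ : R3 → ℝ} (hφ : ContDiff ℝ ∞ φ) :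
    ∫⁻ x in A, ‖φ (x + h) - φ x‖ₑ ^ 2 ≤ ‖h‖ₑ ^ 2 * ∫⁻ x in B, ‖fderiv ℝ φ x‖ₑ ^ 2 := by
  have hfd := hφ.continuous_fderiv (by simp)
  calc ∫⁻ x in A, ‖φ (x + h) - φ x‖ₑ ^ 2
      ≤ ∫⁻ x in A, ‖h‖ₑ ^ 2 * ∫⁻ t in Ioc (0 : ℝ) 1, ‖fderiv ℝ φ (x + t • h)‖ₑ ^ 2 :=
        lintegral_mono fun x => enorm_sub_sq_le_lintegral_fderiv hφ x h
    _ = ‖h‖ₑ ^ 2 * ∫⁻ t in Ioc (0 : ℝ) 1, ∫⁻ x in A, ‖fderiv ℝ φ (x + t • h)‖ₑ ^ 2 := by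
        rw [lintegral_const_mul' _ _ (by simp), lintegral_lintegral_swap]
        refine Continuous.aemeasurable ?_
        simp only [Function.uncurry_def]
        fun_prop
    _ ≤ ‖h‖ₑ ^ 2 * ∫⁻ t in Ioc (0 : ℝ) 1, ∫⁻ x in B, ‖fderiv ℝ φ x‖ₑ ^ 2 := by
        refine mul_le_mul' le_rfl (setLIntegral_mono' measurableSet_Ioc fun t ht => ?_)
        exact setLIntegral_add_right_le (g := fun y => ‖fderiv ℝ φ y‖ₑ ^ 2)
          fun x hx => hAB x hx t ht
    _ = _ := by simp

/-- A Poincaré inequality summed over the cells of a grid. -/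
theorem sum_ofReal_variance_le {s : ℝ} (hs : 0 < s) (Λ : Finset (Fin 3 → ℤ)) {B : Set R3}
    (hB : ∀ k ∈ Λ, ∀ x ∈ gridCell s k, ∀ h : R3, ‖h‖ ≤ 2 * s → x + h ∈ B) {φ : R3 → ℝ}
    (hφ : ContDiff ℝ ∞ φ) :
    ENNReal.ofReal (∑ k ∈ Λ, ((∫ x in gridCell s k, φ x ^ 2) -
      (∫ x in gridCell s k, φ x) ^ 2 / s ^ 3)) ≤
      ENNReal.ofReal (32 * s ^ 2) * ∫⁻ x in B, ‖fderiv ℝ φ x‖ₑ ^ 2 := by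
  have hφc := hφ.continuous
  set I := ∫⁻ x in B, ‖fderiv ℝ φ x‖ₑ ^ 2 with hI
  have hvol : ∀ k, volume (gridCell s k) = ENNReal.ofReal (s ^ 3) := fun k => by
    rw [volume_gridCell, ENNReal.ofReal_pow hs.le]
  have hbdd : ∀ k, Bornology.IsBounded (gridCell s k) := fun k => by
    refine Metric.isBounded_iff.2 ⟨2 * s, fun x hx y hy => ?_⟩
    rw [dist_eq_norm]
    exact norm_le_of_mem_centredCube hs.le (sub_mem_centredCube hx hy)
  have hcell : ∀ k, ENNReal.ofReal ((∫ x in gridCell s k, φ x ^ 2) -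
      (∫ x in gridCell s k, φ x) ^ 2 / s ^ 3) * ENNReal.ofReal (s ^ 3) ≤
      ∫⁻ y in gridCell s k, ∫⁻ h in centredCube s, ‖φ (y + h) - φ y‖ₑ ^ 2 := fun k => by
    refine (ofReal_variance_mul_le (by positivity) (hvol k) (hbdd k)
      hφc).trans (setLIntegral_mono' (measurableSet_gridCell s k) fun y hy => ?_)
    -- Two points of a cell differ by a vector of the centred cube; passing to h = x - y gives
    -- shifts independent of the cell.
    have h1 := setLIntegral_add_right_le (A := gridCell s k) (B := centredCube s) (v := -y)
      (fun x hx => by rw [← sub_eq_add_neg]; exact sub_mem_centredCube hx hy)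
      (fun h => ‖φ (y + h) - φ y‖ₑ ^ 2)
    simpa using h1
  have hne : ENNReal.ofReal (s ^ 3) ≠ 0 := by
    rw [Ne, ENNReal.ofReal_eq_zero, not_le]; positivity
  rw [← ENNReal.mul_le_mul_iff_left hne ENNReal.ofReal_ne_top]
  calc _ ≤ (∑ k ∈ Λ, ENNReal.ofReal ((∫ x in gridCell s k, φ x ^ 2) -
        (∫ x in gridCell s k, φ x) ^ 2 / s ^ 3)) * ENNReal.ofReal (s ^ 3) := by
        gcongr
        exact Finset.le_sum_of_subadditive _ ENNReal.ofReal_zero.le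
          (fun _ _ => ENNReal.ofReal_add_le) _ _
    _ ≤ ∑ k ∈ Λ, ∫⁻ y in gridCell s k, ∫⁻ h in centredCube s, ‖φ (y + h) - φ y‖ₑ ^ 2 := by
        rw [Finset.sum_mul]
        exact Finset.sum_le_sum fun k _ => hcell k
    _ = ∫⁻ y in ⋃ k ∈ Λ, gridCell s k, ∫⁻ h in centredCube s, ‖φ (y + h) - φ y‖ₑ ^ 2 :=
        (lintegral_biUnion_finset (pairwiseDisjoint_gridCell hs _)
          (fun k _ => measurableSet_gridCell s k) _).symm
    _ = ∫⁻ h in centredCube s, ∫⁻ y in ⋃ k ∈ Λ, gridCell s k, ‖φ (y + h) - φ y‖ₑ ^ 2 := by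
        rw [lintegral_lintegral_swap]
        refine Continuous.aemeasurable ?_
        simp only [Function.uncurry_def]
        fun_prop
    _ ≤ ∫⁻ h in centredCube s, ENNReal.ofReal (4 * s ^ 2) * I := by
        refine setLIntegral_mono' (measurableSet_centredCube s) fun h hh => ?_
        have hn := norm_le_of_mem_centredCube hs.le hh
        refine (setLIntegral_enorm_sub_sq_le (B := B) (fun x hx t ht => ?_) hφ).trans ?_
        · obtain ⟨k, hk, hxk⟩ := mem_iUnion₂.1 hx
          refine hB k hk x hxk _ ?_
          rw [norm_smul, Real.norm_of_nonneg ht.1.le]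
          exact (mul_le_of_le_one_left (norm_nonneg _) ht.2).trans hn
        · gcongr
          rw [← ofReal_norm, ← ENNReal.ofReal_pow (norm_nonneg _)]
          refine ENNReal.ofReal_le_ofReal ?_
          calc ‖h‖ ^ 2 ≤ (2 * s) ^ 2 := by gcongr
            _ = 4 * s ^ 2 := by ring
    _ = _ := by
        -- The constant 32: the factor 4 s² from ‖h‖² times the volume (2 s)³ of the cube of shifts
        -- is 32 s² · s³.
        rw [setLIntegral_const, volume_centredCube, ← ENNReal.ofReal_pow (by positivity),
          mul_right_comm, ← ENNReal.ofReal_mul (by positivity), mul_right_comm _ I,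
          ← ENNReal.ofReal_mul (by positivity)]
        congr 2
        ring

namespace Problem

variable {P : Problem}

/-- A measurable set equal to the domain up to a null set; in the periodic case its translates
tile the space. -/
def fundDomain : Problem → Set R3
  | dirichlet Ω => Ω
  | periodic => gridCell (2 * Real.pi) 0

theorem fundDomain_subset : P.fundDomain ⊆ P.domain := by
  cases P with
  | dirichlet Ω => exact subset_rfl
  | periodic =>
    intro x hx i
    have := hx i trivial
    simp only [Pi.zero_apply, Int.cast_zero, zero_mul, zero_add, one_mul] at this
    exact Ico_subset_Icc_self this

theorem fundDomain_ae_eq : P.fundDomain =ᵐ[volume] P.domain := by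
  cases P with
  | dirichlet Ω => exact Filter.EventuallyEq.rfl
  | periodic =>
    have h := Measure.univ_pi_Ico_ae_eq_Icc (μ := fun _ : Fin 3 => (volume : Measure ℝ))
      (f := fun _ => 0) (g := fun _ => 2 * Real.pi)
    have h2 := (PiLp.volume_preserving_ofLp (Fin 3)).quasiMeasurePreserving.preimage_ae_eq h
    rw [domain_periodic_eq]
    convert h2 using 2
    simp [fundDomain, gridCell]

theorem finite_gridCell_inter (hP : P.IsAdmissible) {s : ℝ} (hs : 0 < s) :
    {k | (gridCell s k ∩ P.fundDomain).Nonempty}.Finite := by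
  obtain ⟨R, hR⟩ := (isBounded_domain hP).exists_norm_le
  refine (Fintype.piFinset fun _ : Fin 3 => Finset.Icc ⌊-R / s⌋ ⌊R / s⌋).finite_toSet.subset ?_
  rintro k ⟨x, hxk, hx⟩
  rw [Finset.mem_coe, Fintype.mem_piFinset]
  intro i
  have h1 := abs_le.1 ((PiLp.norm_apply_le x i).trans (hR x (fundDomain_subset hx)))
  rw [← (mem_gridCell_iff hs).1 hxk i, Finset.mem_Icc]
  constructor
  · exact Int.floor_le_floor (by gcongr; exact h1.1)
  · exact Int.floor_le_floor (by gcongr; exact h1.2)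

/-- The side 2π / m divides the period, so no cell straddles the boundary of the fundamental cell.
This is needed because periodic functions do not vanish outside it. -/
theorem gridCell_subset_fundDomain {m : ℕ} (hm : 0 < m) {k : Fin 3 → ℤ}
    (hk : (gridCell (2 * Real.pi / m) k ∩ fundDomain periodic).Nonempty) :
    gridCell (2 * Real.pi / m) k ⊆ fundDomain periodic := by
  have hm' : (0 : ℝ) < m := by exact_mod_cast hm
  have hpi := Real.two_pi_pos
  obtain ⟨x, hxk, hx⟩ := hk
  intro y hy i _
  have h1 := hx i trivial
  have h2 := hxk i trivial
  have h3 := hy i trivial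
  simp only [Pi.zero_apply, Int.cast_zero, zero_mul, zero_add, one_mul, mem_Ico] at h1 h2 h3 ⊢
  rw [← mul_div_assoc, ← mul_div_assoc, div_le_iff₀ hm', lt_div_iff₀ hm'] at h2 h3
  have hk0 : (-1 : ℤ) < k i := by
    have : (-1 : ℝ) < k i := by
      by_contra h
      have : (k i + 1 : ℝ) * (2 * Real.pi) ≤ 0 := mul_nonpos_of_nonpos_of_nonneg (by linarith)
        hpi.le
      nlinarith
    exact_mod_cast this
  have hkm : k i < m := by
    have : (k i : ℝ) < m := by
      by_contra h
      push Not at h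
      have : (m : ℝ) * (2 * Real.pi) ≤ k i * (2 * Real.pi) := by gcongr
      nlinarith
    exact_mod_cast this
  have hk0' : (0 : ℝ) ≤ k i := by exact_mod_cast (by omega : (0 : ℤ) ≤ k i)
  have hkm' : (k i : ℝ) + 1 ≤ m := by exact_mod_cast (by omega : k i + 1 ≤ (m : ℤ))
  constructor
  · have : 0 ≤ y i * m := le_trans (by positivity) h3.1
    exact nonneg_of_mul_nonneg_left this hm'
  · have : (k i + 1 : ℝ) * (2 * Real.pi) ≤ m * (2 * Real.pi) := by gcongr
    nlinarith

/-- A quantitative Rellich theorem: apart from its means over cells of side s = 2π / m, a function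
is small in L² by a factor of order s compared with its H¹ norm. The vectors e k are cell
indicators, and only the finitely many cells meeting the domain matter. -/
theorem exists_norm_sq_embed_le (hP : P.IsAdmissible) : ∃ N : ℝ, 0 ≤ N ∧ ∀ m : ℕ, 7 ≤ m →
    ∃ (Λ : Finset (Fin 3 → ℤ)) (e : (Fin 3 → ℤ) → P.L2), ∀ w : P.H1, ‖P.embed w‖ ^ 2 ≤
      ∑ k ∈ Λ, ⟪e k, P.embed w⟫_ℝ ^ 2 / (2 * Real.pi / m) ^ 3 +
        N * (2 * Real.pi / m) ^ 2 * ‖w‖ ^ 2 := by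
  have hfin := isFiniteMeasure hP
  obtain ⟨R, hR⟩ := (isBounded_domain hP).exists_norm_le
  -- Radius R + 4: a point of a cell is within 2 s of the domain and is shifted by at most 2 s,
  -- where s ≤ 1.
  obtain ⟨N, -, hN⟩ := exists_lintegral_le_of_isBounded P
    (Metric.isBounded_closedBall (x := (0 : R3)) (r := R + 4))
  refine ⟨32 * N, by positivity, fun m hm => ?_⟩
  have hm' : (7 : ℝ) ≤ m := by exact_mod_cast hm
  have hpi := Real.two_pi_pos
  set s : ℝ := 2 * Real.pi / m with hs
  have hs0 : 0 < s := by positivity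
  -- Here m ≥ 7 > 2π is used.
  have hs1 : s ≤ 1 := by
    rw [hs, div_le_one (by linarith)]
    linarith [Real.pi_lt_d2]
  have hΛ := finite_gridCell_inter hP hs0
  refine ⟨hΛ.toFinset, fun k => indicatorConstLp 2 (measurableSet_gridCell s k)
    (measure_ne_top P.μ _) 1, fun w => ?_⟩
  refine H1_induction hP (p := fun w => ‖P.embed w‖ ^ 2 ≤
    ∑ k ∈ hΛ.toFinset, ⟪indicatorConstLp 2 (measurableSet_gridCell s k)
      (measure_ne_top P.μ _) (1 : ℝ), P.embed w⟫_ℝ ^ 2 / s ^ 3 + 32 * N * s ^ 2 * ‖w‖ ^ 2)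
    (isClosed_le (by fun_prop) (by fun_prop)) (fun φ hφ => ?_) w
  have hφc := hφ.contDiff.continuous
  have hnonempty : ∀ k ∈ hΛ.toFinset, (gridCell s k ∩ P.fundDomain).Nonempty := fun k hk => by
    simpa using hk
  have hbdd : ∀ k, Bornology.IsBounded (gridCell s k) := fun k => by
    refine Metric.isBounded_iff.2 ⟨2 * s, fun x hx y hy => ?_⟩
    rw [dist_eq_norm]
    exact norm_le_of_mem_centredCube hs0.le (sub_mem_centredCube hx hy)
  have hint : ∀ {g : R3 → ℝ} {Q : Set R3}, Continuous g → Bornology.IsBounded Q →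
      IntegrableOn g Q := fun {g Q} hg hQ =>
    (hg.continuousOn.integrableOn_compact hQ.isCompact_closure).mono_set subset_closure
  have hmean : ∀ k ∈ hΛ.toFinset, ⟪indicatorConstLp 2 (measurableSet_gridCell s k)
      (measure_ne_top P.μ _) (1 : ℝ), P.embed (testElement hP hφ)⟫_ℝ =
      ∫ x in gridCell s k, φ x := fun k hk => by
    rw [L2.inner_indicatorConstLp_one]
    have e1 : ∫ x in gridCell s k, P.embed (testElement hP hφ) x ∂P.μ =
        ∫ x in gridCell s k, φ x ∂P.μ :=
      integral_congr_ae (ae_restrict_of_ae (toL2_testElement hP hφ))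
    rw [e1, μ, Measure.restrict_restrict (measurableSet_gridCell s k)]
    have hk' := hnonempty k hk
    have hφ' := hφ.isExtended
    clear e1
    cases P with
    | dirichlet Ω =>
      -- Cells may stick out of Ω, but φ vanishes there, so the mean over the full cell is the same.
      rw [inter_comm, ← Measure.restrict_restrict (measurableSet_domain hP)]
      exact setIntegral_eq_integral_of_forall_compl_eq_zero hφ'
    | periodic =>
      rw [inter_eq_left.2 ((gridCell_subset_fundDomain (by omega) hk').trans fundDomain_subset)]
  have hnorm : ‖P.embed (testElement hP hφ)‖ ^ 2 ≤
      ∑ k ∈ hΛ.toFinset, ∫ x in gridCell s k, φ x ^ 2 := by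
    rw [L2_norm_sq_eq_integral]
    have e1 : ∫ x, P.embed (testElement hP hφ) x ^ 2 ∂P.μ = ∫ x in P.fundDomain, φ x ^ 2 := by
      rw [Measure.restrict_congr_set fundDomain_ae_eq]
      refine integral_congr_ae ?_
      filter_upwards [toL2_testElement hP hφ] with x hx
      rw [embed_apply, hx]
    rw [e1, ← integral_biUnion_finset _ (fun k _ => measurableSet_gridCell s k)
      (pairwiseDisjoint_gridCell hs0 _) (fun k _ => hint (by fun_prop) (hbdd k))]
    refine setIntegral_mono_set (hint (by fun_prop) ?_) (Eventually.of_forall fun x => sq_nonneg _)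
      (LE.le.eventuallyLE fun x hx => ?_)
    · exact (Bornology.isBounded_biUnion_finset _).2 fun k _ => hbdd k
    · have hxk : x ∈ gridCell s fun i => ⌊x i / s⌋ := (mem_gridCell_iff hs0).2 fun i => rfl
      exact mem_iUnion₂.2 ⟨_, hΛ.mem_toFinset.2 ⟨x, hxk, hx⟩, hxk⟩
  have hosc : ∑ k ∈ hΛ.toFinset, ((∫ x in gridCell s k, φ x ^ 2) -
      (∫ x in gridCell s k, φ x) ^ 2 / s ^ 3) ≤
      32 * N * s ^ 2 * ‖testElement hP hφ‖ ^ 2 := by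
    refine (ENNReal.ofReal_le_ofReal_iff (by positivity)).1 ?_
    refine (sum_ofReal_variance_le hs0 _ (B := Metric.closedBall 0 (R + 4))
      (fun k hk x hx h hh => ?_) hφ.contDiff).trans ?_
    · obtain ⟨y, hyk, hy⟩ := hnonempty k hk
      have h1 := norm_le_of_mem_centredCube hs0.le (sub_mem_centredCube hx hyk)
      have h2 := hR y (fundDomain_subset hy)
      rw [mem_closedBall_zero_iff]
      have h3 : x + h = y + (x - y) + h := by abel
      rw [h3]
      refine (norm_add₃_le).trans ?_
      linarith
    · have h1 := hN (fun x => ‖fderiv ℝ φ x‖ₑ ^ 2) (hφ.isExtended_fderiv.comp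
        (g := fun y => ‖y‖ₑ ^ 2) (by
          rw [← ofReal_norm, norm_zero, ENNReal.ofReal_zero]; simp))
      rw [lintegral_fderiv_sq_testElement hP hφ] at h1
      have h2 : ‖P.gradL (testElement hP hφ)‖ₑ ^ 2 ≤ ‖testElement hP hφ‖ₑ ^ 2 := by
        rw [enorm_sq_H1_eq]; exact le_self_add
      calc _ ≤ ENNReal.ofReal (32 * s ^ 2) * (N * ‖testElement hP hφ‖ₑ ^ 2) := by
            gcongr
            exact h1.trans (by gcongr)
        _ = _ := by
            rw [← ofReal_norm, ← ENNReal.ofReal_pow (norm_nonneg _), ← ENNReal.ofReal_natCast,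
              ← ENNReal.ofReal_mul (by positivity), ← ENNReal.ofReal_mul (by positivity)]
            congr 1
            ring
  rw [Finset.sum_sub_distrib] at hosc
  have hsum : ∑ k ∈ hΛ.toFinset, ⟪indicatorConstLp 2 (measurableSet_gridCell s k)
      (measure_ne_top P.μ _) (1 : ℝ), P.embed (testElement hP hφ)⟫_ℝ ^ 2 / s ^ 3 =
      ∑ k ∈ hΛ.toFinset, (∫ x in gridCell s k, φ x) ^ 2 / s ^ 3 :=
    Finset.sum_congr rfl fun k hk => by rw [hmean k hk]
  rw [hsum]
  linarith

/-- Rellich's theorem. -/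
theorem isCompactOperator_embed (hP : P.IsAdmissible) : IsCompactOperator P.embed := by
  classical
  obtain ⟨N, hN0, hN⟩ := exists_norm_sq_embed_le hP
  refine isCompactOperator_of_forall_exists_finset fun ε hε => ?_
  have hlim : Tendsto (fun m : ℕ => N * (2 * Real.pi / m) ^ 2) atTop (𝓝 0) := by
    simpa using ((tendsto_const_div_atTop_nhds_zero_nat (2 * Real.pi)).pow 2).const_mul N
  obtain ⟨m, hm7, hm⟩ := ((eventually_ge_atTop 7).and
    (hlim.eventually_lt_const (by positivity : 0 < ε ^ 2))).exists
  obtain ⟨Λ, e, h⟩ := hN m hm7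
  refine ⟨Λ.image e, fun w hw => ?_⟩
  refine le_of_sq_le_sq ((h w).trans ?_) (by positivity)
  rw [Finset.sum_eq_zero fun k hk => by rw [hw _ (Finset.mem_image_of_mem e hk)]; simp, zero_add,
    mul_pow]
  gcongr

/-! ### Density of H¹ in L² -/

theorem interior_domain_periodic_subset : interior (domain periodic) ⊆ fundDomain periodic := by
  have h : interior (domain periodic) = (PiLp.homeomorph 2 fun _ : Fin 3 => ℝ) ⁻¹'
      univ.pi fun _ => Ioo 0 (2 * Real.pi) := by
    have h1 : interior (univ.pi fun _ : Fin 3 => Icc (0 : ℝ) (2 * Real.pi)) =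
        univ.pi fun _ => Ioo 0 (2 * Real.pi) := by
      rw [interior_pi_set finite_univ]; simp
    rw [← h1, Homeomorph.preimage_interior, domain_periodic_eq, ← pi_univ_Icc]
    rfl
  rw [h]
  intro x hx i _
  have := hx i trivial
  simp only [Pi.zero_apply, Int.cast_zero, zero_mul, zero_add, one_mul]
  exact Ioo_subset_Ico_self this

theorem latticeVector_add (m l : Fin 3 → ℤ) :
    latticeVector (m + l) = latticeVector m + latticeVector l := by
  refine PiLp.ext fun i => ?_
  simp [latticeVector, mul_add]

theorem latticeVector_single (i : Fin 3) :
    latticeVector (Pi.single i 1) = EuclideanSpace.single i (2 * Real.pi) := by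
  refine PiLp.ext fun j => ?_
  by_cases h : j = i
  · subst h; simp [latticeVector]
  · simp [latticeVector, h]

/-- Any smooth function with compact support in the interior of the domain coincides on the domain
with a test function; in the periodic case this is its periodisation. -/
theorem exists_isTest_ae_eq (hP : P.IsAdmissible) {ψ : R3 → ℝ} (hψ : ContDiff ℝ ∞ ψ)
    (hc : HasCompactSupport ψ) (hsupp : tsupport ψ ⊆ interior P.domain) :
    ∃ φ, P.IsTest φ ∧ φ =ᵐ[P.μ] ψ := by
  cases P with
  | dirichlet Ω => exact ⟨ψ, ⟨hψ, hc, hsupp.trans interior_subset⟩, Filter.EventuallyEq.rfl⟩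
  | periodic =>
    refine ⟨fun x => ∑' m : Fin 3 → ℤ, ψ (x + latticeVector m), ⟨?_, fun i x => ?_⟩, ?_⟩
    · refine contDiff_iff_contDiffAt.2 fun x => ?_
      obtain ⟨R, hR⟩ := hc.isCompact.isBounded.exists_norm_le
      -- Near x only finitely many translates of the compact support occur, so the periodisation is
      -- locally a finite sum of smooth functions.
      have hfin : {m : Fin 3 → ℤ | ∃ y ∈ Metric.ball x 1, y + latticeVector m ∈ tsupport ψ}.Finite := by
        obtain ⟨M, hM⟩ := exists_nat_gt (R + ‖x‖ + 1)
        refine (Fintype.piFinset fun _ : Fin 3 => Finset.Icc (-M : ℤ) M).finite_toSet.subset ?_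
        rintro m ⟨y, hy, hym⟩
        rw [Finset.mem_coe, Fintype.mem_piFinset]
        intro i
        have h1 : ‖latticeVector m‖ ≤ R + ‖x‖ + 1 := by
          have e : latticeVector m = (y + latticeVector m) - (y - x) - x := by abel
          rw [e]
          refine (norm_sub_le _ _).trans ?_
          have h2 := norm_sub_le (y + latticeVector m) (y - x)
          have h3 := hR _ hym
          rw [Metric.mem_ball, dist_eq_norm] at hy
          linarith
        have h2 : |2 * Real.pi * m i| ≤ R + ‖x‖ + 1 :=
          (PiLp.norm_apply_le (latticeVector m) i).trans h1
        rw [abs_mul, abs_of_pos Real.two_pi_pos] at h2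
        have h3 : |(m i : ℝ)| ≤ M := by
          nlinarith [Real.pi_gt_three, abs_nonneg (m i : ℝ)]
        rw [abs_le] at h3
        rw [Finset.mem_Icc]
        exact ⟨by exact_mod_cast h3.1, by exact_mod_cast h3.2⟩
      have hsum : ContDiffAt ℝ ∞ (fun y => ∑ m ∈ hfin.toFinset, ψ (y + latticeVector m)) x :=
        ContDiffAt.sum fun m _ => (hψ.comp (contDiff_id.add contDiff_const)).contDiffAt
      refine hsum.congr_of_eventuallyEq ?_
      filter_upwards [Metric.ball_mem_nhds x one_pos] with y hy
      refine tsum_eq_sum fun m hm => ?_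
      by_contra hne
      exact hm (hfin.mem_toFinset.2 ⟨y, hy, subset_tsupport _ hne⟩)
    · simp only
      rw [← (Equiv.addRight (Pi.single i 1)).tsum_eq (fun m => ψ (x + latticeVector m))]
      refine tsum_congr fun m => ?_
      rw [Equiv.coe_addRight, latticeVector_add, latticeVector_single]
      congr 1
      abel
    · have h1 : ∀ᵐ x ∂(volume.restrict (fundDomain periodic)), x ∈ fundDomain periodic :=
        ae_restrict_mem (measurableSet_gridCell _ _)
      rw [Measure.restrict_congr_set fundDomain_ae_eq] at h1
      filter_upwards [h1] with x hx
      -- Distinct lattice translates of the half-open cell are disjoint, so on the cell only the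
      -- term m = 0 survives.
      rw [tsum_eq_single 0 fun m hm => ?_]
      · congr 1
        refine PiLp.ext fun i => ?_
        simp [latticeVector]
      · by_contra hne
        refine hm (funext fun i => ?_)
        have h2 : x + latticeVector m ∈ fundDomain periodic :=
          interior_domain_periodic_subset (hsupp (subset_tsupport _ hne))
        have h3 := (mem_gridCell_iff Real.two_pi_pos).1 h2 i
        have h4 := (mem_gridCell_iff Real.two_pi_pos).1 hx i
        have e : (x + latticeVector m) i / (2 * Real.pi) = x i / (2 * Real.pi) + m i := by
          simp only [latticeVector, PiLp.add_apply]
          field_simp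
        rw [e, Int.floor_add_intCast, h4] at h3
        simpa using h3

/-- A vector orthogonal to the range annihilates all test functions, hence all bumps in the
interior, since each agrees almost everywhere on the domain with a test function. -/
theorem denseRange_embed (hP : P.IsAdmissible) : DenseRange P.embed := by
  have h : (LinearMap.range P.embed.toLinearMap).topologicalClosure = ⊤ := by
    rw [Submodule.topologicalClosure_eq_top_iff, Submodule.eq_bot_iff]
    intro u hu
    refine L2_eq_zero_of_integral hP u fun ψ h1 h2 h3 => ?_
    obtain ⟨φ, hφ, hae⟩ := exists_isTest_ae_eq hP h1 h2 h3
    have := hu (P.embed (testElement hP hφ)) ⟨_, rfl⟩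
    rw [L2_inner_eq_integral] at this
    rw [← this]
    refine integral_congr_ae ?_
    filter_upwards [toL2_testElement hP hφ, hae] with x e1 e2
    rw [embed_apply, e1, e2, smul_eq_mul]
  have h2 := congrArg (fun K : Submodule ℝ P.L2 => (K : Set P.L2)) h
  simp only [Submodule.topologicalClosure_coe, Submodule.top_coe] at h2
  exact dense_iff_closure_eq.2 h2

theorem isCompactEmbedding_embed (hP : P.IsAdmissible) : IsCompactEmbedding P.embed :=
  ⟨isCompactOperator_embed hP, injective_embed hP, denseRange_embed hP, norm_embed_le⟩

end Problem

/-! ### Identification of the abstract spectral objects with those of the Laplacian -/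

namespace Problem

variable {P : Problem}

theorem inner_smul_left_H1 (c : ℝ) (w z : P.H1) : ⟪c • w, z⟫_ℝ = c * ⟪w, z⟫_ℝ :=
  real_inner_smul_left w z c

/-- Adding the L² product to the weak eigenvalue equation turns it into ⟪w, z⟫ = (1 + l) ⟪ι w, ι z⟫
with the H¹ product on the left, that is w = (1 + l) ι* ι w. For l = -1 both sides reduce to e = 0.
-/
theorem mem_specSpace_embed_iff (hP : P.IsAdmissible) {l : ℝ} {e : P.L2} :
    e ∈ specSpace P.embed l ↔ ∃ w : P.H1, H1.toL2 w = e ∧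
      ∀ z : P.H1, ⟪H1.grad w, H1.grad z⟫_ℝ = l * ⟪H1.toL2 w, H1.toL2 z⟫_ℝ := by
  have hι := isCompactEmbedding_embed hP
  rw [mem_specSpace]
  constructor
  · intro h
    by_cases hl : 1 + l = 0
    · rw [hl, inv_zero, zero_smul] at h
      have he : e = 0 := hι.greenOp_injective (h.trans (map_zero _).symm)
      refine ⟨0, by rw [he]; exact map_zero P.embed, fun z => ?_⟩
      have h1 : H1.grad (0 : P.H1) = 0 := map_zero P.gradL
      have h2 : H1.toL2 (0 : P.H1) = 0 := map_zero P.embed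
      rw [h1, h2, inner_zero_left, inner_zero_left, mul_zero]
    · have hw : P.embed ((1 + l) • P.embed.adjoint e) = e := by
        rw [map_smul]
        change (1 + l) • greenOp P.embed e = e
        rw [h, smul_smul, mul_inv_cancel₀ hl, one_smul]
      refine ⟨(1 + l) • P.embed.adjoint e, hw, fun z => ?_⟩
      have h1 := inner_H1_eq ((1 + l) • P.embed.adjoint e) z
      rw [inner_smul_left_H1, ContinuousLinearMap.adjoint_inner_left, hw] at h1
      rw [← embed_apply, ← embed_apply, hw]
      rw [gradL_apply, gradL_apply] at h1
      linarith
  · rintro ⟨w, rfl, hw⟩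
    have h1 : w = (1 + l) • P.embed.adjoint (P.embed w) := by
      refine ext_inner_right ℝ fun z => ?_
      rw [inner_smul_left_H1, ContinuousLinearMap.adjoint_inner_left, inner_H1_eq, gradL_apply,
        gradL_apply, hw z, embed_apply, embed_apply]
      ring
    have h2 : P.embed w = (1 + l) • greenOp P.embed (P.embed w) := by
      conv_lhs => rw [h1]
      rw [map_smul]; rfl
    by_cases hl : 1 + l = 0
    · rw [hl, zero_smul] at h2
      rw [← embed_apply, h2, map_zero, smul_zero]
    · rw [← embed_apply]
      conv_rhs => rw [h2]
      rw [smul_smul, inv_mul_cancel₀ hl, one_smul]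

theorem eigenspace_eq (hP : P.IsAdmissible) (l : ℝ) : P.eigenspace l = specSpace P.embed l := by
  have h : {e : P.L2 | ∃ w : P.H1, H1.toL2 w = e ∧
      ∀ z : P.H1, ⟪H1.grad w, H1.grad z⟫_ℝ = l * ⟪H1.toL2 w, H1.toL2 z⟫_ℝ} =
      (specSpace P.embed l : Set P.L2) :=
    Set.ext fun e => (mem_specSpace_embed_iff hP).symm
  rw [eigenspace, h, Submodule.span_eq]
  exact (isClosed_specSpace P.embed l).submodule_topologicalClosure_eq

theorem eigenproj_eq (hP : P.IsAdmissible) (l : ℝ) : P.eigenproj l = specProj P.embed l := by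
  have h := eigenspace_eq hP l
  unfold eigenproj specProj
  congr 1

theorem hsNormSq_eq (hP : P.IsAdmissible) (s : ℝ) (w : P.L2) :
    P.hsNormSq s w = specNormSq P.embed s w := by
  simp only [hsNormSq, specNormSq, eigenproj_eq hP]

theorem fracLap_half_eq (hP : P.IsAdmissible) (w : P.L2) :
    P.fracLap (1 / 2) w = ∑' l : ℝ, √l • specProj P.embed l w := by
  simp only [fracLap, eigenproj_eq hP, Real.sqrt_eq_rpow]

theorem classL2_eq_embed (hP : P.IsAdmissible) {φ : R3 → ℝ} (hφ : P.IsTest φ) :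
    P.classL2 φ = P.embed (testElement hP hφ) := by
  rw [classL2, dif_pos (memLp_of_continuous hP hφ.contDiff.continuous 2)]
  rfl

/-! ### Space-time test functions as paths in H¹ -/

section SpaceTime

variable {T : ℝ} {φ : ℝ × R3 → ℝ}

theorem IsSpaceTimeTest.contDiff (hφ : P.IsSpaceTimeTest T φ) : ContDiff ℝ ∞ φ := by
  cases P <;> exact hφ.1

theorem IsSpaceTimeTest.isTest (hφ : P.IsSpaceTimeTest T φ) (t : ℝ) :
    P.IsTest fun x => φ (t, x) := by
  have hs : ContDiff ℝ ∞ fun x => φ (t, x) := hφ.contDiff.comp (by fun_prop)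
  cases P with
  | dirichlet Ω =>
    have h1 : tsupport (fun x => φ (t, x)) ⊆ (fun x => (t, x)) ⁻¹' tsupport φ :=
      closure_minimal (fun x hx => subset_tsupport φ hx)
        ((isClosed_tsupport φ).preimage (by fun_prop))
    refine ⟨hs, ?_, fun x hx => (hφ.2.2 (h1 hx)).2⟩
    exact (hφ.2.1.image continuous_snd).of_isClosed_subset (isClosed_tsupport _)
      fun x hx => ⟨(t, x), h1 hx, rfl⟩
  | periodic => exact ⟨hs, hφ.2.1 t⟩

theorem IsSpaceTimeTest.eq_zero (hφ : P.IsSpaceTimeTest T φ) {t : ℝ} (ht : t ∉ Ioo 0 T) (x : R3) :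
    φ (t, x) = 0 := by
  cases P with
  | dirichlet Ω => exact image_eq_zero_of_notMem_tsupport fun h => ht (hφ.2.2 h).1
  | periodic =>
    obtain ⟨a, b, ha, hb, h⟩ := hφ.2.2
    exact h t x fun h' => ht ⟨ha.trans_le h'.1, h'.2.trans_lt hb⟩

theorem hasDerivAt_slice (hφ : ContDiff ℝ ∞ φ) (t : ℝ) (x : R3) :
    HasDerivAt (fun s => φ (s, x)) (fderiv ℝ φ (t, x) (1, 0)) t := by
  have h1 : HasDerivAt (fun s : ℝ => (s, x)) ((1 : ℝ), (0 : R3)) t :=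
    (hasDerivAt_id t).prodMk (hasDerivAt_const t x)
  exact (hφ.differentiable (by simp) (t, x)).hasFDerivAt.comp_hasDerivAt t h1

theorem continuous_time_deriv (hφ : ContDiff ℝ ∞ φ) :
    Continuous fun z : ℝ × R3 => fderiv ℝ φ z (1, 0) :=
  (hφ.continuous_fderiv (by simp)).clm_apply continuous_const

theorem gradient_slice (hφ : ContDiff ℝ ∞ φ) (t : ℝ) (x : R3) :
    ‖gradient (fun y => φ (t, y)) x‖ ≤ ‖fderiv ℝ φ (t, x)‖ := by
  rw [norm_gradient_eq]
  have h1 : HasFDerivAt (fun y : R3 => (t, y)) (ContinuousLinearMap.inr ℝ ℝ R3) x :=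
    hasFDerivAt_prodMk_right t x
  have h2 := (hφ.differentiable (by simp) (t, x)).hasFDerivAt.comp x h1
  have h3 : fderiv ℝ (fun y => φ (t, y)) x = (fderiv ℝ φ (t, x)).comp
    (ContinuousLinearMap.inr ℝ ℝ R3) := h2.fderiv
  rw [h3]
  exact (ContinuousLinearMap.opNorm_comp_le _ _).trans
    (mul_le_of_le_one_right (norm_nonneg _) (ContinuousLinearMap.norm_inr_le_one ℝ ℝ R3))

theorem eventually_forall_abs_sub_le {k : ℝ × R3 → ℝ} (hk : Continuous k) {K : Set R3}
    (hK : IsCompact K) (t : ℝ) {ε : ℝ} (hε : 0 < ε) :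
    ∀ᶠ s in 𝓝 t, ∀ x ∈ K, |k (s, x) - k (t, x)| ≤ ε := by
  refine hK.eventually_forall_of_forall_eventually (x₀ := t)
    (P := fun s x => |k (s, x) - k (t, x)| ≤ ε) fun x _ => ?_
  have h1 : ContinuousAt (fun z : ℝ × R3 => |k (z.1, z.2) - k (t, z.2)|) (t, x) := by fun_prop
  have h2 := h1.tendsto.eventually_lt_const (u := ε) (by simpa using hε)
  exact h2.mono fun z hz => hz.le

/-- The mean value inequality for φ minus its linear part in time, the time derivative being close
to its value at t uniformly on the compact set K. -/
theorem eventually_forall_abs_sub_linear_le (hφ : ContDiff ℝ ∞ φ) {K : Set R3}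
    (hK : IsCompact K) (t : ℝ) {ε : ℝ} (hε : 0 < ε) :
    ∀ᶠ s in 𝓝 t, ∀ x ∈ K,
      |φ (s, x) - φ (t, x) - (s - t) * fderiv ℝ φ (t, x) (1, 0)| ≤ ε * |s - t| := by
  obtain ⟨δ, hδ, h⟩ := Metric.eventually_nhds_iff_ball.1
    (eventually_forall_abs_sub_le (continuous_time_deriv hφ) hK t hε)
  refine Metric.eventually_nhds_iff_ball.2 ⟨δ, hδ, fun s hs x hx => ?_⟩
  have hd : ∀ r, HasDerivAt (fun r => φ (r, x) - r * fderiv ℝ φ (t, x) (1, 0))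
      (fderiv ℝ φ (r, x) (1, 0) - fderiv ℝ φ (t, x) (1, 0)) r := fun r =>
    HasDerivAt.congr_deriv ((hasDerivAt_slice hφ r x).sub
      ((hasDerivAt_id' r).mul_const (fderiv ℝ φ (t, x) (1, 0)))) (by ring)
  have := (convex_ball t δ).norm_image_sub_le_of_norm_hasDerivWithin_le
    (fun r _ => (hd r).hasDerivWithinAt) (fun r hr => h r hr x hx) (Metric.mem_ball_self hδ) hs
  rw [Real.norm_eq_abs, Real.norm_eq_abs] at this
  convert this using 2
  ring

/-- The path in `H¹` given by a space-time test function. -/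
def testPath (hP : P.IsAdmissible) (hφ : P.IsSpaceTimeTest T φ) (t : ℝ) : P.H1 :=
  testElement hP (hφ.isTest t)

theorem continuous_time_deriv_slice (hφ : ContDiff ℝ ∞ φ) (t : ℝ) :
    Continuous fun x : R3 => fderiv ℝ φ (t, x) (1, 0) :=
  (continuous_time_deriv hφ).comp (by fun_prop)

/-- The time derivative of a space-time test function, as a path in `L²`. -/
def testVelocity (hP : P.IsAdmissible) (hφ : P.IsSpaceTimeTest T φ) (t : ℝ) : P.L2 :=
  (memLp_of_continuous hP (continuous_time_deriv_slice hφ.contDiff t) 2).toLp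
    fun x => fderiv ℝ φ (t, x) (1, 0)

theorem coeFn_testVelocity (hP : P.IsAdmissible) (hφ : P.IsSpaceTimeTest T φ) (t : ℝ) :
    testVelocity hP hφ t =ᵐ[P.μ] fun x => fderiv ℝ φ (t, x) (1, 0) :=
  (memLp_of_continuous hP (continuous_time_deriv_slice hφ.contDiff t) 2).coeFn_toLp

theorem exists_norm_L2_le (hP : P.IsAdmissible) : ∃ c : ℝ, 0 < c ∧
    ∀ {E : Type} [NormedAddCommGroup E] (u : Lp E 2 P.μ) (C : ℝ), 0 ≤ C →
      (∀ᵐ x ∂P.μ, ‖u x‖ ≤ C) → ‖u‖ ≤ c * C := by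
  have := isFiniteMeasure hP
  refine ⟨P.μ.real univ ^ (2 : ℝ)⁻¹ + 1, by positivity, fun {E} _ u C hC hu => ?_⟩
  have h := Lp.norm_le_of_ae_bound hC hu
  refine h.trans ?_
  simp only [ENNReal.toReal_ofNat]
  gcongr
  have : (↑(measureUnivNNReal P.μ) : ℝ) = P.μ.real univ := rfl
  rw [← this]
  linarith

/-- On the compact closure of the domain the difference quotients converge uniformly, hence in L².
The H¹ bound needs only suprema of φ and its differential, and differentiability is required only in
L², so gradients need not be differentiated in time. -/
theorem isTestPath_testPath (hP : P.IsAdmissible) (hφ : P.IsSpaceTimeTest T φ) :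
    IsTestPath P.embed T (testPath hP hφ) (testVelocity hP hφ) := by
  obtain ⟨c, hc, hcL⟩ := exists_norm_L2_le hP
  set K := closure P.domain with hK
  have hKc : IsCompact K := (isBounded_domain hP).isCompact_closure
  have hmem : ∀ᵐ x ∂P.μ, x ∈ K := by
    filter_upwards [ae_restrict_mem (measurableSet_domain hP)] with x hx
    exact subset_closure hx
  have hsm := hφ.contDiff
  have hzero : ∀ t ∉ Ioo 0 T, testPath hP hφ t = 0 := fun t ht => by
    refine injective_embed hP ?_
    rw [map_zero]
    refine (Lp.eq_zero_iff_ae_eq_zero).2 ((toL2_testElement hP (hφ.isTest t)).trans ?_)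
    exact Eventually.of_forall fun x => hφ.eq_zero ht x
  refine ⟨?_, fun t _ => ?_, ?_, hzero 0 (by simp), hzero T (by simp)⟩
  · obtain ⟨C₁, hC₁⟩ := ((isCompact_Icc (a := 0) (b := T)).prod hKc).exists_bound_of_continuousOn
      hsm.continuous.continuousOn
    obtain ⟨C₂, hC₂⟩ := ((isCompact_Icc (a := 0) (b := T)).prod hKc).exists_bound_of_continuousOn
      (hsm.continuous_fderiv (by simp)).continuousOn
    refine ⟨c * |C₁| + c * |C₂|, fun t ht => ?_⟩
    have h1 : ‖P.embed (testPath hP hφ t)‖ ≤ c * |C₁| := by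
      refine hcL _ _ (abs_nonneg _) ?_
      filter_upwards [toL2_testElement hP (hφ.isTest t), hmem] with x hx hxK
      rw [testPath, embed_apply, hx]
      exact (hC₁ (t, x) ⟨ht, hxK⟩).trans (le_abs_self _)
    have h2 : ‖P.gradL (testPath hP hφ t)‖ ≤ c * |C₂| := by
      refine hcL _ _ (abs_nonneg _) ?_
      filter_upwards [grad_testElement hP (hφ.isTest t), hmem] with x hx hxK
      rw [testPath, gradL_apply, hx]
      exact (gradient_slice hsm t x).trans ((hC₂ (t, x) ⟨ht, hxK⟩).trans (le_abs_self _))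
    refine le_of_sq_le_sq ?_ (by positivity)
    rw [norm_sq_H1_eq]
    nlinarith [norm_nonneg (P.embed (testPath hP hφ t)), norm_nonneg (P.gradL (testPath hP hφ t))]
  · rw [hasDerivAt_iff_isLittleO, Asymptotics.isLittleO_iff]
    intro ε hε
    filter_upwards [eventually_forall_abs_sub_linear_le hsm hKc t (by positivity : 0 < ε / c)]
      with s hs
    have h1 : ‖P.embed (testPath hP hφ s) - P.embed (testPath hP hφ t) -
        (s - t) • testVelocity hP hφ t‖ ≤ c * (ε / c * |s - t|) := by
      refine hcL _ _ (by positivity) ?_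
      filter_upwards [toL2_testElement hP (hφ.isTest s), toL2_testElement hP (hφ.isTest t),
        coeFn_testVelocity hP hφ t, hmem,
        Lp.coeFn_sub (P.embed (testPath hP hφ s)) (P.embed (testPath hP hφ t)),
        Lp.coeFn_sub (P.embed (testPath hP hφ s) - P.embed (testPath hP hφ t))
          ((s - t) • testVelocity hP hφ t),
        Lp.coeFn_smul (s - t) (testVelocity hP hφ t)] with x e1 e2 e3 hx e4 e5 e6
      rw [e5, Pi.sub_apply, e4, Pi.sub_apply, e6, Pi.smul_apply, e3, testPath, testPath,
        embed_apply, embed_apply, e1, e2]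
      exact hs x hx
    refine h1.trans (le_of_eq ?_)
    rw [Real.norm_eq_abs]
    field_simp
  · refine Continuous.continuousOn (continuous_iff_continuousAt.2 fun t => ?_)
    rw [ContinuousAt, Metric.tendsto_nhds]
    intro ε hε
    filter_upwards [eventually_forall_abs_sub_le (continuous_time_deriv hsm) hKc t
      (by positivity : 0 < ε / 2 / c)] with s hs
    rw [dist_eq_norm]
    have h1 : ‖testVelocity hP hφ s - testVelocity hP hφ t‖ ≤ c * (ε / 2 / c) := by
      refine hcL _ _ (by positivity) ?_
      filter_upwards [coeFn_testVelocity hP hφ s, coeFn_testVelocity hP hφ t, hmem,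
        Lp.coeFn_sub (testVelocity hP hφ s) (testVelocity hP hφ t)] with x e1 e2 hx e3
      rw [e3, Pi.sub_apply, e1, e2]
      exact hs x hx
    refine h1.trans_lt ?_
    rw [mul_div_cancel₀ _ hc.ne']
    linarith

theorem inner_testVelocity (hP : P.IsAdmissible) (hφ : P.IsSpaceTimeTest T φ) (u : P.L2) (t : ℝ) :
    ∫ x in P.domain, u x * deriv (fun s => φ (s, x)) t = ⟪u, testVelocity hP hφ t⟫_ℝ := by
  rw [L2_inner_eq_integral]
  refine integral_congr_ae ?_
  filter_upwards [coeFn_testVelocity hP hφ t] with x hx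
  rw [hx, (hasDerivAt_slice hφ.contDiff t x).deriv]

theorem inner_embed_testPath (hP : P.IsAdmissible) (hφ : P.IsSpaceTimeTest T φ) (u : P.L2)
    (t : ℝ) : ∫ x in P.domain, u x * φ (t, x) = ⟪u, P.embed (testPath hP hφ t)⟫_ℝ := by
  rw [L2_inner_eq_integral]
  refine integral_congr_ae ?_
  filter_upwards [toL2_testElement hP (hφ.isTest t)] with x hx
  rw [testPath, embed_apply, hx]

theorem inner_gradL_testPath (hP : P.IsAdmissible) (hφ : P.IsSpaceTimeTest T φ) (w : P.H1)
    (t : ℝ) : ∫ x in P.domain, ⟪(H1.grad w) x, gradient (fun y => φ (t, y)) x⟫_ℝ =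
      ⟪w, testPath hP hφ t⟫_ℝ - ⟪P.embed w, P.embed (testPath hP hφ t)⟫_ℝ := by
  rw [inner_H1_eq, add_sub_cancel_left, L2.inner_def]
  refine integral_congr_ae ?_
  filter_upwards [grad_testElement hP (hφ.isTest t)] with x hx
  rw [testPath, gradL_apply, gradL_apply, hx]

end SpaceTime

end Problem

/-! ### From abstract limit solutions to weak energy solutions -/

section Measurability

variable {V H : Type} [NormedAddCommGroup V] [InnerProductSpace ℝ V] [CompleteSpace V]
  [NormedAddCommGroup H] [InnerProductSpace ℝ H] [CompleteSpace H] {ι : V →L[ℝ] H}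

/-- Paths that are continuous in weak norms are strongly measurable. -/
theorem IsLimitSolution.aestronglyMeasurable [TopologicalSpace.SeparableSpace H]
    (hι : IsCompactEmbedding ι) {γ α : ℝ} {B : V → V → ℝ} {g : H} {u₀ : V} {u₁ : H} {U : ℝ → V}
    {v : ℝ → H} (h : IsLimitSolution ι γ α B g u₀ u₁ U v) (T : ℝ) :
    AEStronglyMeasurable U (volume.restrict (Ioo 0 T)) ∧
      AEStronglyMeasurable v (volume.restrict (Ioo 0 T)) := by
  obtain ⟨s, hs, hsum⟩ := hι.exists_exhaustion
  have hsub : Ioo 0 T ⊆ Ici 0 := fun t ht => ht.1.le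
  constructor
  · refine aestronglyMeasurable_of_tendsto_ae atTop (f := fun n t => specLiftSum ι (s n) (ι (U t)))
      (fun n => ?_) (Eventually.of_forall fun t => ?_)
    · exact ((specLiftSum ι (s n)).continuous.comp_continuousOn
        (h.continuousOn_map.mono hsub)).aestronglyMeasurable measurableSet_Ioo
    · have := hsum (fun l => specLift ι l (ι (U t))) (U t)
        (fun l hl => specLift_eq_zero_of_specSpace_eq_bot hl _) (hι.hasSum_specLift (U t))
      simpa only [specLiftSum_apply] using this
  -- Only `greenOp ι (v t)` is continuous in norm; the multiplier 1 + l recovers from it the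
  -- spectral components of v t.
  · refine aestronglyMeasurable_of_tendsto_ae atTop
      (f := fun n t => specMul ι (s n) (fun l => 1 + l) (greenOp ι (v t)))
      (fun n => ?_) (Eventually.of_forall fun t => ?_)
    · exact ((specMul ι (s n) fun l => 1 + l).continuous.comp_continuousOn
        (h.continuousOn_green.mono hsub)).aestronglyMeasurable measurableSet_Ioo
    · have := hsum (fun l => specProj ι l (v t)) (v t)
        (fun l hl => specProj_eq_zero_of_specSpace_eq_bot hl _) (hι.hasSum_specProj (v t))
      refine this.congr fun n => ?_
      rw [specMul_apply]
      refine Finset.sum_congr rfl fun l hl => ?_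
      have := hs n l hl
      rw [specProj_greenOp, smul_smul, mul_inv_cancel₀ (by positivity), one_smul]

end Measurability

theorem setLIntegral_Ioo_lt_top {F : ℝ → ℝ≥0∞} {C : ℝ≥0∞} (hC : C ≠ ⊤)
    (h : ∀ t : ℝ, 0 ≤ t → ∫⁻ s in Ioc t (t + 1), F s ≤ C) (T : ℝ) : ∫⁻ s in Ioo 0 T, F s < ⊤ := by
  obtain ⟨N, hN⟩ := exists_nat_gt T
  have hsub : Ioo 0 T ⊆ ⋃ n : Fin N, Ioc ((n : ℕ) : ℝ) ((n : ℕ) + 1) := fun t ht => by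
    -- The windows are open on the left, so t belongs to the one starting at ⌈t⌉₊ - 1.
    have h1 : 0 < ⌈t⌉₊ := Nat.ceil_pos.2 ht.1
    have h2 : ⌈t⌉₊ ≤ N := Nat.ceil_le.2 (ht.2.trans hN).le
    have h3 : ((⌈t⌉₊ - 1 : ℕ) : ℝ) = ⌈t⌉₊ - 1 := by rw [Nat.cast_sub h1]; simp
    refine mem_iUnion.2 ⟨⟨⌈t⌉₊ - 1, by omega⟩, ?_, ?_⟩
    · rw [h3]; linarith [Nat.ceil_lt_add_one ht.1.le]
    · rw [h3]; linarith [Nat.le_ceil t]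
  calc ∫⁻ s in Ioo 0 T, F s ≤ ∫⁻ s in ⋃ n : Fin N, Ioc ((n : ℕ) : ℝ) ((n : ℕ) + 1), F s :=
        lintegral_mono_set hsub
    _ ≤ ∑' n : Fin N, ∫⁻ s in Ioc ((n : ℕ) : ℝ) ((n : ℕ) + 1), F s := lintegral_iUnion_le _ _
    _ ≤ ∑' _ : Fin N, C := ENNReal.tsum_le_tsum fun n => h _ (Nat.cast_nonneg _)
    _ < ⊤ := by
        rw [tsum_fintype, Finset.sum_const, nsmul_eq_mul]
        exact ENNReal.mul_lt_top (by simp) hC.lt_top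

namespace Problem

variable {P : Problem}

theorem separableSpace_L2 (P : Problem) : TopologicalSpace.SeparableSpace P.L2 := by
  have : Fact ((2 : ℝ≥0∞) ≠ ⊤) := ⟨ENNReal.ofNat_ne_top⟩
  infer_instance

theorem norm_sq_Energy_eq (ξ : P.Energy) : ‖ξ‖ ^ 2 = ‖ξ.fst‖ ^ 2 + ‖ξ.snd‖ ^ 2 :=
  WithLp.prod_norm_sq_eq_of_L2 ξ

/-- Solutions of the abstract equation are weak energy solutions. -/
theorem isWeakEnergySolution_of_isLimitSolution (hP : P.IsAdmissible) {f : ℝ → ℝ} {γ α : ℝ}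
    {g : P.L2} {ξ₀ : P.Energy} {U : ℝ → P.H1} {v : ℝ → P.L2}
    (h : IsLimitSolution P.embed γ α (fun w z => ∫ x, f (P.embed w x) * P.embed z x ∂P.μ) g
      ξ₀.fst ξ₀.snd U v) {C : ℝ}
    (hC : ∀ t, 0 ≤ t → ENNReal.ofReal (‖U t‖ ^ 2) + ENNReal.ofReal (‖v t‖ ^ 2) +
      ∫⁻ τ in Ioc t (t + 1), specNormSq P.embed (1 / 2) (v τ) ≤ ENNReal.ofReal C) :
    P.IsWeakEnergySolution f γ α g ξ₀ fun t => WithLp.toLp 2 (U t, v t) := by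
  have hsep := P.separableSpace_L2
  have hι := isCompactEmbedding_embed hP
  refine ⟨fun T hT => ?_, fun T hT φ hφ => ?_, fun T hT => ?_, fun η => ?_, ?_, fun T hT φ hφ => ?_⟩
  · obtain ⟨hU, hv⟩ := h.aestronglyMeasurable hι T
    refine memLp_top_of_bound ((WithLp.prod_continuous_toLp 2 P.H1
      P.L2).comp_aestronglyMeasurable (hU.prodMk hv)) (√C) ?_
    filter_upwards [ae_restrict_mem measurableSet_Ioo] with t ht
    have h1 := le_self_add.trans (hC t ht.1.le)
    rw [← ENNReal.ofReal_add (by positivity) (by positivity)] at h1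
    have h2 : ‖(WithLp.toLp 2 (U t, v t) : P.Energy)‖ ^ 2 = ‖U t‖ ^ 2 + ‖v t‖ ^ 2 :=
      norm_sq_Energy_eq _
    rw [← h2] at h1
    rcases le_or_gt 0 C with h0 | h0
    · exact Real.le_sqrt_of_sq_le ((ENNReal.ofReal_le_ofReal_iff h0).1 h1)
    · rw [ENNReal.ofReal_of_nonpos h0.le, nonpos_iff_eq_zero, ENNReal.ofReal_eq_zero] at h1
      have h3 : ‖(WithLp.toLp 2 (U t, v t) : P.Energy)‖ = 0 :=
        pow_eq_zero_iff two_ne_zero |>.1 (le_antisymm h1 (sq_nonneg _))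
      rw [h3]
      exact Real.sqrt_nonneg _
  · simp only [inner_testVelocity hP hφ, inner_embed_testPath hP hφ]
    exact h.time_deriv T hT _ _ (isTestPath_testPath hP hφ)
  · simp only [hsNormSq_eq hP]
    exact setLIntegral_Ioo_lt_top ENNReal.ofReal_ne_top
      (fun t ht => le_add_self.trans (hC t ht)) T
  · have e : ∀ t, ⟪η, (WithLp.toLp 2 (U t, v t) : P.Energy)⟫_ℝ =
        ⟪η.fst, U t⟫_ℝ + ⟪η.snd, v t⟫_ℝ := fun t => WithLp.prod_inner_apply _ _
    simp only [e]
    exact (h.weak_fst _).add (h.weak_snd _)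
  · simp only [h.initial_fst, h.initial_snd]
    rfl
  · have e : ∀ t, ∫ x in P.domain, f ((H1.toL2 (WithLp.toLp 2 (U t, v t) : P.Energy).fst) x) * φ (t, x) =
        ∫ x, f (P.embed (U t) x) * P.embed (testPath hP hφ t) x ∂P.μ := fun t => by
      refine integral_congr_ae ?_
      filter_upwards [toL2_testElement hP (hφ.isTest t)] with x hx
      rw [testPath, embed_apply, embed_apply, hx]
      rfl
    have e2 : ∀ t, P.classL2 (fun x => φ (t, x)) = P.embed (testPath hP hφ t) :=
      fun t => classL2_eq_embed hP (hφ.isTest t)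
    simp only [inner_testVelocity hP hφ, inner_embed_testPath hP hφ, inner_gradL_testPath hP hφ,
      e, e2, fracLap_half_eq hP]
    exact h.equation T hT _ _ (isTestPath_testPath hP hφ)

end Problem

end DampedWave

end

/-! ### Assembly of the theorem -/

theorem theorem2p1 (P : DampedWave.Problem) (hP : P.IsAdmissible)
    (f : ℝ → ℝ) (hf : DampedWave.IsQuinticDissipative f)
    (α γ : ℝ) (hα : 0 < α) (hγ : 0 < γ) :
    ∃ (β : ℝ) (Q : ℝ → ℝ), 0 < β ∧ Monotone Q ∧
      ∀ (g : P.L2) (ξ₀ : P.Energy), ∃ ξ : ℝ → P.Energy,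
        P.IsWeakEnergySolution f γ α g ξ₀ ξ ∧
        ∀ t : ℝ, 0 ≤ t →
          ENNReal.ofReal (‖ξ t‖ ^ 2)
              + ∫⁻ s in Ioc t (t + 1), P.hsNormSq (1 / 2) (ξ s).snd
            ≤ ENNReal.ofReal (Q ‖ξ₀‖ * Real.exp (-β * t) + Q ‖g‖) := by
  open DampedWave DampedWave.Problem in
  have hfin := isFiniteMeasure hP
  have hsep := P.separableSpace_L2
  obtain ⟨S, hS, hint, hsob⟩ := exists_sobolev hP
  obtain ⟨G, Φ, ε, κ, C, hε, hκ, hC, happ⟩ := hf.exists_isApproximation hS hint hsob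
  obtain ⟨β, M, hβ, hM, hex⟩ := exists_isLimitSolution (isCompactEmbedding_embed hP) happ hε hκ hC
    hα hγ
  -- The sixth power comes from the potential of the initial data, controlled through the Sobolev
  -- embedding. The forcing enters only quadratically, but one Q serves both terms; `max x 0` makes
  -- it monotone on all of ℝ.
  refine ⟨β, fun x => M * (2 + 2 * max x 0 ^ 6), hβ, fun x y hxy => ?_, fun g ξ₀ => ?_⟩
  · have := max_le_max_right 0 hxy
    have h0 : 0 ≤ max x 0 := le_max_right _ _
    simp only
    gcongr
  obtain ⟨U, v, hsol, hest⟩ := hex g ξ₀.fst ξ₀.snd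
  have hle : ∀ t, 0 ≤ t → M * ((1 + ‖ξ₀.fst‖ ^ 6 + ‖ξ₀.snd‖ ^ 2) * Real.exp (-β * t) + 1 +
      ‖g‖ ^ 2) ≤ M * (2 + 2 * max ‖ξ₀‖ 0 ^ 6) * Real.exp (-β * t) +
        M * (2 + 2 * max ‖g‖ 0 ^ 6) := fun t _ => by
    rw [max_eq_left (norm_nonneg _), max_eq_left (norm_nonneg _)]
    have h1 := norm_sq_Energy_eq ξ₀
    have h2 : ‖ξ₀.fst‖ ≤ ‖ξ₀‖ :=
      le_of_sq_le_sq (by rw [h1]; linarith [sq_nonneg ‖ξ₀.snd‖]) (norm_nonneg _)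
    have h3 : ‖ξ₀.fst‖ ^ 6 ≤ ‖ξ₀‖ ^ 6 := by gcongr
    have h4 : ∀ x : ℝ, x ^ 2 ≤ 1 + x ^ 6 := fun x => by
      nlinarith [sq_nonneg (x ^ 2 - 1), sq_nonneg x, sq_nonneg (x ^ 3)]
    have h5 : ‖ξ₀.snd‖ ^ 2 ≤ 1 + ‖ξ₀‖ ^ 6 :=
      le_trans (by rw [h1]; linarith [sq_nonneg ‖ξ₀.fst‖]) (h4 ‖ξ₀‖)
    have h6 : ‖g‖ ^ 2 ≤ 1 + ‖g‖ ^ 6 := h4 ‖g‖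
    have h7 : 0 ≤ ‖g‖ ^ 6 := by positivity
    have h8 : (1 + ‖ξ₀.fst‖ ^ 6 + ‖ξ₀.snd‖ ^ 2) * Real.exp (-β * t) ≤
        (2 + 2 * ‖ξ₀‖ ^ 6) * Real.exp (-β * t) :=
      mul_le_mul_of_nonneg_right (by linarith) (Real.exp_pos _).le
    calc _ ≤ M * ((2 + 2 * ‖ξ₀‖ ^ 6) * Real.exp (-β * t) + (2 + 2 * ‖g‖ ^ 6)) :=
          mul_le_mul_of_nonneg_left (by linarith) hM.le
      _ = _ := by ring
  refine ⟨fun t => WithLp.toLp 2 (U t, v t), isWeakEnergySolution_of_isLimitSolution hP hsol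
    (C := M * ((1 + ‖ξ₀.fst‖ ^ 6 + ‖ξ₀.snd‖ ^ 2) + 1 + ‖g‖ ^ 2)) fun t ht => ?_, fun t ht => ?_⟩
  · refine (hest t ht).trans (ENNReal.ofReal_le_ofReal ?_)
    have h1 : Real.exp (-β * t) ≤ 1 := Real.exp_le_one_iff.2 (by nlinarith)
    have h2 : (1 + ‖ξ₀.fst‖ ^ 6 + ‖ξ₀.snd‖ ^ 2) * Real.exp (-β * t) ≤
        1 + ‖ξ₀.fst‖ ^ 6 + ‖ξ₀.snd‖ ^ 2 := mul_le_of_le_one_right (by positivity) h1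
    exact mul_le_mul_of_nonneg_left (by linarith) hM.le
  · have h1 : ‖(WithLp.toLp 2 (U t, v t) : P.Energy)‖ ^ 2 = ‖U t‖ ^ 2 + ‖v t‖ ^ 2 :=
      norm_sq_Energy_eq _
    simp only [h1, hsNormSq_eq hP]
    rw [ENNReal.ofReal_add (by positivity) (by positivity)]
    exact (hest t ht).trans (ENNReal.ofReal_le_ofReal (hle t ht))
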